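/- Let $S\subset\mathbb Z$ be a non-empty interval of integers (finite or infinite) and let $\boldsymbol n=\{n_s\}_{s\in S}\subset\mathbb Z$ with $n_s<n_{s+1}$ whenever $s,s+1\in S$; put $m_s=n_{s+1}-n_s$. *The hierarchy.* Let $R=\mathbb C[[t_1,t_2,\dots]]$, let $K=\operatorname{Frac}R$, and let $\partial=\partial/\partial t_1$ (the variable $x$ occurs only in the combination $t_1+x$ and is absorbed into $t_1$). Formal micro-differential operators are the series $\sum_{i\le N}a_i\partial^i$, $a_i\in K$, multiplied by $\partial^i\circ b=\sum_{k\ge0}\binom ik(\partial^kb)\,\partial^{i-k}$; $(\cdot)_{<0}$ denotes the part of negative order and $\partial/\partial t_n$ acts on an operator coefficientwise. A solution of the $\boldsymbol n$-modified KP hierarchy is a family $(W(t;s))_{s\in S}$ of monic operators of order $0$, $$W(t;s)=1+w_1(t;s)\partial^{-1}+w_2(t;s)\partial^{-2}+\cdots ,$$ such that for each $s$ the coefficients $w_j(t;s)\in K$ have a common denominator (there is $0\ne\tau\in R$ with $\tau w_j(t;s)\in R$ for all $j$), and $$\frac{\partial W(s)}{\partial t_n}=-\bigl(W(s)\,\partial^n\,W(s)^{-1}\bigr)_{<0}W(s)\quad(s\in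 S,\ n\ge1),\qquad \bigl(W(s+1)\,\partial^{m_s}\,W(s)^{-1}\bigr)_{<0}=0\quad(s,s+1\in S).$$ *The flag variety.* Let $\mathcal V$ be the complex vector space of formal sums $\sum_{\nu\in\mathbb Z}c_\nu e_\nu$ with $c_\nu=0$ for $\nu\ll0$, and let $\mathcal V^{(0)}=\{\sum_{\nu\ge0}c_\nu e_\nu\}$. The Sato Grassmann manifold $\mathrm{SGM}^{(n)}$ of charge $n$ is the set of subspaces $U\subset\mathcal V$ for which $U\to\mathcal V/\mathcal V^{(0)}$ has finite-dimensional kernel and cokernel and index $\dim\ker-\dim\operatorname{coker}=n$. Let $$\mathrm{Flag}_{\boldsymbol n}=\{(U_s)_{s\in S}\mid U_s\in\mathrm{SGM}^{(n_s)},\ U_s\subset U_{s+1}\}.$$ *Proposition.* The solutions of the $\boldsymbol n$-modified KP hierarchy are parametrised by $\mathrm{Flag}_{\boldsymbol n}$: the map $(W(s))_{s\in S}\mapsto(U_s)_{s\in S}$, $$U_s=\Bigl\{\sum_\nu c_\nu e_\nu\in\mathcal V\ \Bigm|\ \operatorname{Res}_\lambda\Bigl(w(t;s;\lambda)\sum_\nu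 c_\nu\lambda^{-\nu-1}\Bigr)d\lambda=0\Bigr\},$$ $$w(t;s;\lambda)=W(s)\,\partial^{n_s}e^{\xi(t;\lambda)}=\Bigl(1+\sum_{j\ge1}w_j(t;s)\lambda^{-j}\Bigr)\lambda^{n_s}e^{\xi(t;\lambda)},\qquad \xi(t;\lambda)=\sum_{n\ge1}t_n\lambda^n,$$ is a bijection from the set of solutions onto $\mathrm{Flag}_{\boldsymbol n}$. Here $\operatorname{Res}_\lambda$ is the coefficient of $\lambda^{-1}$, and the condition is read in $R$ after multiplication by a common denominator $\tau$ of the $w_j(t;s)$. -/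

import Mathlib

namespace MKP

noncomputable section

/-! ### The differential field of coefficients -/

/-- Formal power series `ℂ[[t₁, t₂, t₃, …]]` in the times. The variable `x` of the hierarchy occurs
only in the combination `t₁ + x` and is absorbed into `t₁`. -/
abbrev TimeSeries : Type := MvPowerSeries ℕ+ ℂ

/-- Formal meromorphic functions of the times: the field of fractions of `ℂ[[t₁, t₂, …]]`. -/
abbrev TimeField : Type := FractionRing TimeSeries

/-- The ring homomorphism `f ↦ f + ε ∂f/∂tₙ` into the dual numbers over the field of fractions. -/
def timeJet (n : ℕ+) : TimeSeries →+* TrivSqZeroExt TimeField TimeField where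
  toFun f := TrivSqZeroExt.inl (algebraMap TimeSeries TimeField f) +
    TrivSqZeroExt.inr (algebraMap TimeSeries TimeField (MvPowerSeries.pderiv ℂ n f))
  map_one' := by
    rw [Derivation.map_one_eq_zero]
    apply TrivSqZeroExt.ext <;> simp
  map_zero' := by
    apply TrivSqZeroExt.ext <;> simp
  map_mul' f g := by
    rw [Derivation.leibniz, smul_eq_mul, smul_eq_mul, map_add, map_mul, map_mul, map_mul]
    apply TrivSqZeroExt.ext
    · simp
    · simp only [TrivSqZeroExt.snd_add, TrivSqZeroExt.snd_inl, TrivSqZeroExt.snd_inr,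
        TrivSqZeroExt.snd_mul, TrivSqZeroExt.fst_add, TrivSqZeroExt.fst_inl,
        TrivSqZeroExt.fst_inr, smul_eq_mul, MulOpposite.smul_eq_mul_unop, MulOpposite.unop_op]
      ring
  map_add' f g := by
    rw [map_add, map_add, map_add]
    apply TrivSqZeroExt.ext
    · simp
    · simp only [TrivSqZeroExt.snd_add, TrivSqZeroExt.snd_inl, TrivSqZeroExt.snd_inr]
      ring

theorem fst_timeJet (n : ℕ+) (f : TimeSeries) :
    (timeJet n f).fst = algebraMap TimeSeries TimeField f := by
  change (TrivSqZeroExt.inl _ + TrivSqZeroExt.inr _ : TrivSqZeroExt TimeField TimeField).fst = _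
  rw [TrivSqZeroExt.fst_add, TrivSqZeroExt.fst_inl, TrivSqZeroExt.fst_inr, add_zero]

theorem snd_timeJet (n : ℕ+) (f : TimeSeries) :
    (timeJet n f).snd = algebraMap TimeSeries TimeField (MvPowerSeries.pderiv ℂ n f) := by
  change (TrivSqZeroExt.inl _ + TrivSqZeroExt.inr _ : TrivSqZeroExt TimeField TimeField).snd = _
  rw [TrivSqZeroExt.snd_add, TrivSqZeroExt.snd_inl, TrivSqZeroExt.snd_inr, zero_add]

theorem isUnit_timeJet (n : ℕ+) (y : nonZeroDivisors TimeSeries) : IsUnit (timeJet n y) := by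
  rw [TrivSqZeroExt.isUnit_iff_isUnit_fst, fst_timeJet]
  exact IsLocalization.map_units TimeField y

/-- The extension of `timeJet n` to the field of fractions. -/
def fieldJet (n : ℕ+) : TimeField →+* TrivSqZeroExt TimeField TimeField :=
  IsLocalization.lift (M := nonZeroDivisors TimeSeries) (isUnit_timeJet n)

/-- The partial derivative `∂/∂tₙ` on the field of fractions. -/
def dt (n : ℕ+) (f : TimeField) : TimeField := (fieldJet n f).snd

/-- `dt n` extends the partial derivative of formal power series. -/
theorem dt_algebraMap (n : ℕ+) (f : TimeSeries) :
    dt n (algebraMap TimeSeries TimeField f) =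
      algebraMap TimeSeries TimeField (MvPowerSeries.pderiv ℂ n f) := by
  rw [dt, fieldJet, IsLocalization.lift_eq, snd_timeJet]

theorem dt_zero (n : ℕ+) : dt n 0 = 0 := by simp [dt]

theorem dt_add (n : ℕ+) (f g : TimeField) : dt n (f + g) = dt n f + dt n g := by simp [dt]

theorem fst_fieldJet (n : ℕ+) (f : TimeField) : (fieldJet n f).fst = f := by
  have h : (TrivSqZeroExt.fstHom ℂ TimeField TimeField).toRingHom.comp (fieldJet n)
      = RingHom.id TimeField := by
    apply IsLocalization.ringHom_ext (nonZeroDivisors TimeSeries)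
    ext f
    change (IsLocalization.lift (M := nonZeroDivisors TimeSeries) (isUnit_timeJet n)
      (algebraMap TimeSeries TimeField f)).fst = algebraMap TimeSeries TimeField f
    rw [IsLocalization.lift_eq, fst_timeJet]
  exact congrArg (fun φ : TimeField →+* TimeField => φ f) h

/-- `dt n` satisfies the Leibniz rule. -/
theorem dt_mul (n : ℕ+) (f g : TimeField) : dt n (f * g) = f * dt n g + g * dt n f := by
  simp [dt, fst_fieldJet, mul_comm]

/-! ### Micro-differential operators -/

/-- A formal micro-differential operator `∑ᵢ aᵢ ∂ⁱ` (`i ∈ ℤ`, `aᵢ = 0` for `i` large), where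
`∂ = ∂/∂x = ∂/∂t₁`, with coefficients in the field of fractions of `ℂ[[t]]`. -/
@[ext]
structure MicroDiffOp where
  /-- the coefficient `aᵢ` of `∂ⁱ` -/
  coeff : ℤ → TimeField
  bounded : ∃ N : ℤ, ∀ i, N < i → coeff i = 0

namespace MicroDiffOp

/-- The contribution of `(aᵢ ∂ⁱ) ∘ (bⱼ ∂ʲ)` to the coefficient of `∂ᵐ`; here `p = (i, k)` and
`j = m - i + k`, by the rule `∂ⁱ ∘ b = ∑ₖ (i choose k) (∂ᵏ b) ∂ⁱ⁻ᵏ`. -/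
def mulTerm (A B : MicroDiffOp) (m : ℤ) (p : ℤ × ℕ) : TimeField :=
  (Ring.choose p.1 p.2 : ℤ) • (A.coeff p.1 * (dt 1)^[p.2] (B.coeff (m - p.1 + p.2)))

theorem iterate_dt_zero (n : ℕ+) (k : ℕ) : (dt n)^[k] 0 = 0 :=
  Function.iterate_fixed (dt_zero n) k

theorem mulTerm_eq_zero {A B : MicroDiffOp} {N M : ℤ} (hA : ∀ i, N < i → A.coeff i = 0)
    (hB : ∀ i, M < i → B.coeff i = 0) (m : ℤ) (p : ℤ × ℕ)
    (hp : N < p.1 ∨ M < m - p.1 + p.2) : mulTerm A B m p = 0 := by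
  rcases hp with h | h
  · simp [mulTerm, hA _ h]
  · simp [mulTerm, hB _ h, iterate_dt_zero]

/-- Every coefficient of a composition is a finite sum. -/
theorem mulTerm_support_finite (A B : MicroDiffOp) (m : ℤ) :
    (Function.support (mulTerm A B m)).Finite := by
  obtain ⟨N, hN⟩ := A.bounded
  obtain ⟨M, hM⟩ := B.bounded
  refine Set.Finite.subset
    (Set.Finite.prod (Set.finite_Icc (m - M) N) (Set.finite_Iic (M - m + N).toNat)) ?_
  intro p hp
  have h := mt (mulTerm_eq_zero hN hM m p) hp
  push Not at h
  simp only [Set.mem_prod, Set.mem_Icc, Set.mem_Iic]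
  omega

/-- Composition of micro-differential operators. -/
instance : Mul MicroDiffOp where
  mul A B :=
    { coeff := fun m => ∑ᶠ p : ℤ × ℕ, mulTerm A B m p
      bounded := by
        obtain ⟨N, hN⟩ := A.bounded
        obtain ⟨M, hM⟩ := B.bounded
        refine ⟨N + M, fun m hm => ?_⟩
        rw [finsum_congr (g := fun _ => (0 : TimeField)), finsum_zero]
        intro p
        exact mulTerm_eq_zero hN hM m p (by omega) }

/-- The operator `∂ⁿ`, `n ∈ ℤ`. -/
def del (n : ℤ) : MicroDiffOp where
  coeff i := if i = n then 1 else 0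
  bounded := ⟨n, fun i hi => if_neg (by omega)⟩

/-- The identity operator `1 = ∂⁰`. -/
instance : One MicroDiffOp := ⟨del 0⟩

instance : Neg MicroDiffOp where
  neg A :=
    { coeff := fun i => -A.coeff i
      bounded := by
        obtain ⟨N, hN⟩ := A.bounded
        exact ⟨N, fun i hi => by simp [hN i hi]⟩ }

/-- The projection `(·)_{<0}` to the part of negative order. -/
def negPart (A : MicroDiffOp) : MicroDiffOp where
  coeff i := if i < 0 then A.coeff i else 0
  bounded := ⟨0, fun i hi => if_neg (by omega)⟩

/-- The zero operator. -/
instance : Zero MicroDiffOp := ⟨⟨fun _ => 0, 0, fun _ _ => rfl⟩⟩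

/-- `∂A/∂tₙ`: differentiation of the coefficients. -/
def timeDeriv (n : ℕ+) (A : MicroDiffOp) : MicroDiffOp where
  coeff i := dt n (A.coeff i)
  bounded := by
    obtain ⟨N, hN⟩ := A.bounded
    exact ⟨N, fun i hi => by rw [hN i hi, dt_zero]⟩

/-- `A` is monic of order `0`: `A = 1 + w₁ ∂⁻¹ + w₂ ∂⁻² + ⋯`. -/
def IsWaveOperator (A : MicroDiffOp) : Prop :=
  A.coeff 0 = 1 ∧ ∀ i, 0 < i → A.coeff i = 0

/-- `(τ, a)` clears the denominators of `A = ∑_{j ≥ 0} w_j ∂⁻ʲ`: `τ, a_j ∈ ℂ[[t]]` and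
`a_j = τ w_j` for all `j ≥ 0`. -/
def Clears (A : MicroDiffOp) (τ : TimeSeries) (a : ℕ → TimeSeries) : Prop :=
  ∀ j : ℕ, algebraMap TimeSeries TimeField (a j) =
    algebraMap TimeSeries TimeField τ * A.coeff (-(j : ℤ))

/-- The coefficients `w_j` of `A = ∑_{j ≥ 0} w_j ∂⁻ʲ` have a common denominator in `ℂ[[t]]`. -/
def IsMeromorphic (A : MicroDiffOp) : Prop :=
  ∃ (τ : TimeSeries) (a : ℕ → TimeSeries), τ ≠ 0 ∧ A.Clears τ a

end MicroDiffOp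

/-! ### The hierarchy -/

open MicroDiffOp in
/-- The solutions `(W(t;s))_{s ∈ S}` of the `𝐧`-mKP hierarchy in terms of wave operators, where
`𝐧 = {n_s}_{s ∈ S}`:
`∂W(s)/∂tₙ = - (W(s) ∂ⁿ W(s)⁻¹)_{<0} W(s)` and
`(W(s+1) ∂^{m_s} W(s)⁻¹)_{<0} = 0` with `m_s = n_{s+1} - n_s` whenever `s, s+1 ∈ S`.
`V s` is the inverse of `W s`. -/
def Solutions {S : Set ℤ} (n : S → ℤ) : Set (S → MicroDiffOp) :=
  {W | (∀ s, (W s).IsWaveOperator ∧ (W s).IsMeromorphic) ∧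
    ∃ V : S → MicroDiffOp, (∀ s, W s * V s = 1 ∧ V s * W s = 1) ∧
      (∀ (s : S) (k : ℕ+),
        timeDeriv k (W s) = -(negPart (W s * del (k : ℕ) * V s) * W s)) ∧
      (∀ s s' : S, (s' : ℤ) = s + 1 → negPart (W s' * del (n s' - n s) * V s) = 0)}

/-! ### The flag variety -/

/-- Formal sums `∑_ν c_ν e_ν` (`ν ∈ ℤ`) with `c_ν = 0` for `ν ≪ 0`, as a space of coefficient
families. -/
def satoSubmodule : Submodule ℂ (ℤ → ℂ) where
  carrier := {c | ∃ N : ℤ, ∀ ν, ν < N → c ν = 0}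
  zero_mem' := ⟨0, fun _ _ => rfl⟩
  add_mem' := by
    rintro c d ⟨N, hN⟩ ⟨M, hM⟩
    exact ⟨min N M, fun ν hν => by
      simp [hN ν (lt_of_lt_of_le hν (min_le_left _ _)),
        hM ν (lt_of_lt_of_le hν (min_le_right _ _))]⟩
  smul_mem' := by
    rintro z c ⟨N, hN⟩
    exact ⟨N, fun ν hν => by simp [hN ν hν]⟩

/-- The completion of `⨁_ν ℂ e_ν` on which micro-differential operators act. -/
def SatoSpace : Type := satoSubmodule

instance : AddCommGroup SatoSpace := inferInstanceAs (AddCommGroup satoSubmodule)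

instance : Module ℂ SatoSpace := inferInstanceAs (Module ℂ satoSubmodule)

/-- The coefficient `c_ν` of `e_ν` in `u = ∑_ν c_ν e_ν`. -/
def SatoSpace.coeff (u : SatoSpace) (ν : ℤ) : ℂ := u.1 ν

@[simp] theorem SatoSpace.coeff_zero (ν : ℤ) : (0 : SatoSpace).coeff ν = 0 := rfl

@[simp] theorem SatoSpace.coeff_add (u v : SatoSpace) (ν : ℤ) :
    (u + v).coeff ν = u.coeff ν + v.coeff ν := rfl

@[simp] theorem SatoSpace.coeff_smul (c : ℂ) (u : SatoSpace) (ν : ℤ) :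
    (c • u).coeff ν = c * u.coeff ν := rfl

/-- `𝒱⁽⁰⁾`: the sums `∑_{ν ≥ 0} c_ν e_ν`. -/
def SatoSpaceZero : Submodule ℂ SatoSpace where
  carrier := {u | ∀ ν : ℤ, ν < 0 → u.coeff ν = 0}
  zero_mem' := fun _ _ => rfl
  add_mem' := by
    intro u v hu hv ν hν
    simp [hu ν hν, hv ν hν]
  smul_mem' := by
    intro c u hu ν hν
    simp [hu ν hν]

/-- The natural map `U → 𝒱 / 𝒱⁽⁰⁾`. -/
def projMap (U : Submodule ℂ SatoSpace) : U →ₗ[ℂ] SatoSpace ⧸ SatoSpaceZero :=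
  SatoSpaceZero.mkQ ∘ₗ U.subtype

/-- The Sato Grassmann manifold of charge `n`: the subspaces `U` for which `U → 𝒱 / 𝒱⁽⁰⁾` has
finite-dimensional kernel and cokernel and index `dim ker - dim coker = n`. -/
def SatoGrassmannian (n : ℤ) : Set (Submodule ℂ SatoSpace) :=
  {U | FiniteDimensional ℂ (LinearMap.ker (projMap U)) ∧
    FiniteDimensional ℂ ((SatoSpace ⧸ SatoSpaceZero) ⧸ LinearMap.range (projMap U)) ∧
    (Module.finrank ℂ (LinearMap.ker (projMap U)) : ℤ) -
      Module.finrank ℂ ((SatoSpace ⧸ SatoSpaceZero) ⧸ LinearMap.range (projMap U)) = n}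

/-- The flag variety: families `(U_s)_{s ∈ S}` with `U_s` in the Sato Grassmann manifold of charge
`n_s` and `U_s ⊂ U_{s+1}`. -/
def Flag {S : Set ℤ} (n : S → ℤ) : Set (S → Submodule ℂ SatoSpace) :=
  {U | (∀ s, U s ∈ SatoGrassmannian (n s)) ∧ ∀ s s' : S, (s' : ℤ) = s + 1 → U s ≤ U s'}

/-! ### From wave operators to subspaces -/

/-- The coefficient `h_k(t)` of `λᵏ` in `e^{ξ(t;λ)}`, `ξ(t;λ) = ∑_{n ≥ 1} tₙ λⁿ`: the sum of
`∏ₙ tₙ^{αₙ} / αₙ!` over all `α` with `∑ₙ n αₙ = k`. -/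
def expXi (k : ℕ) : TimeSeries := fun α =>
  if (α.sum fun n a => (n : ℕ) * a) = k then α.prod fun _ a => ((Nat.factorial a : ℂ))⁻¹ else 0

/-- The contribution of `a_j λ^{n-j}`, `h_k(t) λᵏ` and `c_{n-j+k} λ^{-(n-j+k)-1}` to the coefficient
of `tᵅ λ⁻¹` in the product in `residue`; here `p = (j, k)`. -/
def residueTerm (n : ℤ) (a : ℕ → TimeSeries) (u : SatoSpace) (α : ℕ+ →₀ ℕ) (p : ℕ × ℕ) : ℂ :=
  MvPowerSeries.coeff α (a p.1 * expXi p.2) * u.coeff (n - p.1 + p.2)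

theorem residueTerm_support_finite (n : ℤ) (a : ℕ → TimeSeries) (u : SatoSpace) (α : ℕ+ →₀ ℕ) :
    (Function.support (residueTerm n a u α)).Finite := by
  classical
  obtain ⟨N, hN⟩ : ∃ N : ℤ, ∀ ν, ν < N → u.coeff ν = 0 := u.2
  -- the degree in `λ` is bounded by the weights of the finitely many exponents below `α`
  obtain ⟨K, hK⟩ : ∃ K : ℕ, ∀ β ∈ Finset.HasAntidiagonal.antidiagonal α,
      (β.2.sum fun n a => (n : ℕ) * a) ≤ K :=
    ⟨(Finset.HasAntidiagonal.antidiagonal α).sup fun β => β.2.sum fun n a => (n : ℕ) * a,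
      fun β hβ => Finset.le_sup
        (f := fun β : (ℕ+ →₀ ℕ) × (ℕ+ →₀ ℕ) => β.2.sum fun n a => (n : ℕ) * a) hβ⟩
  refine Set.Finite.subset
    (Set.Finite.prod (Set.finite_Iic (n + K - N).toNat) (Set.finite_Iic K)) ?_
  intro p hp
  have hk : p.2 ≤ K := by
    by_contra hlt
    apply hp
    have h0 : MvPowerSeries.coeff α (a p.1 * expXi p.2) = 0 := by
      rw [MvPowerSeries.coeff_mul]
      refine Finset.sum_eq_zero fun β hβ => ?_
      have hne : ¬ (β.2.sum fun n a => (n : ℕ) * a) = p.2 := by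
        have := hK β hβ
        omega
      have h1 : MvPowerSeries.coeff β.2 (expXi p.2) = 0 := if_neg hne
      rw [h1, mul_zero]
    simp [residueTerm, h0]
  have hc : N ≤ n - p.1 + p.2 := by
    by_contra hlt
    apply hp
    simp [residueTerm, hN _ (not_le.mp hlt)]
  simp only [Set.mem_prod, Set.mem_Iic]
  omega

/-- The formal residue, i.e. the coefficient of `λ⁻¹`, of
`(∑_{j ≥ 0} a_j λ^{n-j}) e^{ξ(t;λ)} u(λ)`, where `u(λ) = ∑_ν c_ν λ^{-ν-1}` for
`u = ∑_ν c_ν e_ν`. It is an element of `ℂ[[t]]`. -/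
def residue (n : ℤ) (a : ℕ → TimeSeries) (u : SatoSpace) : TimeSeries := fun α =>
  ∑ᶠ p : ℕ × ℕ, residueTerm n a u α p

theorem residue_add (n : ℤ) (a : ℕ → TimeSeries) (u v : SatoSpace) :
    residue n a (u + v) = residue n a u + residue n a v := by
  funext α
  have h : residueTerm n a (u + v) α = fun p => residueTerm n a u α p + residueTerm n a v α p := by
    funext p
    simp [residueTerm, mul_add]
  change ∑ᶠ p, residueTerm n a (u + v) α p =
    (∑ᶠ p, residueTerm n a u α p) + ∑ᶠ p, residueTerm n a v α p
  rw [h]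
  exact finsum_add_distrib (residueTerm_support_finite n a u α)
    (residueTerm_support_finite n a v α)

theorem residue_smul (n : ℤ) (a : ℕ → TimeSeries) (c : ℂ) (u : SatoSpace) :
    residue n a (c • u) = c • residue n a u := by
  funext α
  have h : residueTerm n a (c • u) α = fun p => c • residueTerm n a u α p := by
    funext p
    simp [residueTerm, mul_left_comm]
  change ∑ᶠ p, residueTerm n a (c • u) α p = c • ∑ᶠ p, residueTerm n a u α p
  rw [h, smul_finsum]

/-- The subspace of `𝒱` attached to a wave operator `A = ∑_{j ≥ 0} w_j ∂⁻ʲ` and a charge `n`: all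
`u` with `Res_λ (w(t;λ) u(λ)) dλ = 0`, where
`w(t;λ) = A ∂ⁿ e^{ξ(t;λ)} = (∑_{j ≥ 0} w_j λ^{n-j}) e^{ξ(t;λ)}` is the wave function. The condition
is imposed after multiplication by common denominators `τ` of the `w_j`. -/
def subspaceOf (n : ℤ) (A : MicroDiffOp) : Submodule ℂ SatoSpace where
  carrier := {u | ∀ (τ : TimeSeries) (a : ℕ → TimeSeries), A.Clears τ a → residue n a u = 0}
  zero_mem' := by
    intro τ a _
    simpa using residue_smul n a 0 0
  add_mem' := by
    intro u v hu hv τ a h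
    rw [residue_add, hu τ a h, hv τ a h, add_zero]
  smul_mem' := by
    intro c u hu τ a h
    rw [residue_smul, hu τ a h, smul_zero]

/-- The family of subspaces attached to a family of wave operators. -/
def flagOf {S : Set ℤ} (n : S → ℤ) (W : S → MicroDiffOp) : S → Submodule ℂ SatoSpace :=
  fun s => subspaceOf (n s) (W s)

end

end MKP

/-!
A wave operator `W`, or more generally an operator `A = ∑ᵢ Aᵢ ∂ⁱ`, is treated as a symbol
`A : ℤ → TimeField`. Applying `∂/∂tₖ` to `A e^{ξ(t;λ)}` amounts to the operator
`covD (dt k) k : A ↦ ∂A/∂tₖ + A ∂ᵏ` on symbols; composition with `∂` from the left is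
`covD (dt 1) 1`. Let `dSpan W` be the left module over the differential operators generated by `W`.
The Sato equations for `W` say that `dSpan W` is stable under all these operators
(`MicroDiffOp.sato_iff`), and the relation between `W` and `W'` says that `W' ∂ᵐ` lies in `dSpan W`
(`MicroDiffOp.negPart_eq_zero_iff`). The residue pairing of symbols with vectors of `𝒱` intertwines
`covD (dt k) k` with `∂/∂tₖ` (`pairing_covD`), so the symbols annihilating a subspace `U` form a
left module stable under all flows, and inclusions of subspaces correspond to inclusions of modules.
What has to be shown is that charges match: that the subspace of a solution, normalised by `λⁿ`, has
charge `n`, and that a subspace of charge `n` has enough annihilating symbols.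

*The subspace of a solution has charge `n`.* Give `tₖ` the weight `k` and let `e` be the least value
of `i + j` such that `τ w_j` has a component of weight `i`, where `τ` is a common denominator and
`w_0 = 1`. The components with `i + j = e`, divided by the lowest component of `τ`, are the
coefficients of a polynomial `P` in `λ` over the rational functions, and the hierarchy for `W`
passes to `P`, because the polynomials `(∂ + λ)ⁱ P` have distinct degrees and no cancellation can
occur (`SymLead.exists_lead_of_sum`). A comparison of the flows for `tₖ` and `t₂ₖ` shows that the
leading coefficient of `P` is constant (`ratD_leadingCoeff`). Being constant, it has weight `0`, so
`τ` itself has order `e`, and `P` is monic of degree `e` (`exists_monic_symLead`).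

For such a polynomial the module `M` spanned by the `(∂ + λ)ⁱ P` is stable under the connections
`∂/∂tₖ + λᵏ`. Since `P` depends on finitely many times, `M` contains `λᵏ P` for large `k`; the ideal
of all `g` with `λᵏ g ∈ M` for large `k` is generated by a polynomial with constant coefficients,
which has no root (a nonzero root is excluded by homogeneity, the root `0` by the definition of the
ideal), so `M` contains all high powers of `λ` (`exists_X_pow_mem`). Multiplication by `e^{ξ(t;λ)}`
trivialises the connections, and a subspace of a coordinate space stable under all `∂/∂tₖ` is
spanned by constant vectors (`mem_span_const`). Together with the homogeneity of the coefficients of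
`P e^{ξ(t;λ)}` this shows that exactly `e` of these coefficients vanish (`card_expVec_eq_zero`), and
that the lowest component of the pairing of `W` with any vector is a constant multiple of one of
these coefficients (`exists_eq_sum_expVec`, `exists_comp_pairing_eq`). Solving `⟨W, v⟩ = 0` weight
by weight, one finds a complement of the subspace consisting of all vectors supported in
`{n - e, n - e + 1, …}` with `e` positions removed (`exists_complement`), and the charge is `n`.

*Every point of the Grassmann manifold comes from a solution.* If `U` has charge `n`, a count of
equations and unknowns, after a contraction argument has eliminated all but finitely many of them,
yields a nonzero symbol of order at most `n` annihilating `U` (`exists_annihilator`). An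
annihilating symbol of minimal order `m`, normalised to be monic, generates the annihilator
(`exists_minimal_waveOperator`). The annihilator is stable under all flows, so this is a solution;
its subspace contains `U` and has charge `m ≤ n` by the first part. Since the charge is monotone and
strict inclusions change it, `m = n` and the subspace is `U` (`exists_waveOperator`). Minimality of
the order gives uniqueness (`waveOperator_unique`).
-/


namespace MKP

noncomputable section

/-! ### Covariant derivatives of symbols -/

/-- The operator `A ↦ δA + A ∂ᵏ` on symbols `A = ∑ᵢ Aᵢ ∂ⁱ`, where `δ` acts on the coefficients.
For `δ = ∂/∂tₖ` this describes how `∂/∂tₖ` acts on `A e^{ξ(t;λ)}`; for `δ = ∂` and `k = 1` it is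
composition with `∂` from the left. -/
def covD {F : Type*} [Add F] (δ : F → F) (k : ℤ) (A : ℤ → F) : ℤ → F :=
  fun i => δ (A i) + A (i - k)

/-- `A i = 0` for all `i > N`: the symbol `A` has order at most `N`. -/
def OrdLE {F : Type*} [Zero F] (N : ℤ) (A : ℤ → F) : Prop := ∀ i, N < i → A i = 0

theorem OrdLE.mono {F : Type*} [Zero F] {N M : ℤ} {A : ℤ → F} (h : OrdLE N A) (hNM : N ≤ M) :
    OrdLE M A := fun i hi => h i (by omega)

/-- `dt n` as an additive map. -/
def dtHom (n : ℕ+) : TimeField →+ TimeField := ⟨⟨dt n, dt_zero n⟩, dt_add n⟩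

theorem dt_one (n : ℕ+) : dt n 1 = 0 := by
  have h := dt_mul n 1 1
  simpa using h

theorem dt_sum {ι : Type*} (n : ℕ+) (s : Finset ι) (f : ι → TimeField) :
    dt n (∑ i ∈ s, f i) = ∑ i ∈ s, dt n (f i) := map_sum (dtHom n) f s

theorem dt_zsmul (n : ℕ+) (z : ℤ) (x : TimeField) : dt n (z • x) = z • dt n x :=
  map_zsmul (dtHom n) z x

namespace MicroDiffOp

/-- The coefficient of `∂ᵐ` in `∂ⁱ ∘ B`. -/
def dpow (i : ℤ) (B : ℤ → TimeField) (m : ℤ) : TimeField :=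
  ∑ᶠ k : ℕ, (Ring.choose i k : ℤ) • (dt 1)^[k] (B (m - i + k))

/-- The sum over the binomial expansion of `∂ⁱ ∘ B` breaks off, since `B` has bounded order. -/
theorem dpow_eq_sum {b : ℤ} {B : ℤ → TimeField} (hB : OrdLE b B) (i m : ℤ) {n : ℕ}
    (hn : b - m + i < n) :
    dpow i B m = ∑ k ∈ Finset.range n, (Ring.choose i k : ℤ) • (dt 1)^[k] (B (m - i + k)) := by
  refine finsum_eq_sum_of_support_subset _ fun k hk => ?_
  by_contra hkn
  simp only [Finset.coe_range, Set.mem_Iio, not_lt] at hkn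
  exact hk (by simp [hB (m - i + k) (by omega), iterate_dt_zero])

theorem dpow_eq_zero {b : ℤ} {B : ℤ → TimeField} (hB : OrdLE b B) {i m : ℤ} (h : i + b < m) :
    dpow i B m = 0 := by
  rw [dpow_eq_sum hB i m (n := 0) (by push_cast; omega)]
  simp

theorem dpow_zero (B : ℤ → TimeField) (m : ℤ) : dpow 0 B m = B m := by
  rw [dpow, finsum_eq_single _ 0]
  · simp
  · intro k hk
    rw [Ring.choose_zero_pos ℤ (Nat.pos_of_ne_zero hk)]
    simp

/-- `∂ⁱ⁺¹ ∘ B = ∂ ∘ (∂ⁱ ∘ B)`, by Pascal's rule. -/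
theorem dpow_succ {b : ℤ} {B : ℤ → TimeField} (hB : OrdLE b B) (i : ℤ) :
    dpow (i + 1) B = covD (dt 1) 1 (dpow i B) := by
  funext m
  obtain ⟨n, hn⟩ : ∃ n : ℕ, b - m + i + 1 < n := ⟨(b - m + i + 2).toNat, by omega⟩
  rw [covD, dpow_eq_sum hB (i + 1) m (n := n + 1) (by push_cast; omega),
    dpow_eq_sum hB i m (n := n) (by omega),
      dpow_eq_sum hB i (m - 1) (n := n + 1) (by push_cast; omega),
    Finset.sum_range_succ', Finset.sum_range_succ' (n := n), dt_sum, ← add_assoc,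
    ← Finset.sum_add_distrib]
  congr 1
  · refine Finset.sum_congr rfl fun k _ => ?_
    rw [Ring.choose_succ_succ, add_smul, dt_zsmul, ← Function.iterate_succ_apply' (dt 1) k]
    have h1 : m - (i + 1) + ((k + 1 : ℕ) : ℤ) = m - i + k := by push_cast; ring
    have h2 : m - 1 - i + ((k + 1 : ℕ) : ℤ) = m - i + k := by push_cast; ring
    rw [h1, h2]
  · simp only [Ring.choose_zero_right, Nat.cast_zero, add_zero, Function.iterate_zero, id_eq]
    congr 2; ring

theorem exists_ordLE (A : MicroDiffOp) : ∃ N, OrdLE N A.coeff := A.bounded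

theorem coeff_mul_finsum (A B : MicroDiffOp) (m : ℤ) :
    (A * B).coeff m = ∑ᶠ i, A.coeff i * dpow i B.coeff m := by
  change ∑ᶠ p : ℤ × ℕ, mulTerm A B m p = _
  rw [finsum_curry _ (mulTerm_support_finite A B m)]
  refine finsum_congr fun i => ?_
  rw [dpow, mul_finsum]
  refine finsum_congr fun k => ?_
  rw [mulTerm, mul_smul_comm]

theorem coeff_mul_eq_sum {a b : ℤ} {A B : MicroDiffOp} (hA : OrdLE a A.coeff)
    (hB : OrdLE b B.coeff) (m : ℤ) {lo hi : ℤ} (hlo : lo ≤ m - b) (hhi : a ≤ hi) :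
    (A * B).coeff m = ∑ i ∈ Finset.Icc lo hi, A.coeff i * dpow i B.coeff m := by
  rw [coeff_mul_finsum]
  refine finsum_eq_sum_of_support_subset _ fun i hi' => ?_
  by_contra hn
  simp only [Finset.coe_Icc, Set.mem_Icc, not_and_or, not_le] at hn
  refine hi' ?_
  rcases hn with h | h
  · simp [dpow_eq_zero hB (i := i) (m := m) (by omega)]
  · simp [hA i (by omega)]

theorem ordLE_mul {a b : ℤ} {A B : MicroDiffOp} (hA : OrdLE a A.coeff) (hB : OrdLE b B.coeff) :
    OrdLE (a + b) (A * B).coeff := fun m hm => by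
  rw [coeff_mul_eq_sum hA hB m (le_refl (m - b)) le_rfl, Finset.Icc_eq_empty (by omega),
    Finset.sum_empty]

theorem coeff_del_mul (i : ℤ) (B : MicroDiffOp) : (del i * B).coeff = dpow i B.coeff := by
  funext m
  rw [coeff_mul_finsum, finsum_eq_single _ i]
  · simp [del]
  · intro j hj
    simp [del, hj]

theorem coeff_mul_del (A : MicroDiffOp) (k m : ℤ) : (A * del k).coeff m = A.coeff (m - k) := by
  have hd : ∀ i, dpow i (del k).coeff m = if i = m - k then 1 else 0 := by
    intro i
    rw [dpow, finsum_eq_single _ 0]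
    · simp only [del, Ring.choose_zero_right, Function.iterate_zero, id_eq, one_smul, Nat.cast_zero]
      refine if_congr ?_ rfl rfl
      omega
    · intro j hj
      obtain ⟨j, rfl⟩ := Nat.exists_eq_succ_of_ne_zero hj
      have h1 : dt 1 (1 : TimeField) = 0 := dt_one 1
      have : dt 1 ((del k).coeff (m - i + (j + 1 : ℕ))) = 0 := by
        simp only [del]
        split_ifs
        · exact h1
        · exact dt_zero 1
      rw [Function.iterate_succ_apply, this, iterate_dt_zero]
      simp
  rw [coeff_mul_finsum, finsum_eq_single _ (m - k)]
  · simp [hd]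
  · intro j hj
    simp [hd, hj]

/-- Composition with `∂` from the left is injective: the coefficients are determined from the top
downwards. -/
theorem covD_injective {N : ℤ} {A B : ℤ → TimeField} (hA : OrdLE N A) (hB : OrdLE N B)
    (h : covD (dt 1) 1 A = covD (dt 1) 1 B) : A = B := by
  have key : ∀ j : ℕ, ∀ i : ℤ, N - j < i → A i = B i := by
    intro j
    induction j with
    | zero => intro i hi; rw [hA i (by simpa using hi), hB i (by simpa using hi)]
    | succ j ih =>
      intro i hi
      have h1 := congrFun h (i + 1)
      simp only [covD, add_sub_cancel_right] at h1
      rw [ih (i + 1) (by push_cast at hi; omega)] at h1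
      exact add_left_cancel h1
  funext i
  exact key (N - i + 1).toNat i (by omega)

theorem one_mul' (A : MicroDiffOp) : 1 * A = A := by
  ext m
  change (del 0 * A).coeff m = _
  rw [coeff_del_mul, dpow_zero]

/-- `(∂ ∘ B) ∘ C = ∂ ∘ (B ∘ C)`. -/
theorem coeff_mul_of_covD {B B' C : MicroDiffOp} (h : B'.coeff = covD (dt 1) 1 B.coeff) :
    (B' * C).coeff = covD (dt 1) 1 (B * C).coeff := by
  obtain ⟨b, hb⟩ := B.exists_ordLE
  obtain ⟨c, hc⟩ := C.exists_ordLE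
  have hb' : OrdLE (b + 1) B'.coeff := fun i hi => by
    rw [h, covD, hb i (by omega), hb (i - 1) (by omega), dt_zero, add_zero]
  funext m
  have hs : ∀ i, dpow i C.coeff (m - 1) + dt 1 (dpow i C.coeff m) = dpow (i + 1) C.coeff m := by
    intro i
    rw [dpow_succ hc, covD, add_comm]
  have e : ∑ i ∈ Finset.Icc (m - c - 1) (b + 1), B.coeff (i - 1) * dpow i C.coeff m =
      ∑ i ∈ Finset.Icc (m - c - 2) b, B.coeff i * dpow (i + 1) C.coeff m := by
    refine Finset.sum_nbij' (fun i => i - 1) (fun i => i + 1) ?_ ?_ ?_ ?_ ?_ <;>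
      simp only [Finset.mem_Icc] <;> intros <;> first | omega | skip
    simp
  have e2 : ∑ i ∈ Finset.Icc (m - c - 1) (b + 1), dt 1 (B.coeff i) * dpow i C.coeff m =
      ∑ i ∈ Finset.Icc (m - c - 2) (b + 1), dt 1 (B.coeff i) * dpow i C.coeff m := by
    refine Finset.sum_subset (Finset.Icc_subset_Icc (by omega) le_rfl) fun i hi hn => ?_
    rw [dpow_eq_zero hc, mul_zero]
    simp only [Finset.mem_Icc] at hi hn
    omega
  rw [covD, coeff_mul_eq_sum hb' hc m (lo := m - c - 1) (hi := b + 1) (by omega) le_rfl,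
    coeff_mul_eq_sum hb hc m (lo := m - c - 2) (hi := b + 1) (by omega) (by omega),
    coeff_mul_eq_sum hb hc (m - 1) (lo := m - c - 2) (hi := b) (by omega) (by omega)]
  simp only [h, covD, add_mul, Finset.sum_add_distrib]
  rw [e, e2, dt_sum]
  simp only [dt_mul, Finset.sum_add_distrib, ← hs, mul_add]
  rw [← Finset.sum_subset (Finset.Icc_subset_Icc le_rfl (by omega : b ≤ b + 1))
    (s₁ := Finset.Icc (m - c - 2) b)
    (f := fun i => B.coeff i * dt 1 (dpow i C.coeff m))]
  · have : ∀ i, dpow i C.coeff m * dt 1 (B.coeff i) = dt 1 (B.coeff i) * dpow i C.coeff m :=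
      fun i => mul_comm _ _
    simp only [this]
    ring
  · intro i hi hn
    simp only [Finset.mem_Icc] at hi hn
    rw [hb i (by omega), zero_mul]

theorem coeff_del_succ_mul (i : ℤ) (B : MicroDiffOp) :
    (del (i + 1) * B).coeff = covD (dt 1) 1 (del i * B).coeff := by
  obtain ⟨b, hb⟩ := B.exists_ordLE
  rw [coeff_del_mul, coeff_del_mul, dpow_succ hb]

theorem ordLE_del (i : ℤ) : OrdLE i (del i).coeff := fun j hj => by simp [del]; omega

/-- Associativity for powers of `∂`; the step `∂ⁱ ⇝ ∂ⁱ⁺¹` can be reversed because composition with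
`∂` is injective, so the induction also reaches negative exponents. -/
theorem del_mul_assoc (i : ℤ) (B C : MicroDiffOp) : del i * B * C = del i * (B * C) := by
  have key : ∀ i : ℤ, del i * B * C = del i * (B * C) ↔
      del (i + 1) * B * C = del (i + 1) * (B * C) := by
    intro i
    rw [MicroDiffOp.ext_iff, MicroDiffOp.ext_iff, coeff_del_succ_mul i (B * C),
      coeff_mul_of_covD (coeff_del_succ_mul i B)]
    refine ⟨fun h => by rw [h], fun h => ?_⟩
    obtain ⟨N, hN⟩ := (del i * B * C).exists_ordLE
    obtain ⟨M, hM⟩ := (del i * (B * C)).exists_ordLE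
    exact covD_injective (hN.mono (le_max_left N M)) (hM.mono (le_max_right N M)) h
  induction i using Int.induction_on with
  | zero =>
    change 1 * B * C = 1 * (B * C)
    rw [one_mul', one_mul']
  | succ i ih => exact (key i).1 ih
  | pred i ih =>
    have := key (-(i : ℤ) - 1)
    rw [sub_add_cancel] at this
    exact this.2 ih

protected theorem mul_assoc (A B C : MicroDiffOp) : A * B * C = A * (B * C) := by
  obtain ⟨a, ha⟩ := A.exists_ordLE
  obtain ⟨b, hb⟩ := B.exists_ordLE
  obtain ⟨c, hc⟩ := C.exists_ordLE
  ext m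
  rw [coeff_mul_eq_sum (ordLE_mul ha hb) hc m (lo := m - c) le_rfl le_rfl,
    coeff_mul_eq_sum ha (ordLE_mul hb hc) m (lo := m - c - b) (by omega) le_rfl]
  have h1 : ∀ l ∈ Finset.Icc (m - c) (a + b), (A * B).coeff l * dpow l C.coeff m =
      ∑ i ∈ Finset.Icc (m - c - b) a, A.coeff i * (dpow i B.coeff l * dpow l C.coeff m) := by
    intro l hl
    rw [Finset.mem_Icc] at hl
    rw [coeff_mul_eq_sum ha hb l (lo := m - c - b) (by omega) le_rfl, Finset.sum_mul]
    exact Finset.sum_congr rfl fun i _ => mul_assoc _ _ _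
  rw [Finset.sum_congr rfl h1, Finset.sum_comm]
  refine Finset.sum_congr rfl fun i hi => ?_
  rw [Finset.mem_Icc] at hi
  rw [← Finset.mul_sum, ← coeff_del_mul i (B * C), ← del_mul_assoc,
    coeff_mul_eq_sum (ordLE_mul (ordLE_del i) hb) hc m (lo := m - c) (hi := a + b) le_rfl
      (by omega),
    coeff_del_mul]

theorem mul_one' (A : MicroDiffOp) : A * 1 = A := by
  ext m
  change (A * del 0).coeff m = _
  rw [coeff_mul_del, sub_zero]

theorem coeff_neg (A : MicroDiffOp) (i : ℤ) : (-A).coeff i = -A.coeff i := rfl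

/-- Composition is additive in the left factor. -/
theorem coeff_mul_add_left {A A₁ A₂ : MicroDiffOp} (h : ∀ i, A.coeff i = A₁.coeff i + A₂.coeff i)
    (B : MicroDiffOp) (m : ℤ) : (A * B).coeff m = (A₁ * B).coeff m + (A₂ * B).coeff m := by
  obtain ⟨a₁, h₁⟩ := A₁.exists_ordLE
  obtain ⟨a₂, h₂⟩ := A₂.exists_ordLE
  obtain ⟨b, hb⟩ := B.exists_ordLE
  have h₃ : OrdLE (max a₁ a₂) A.coeff := fun i hi => by
    rw [h, h₁ i (by omega), h₂ i (by omega), add_zero]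
  rw [coeff_mul_eq_sum h₃ hb m (le_refl (m - b)) le_rfl,
    coeff_mul_eq_sum h₁ hb m (le_refl (m - b)) (le_max_left a₁ a₂),
    coeff_mul_eq_sum h₂ hb m (le_refl (m - b)) (le_max_right a₁ a₂), ← Finset.sum_add_distrib]
  exact Finset.sum_congr rfl fun i _ => by rw [h, add_mul]

end MicroDiffOp

/-! ### The hierarchy in terms of the left module generated by a symbol -/

/-- A covariant derivative `D` along the derivation `δ` of the field of scalars. -/
structure IsConnection {F V : Type*} [Field F] [AddCommGroup V] [Module F V] (δ : F → F)
    (D : V → V) : Prop where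
  map_add : ∀ x y, D (x + y) = D x + D y
  map_smul : ∀ (a : F) x, D (a • x) = δ a • x + a • D x

/-- The left module over the differential operators generated by `v`: the span of all `Dⁱ v`,
`i ≥ 0`. -/
def gSpan (F : Type*) {V : Type*} [Field F] [AddCommGroup V] [Module F V] (D : V → V) (v : V) :
    Submodule F V :=
  Submodule.span F (Set.range fun i : ℕ => D^[i] v)

section gSpan

variable {F V : Type*} [Field F] [AddCommGroup V] [Module F V] {δ ε : F → F} {D E : V → V}
  {v : V}

theorem iterate_mem_gSpan (i : ℕ) : D^[i] v ∈ gSpan F D v := Submodule.subset_span ⟨i, rfl⟩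

theorem self_mem_gSpan : v ∈ gSpan F D v := iterate_mem_gSpan 0

theorem mem_gSpan_iff {x : V} :
    x ∈ gSpan F D v ↔ ∃ (m : ℕ) (g : ℕ → F), x = ∑ i ∈ Finset.range m, g i • D^[i] v := by
  constructor
  · intro h
    obtain ⟨c, hc⟩ := Finsupp.mem_span_range_iff_exists_finsupp.1 h
    obtain ⟨m, hm⟩ := c.support.exists_nat_subset_range
    refine ⟨m, c, ?_⟩
    rw [← hc, Finsupp.sum]
    exact Finset.sum_subset hm fun i _ hi => by rw [Finsupp.notMem_support_iff.1 hi, zero_smul]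
  · rintro ⟨m, g, rfl⟩
    exact Submodule.sum_mem _ fun i _ => Submodule.smul_mem _ _ (iterate_mem_gSpan i)

theorem IsConnection.map_zero (hD : IsConnection δ D) : D 0 = 0 := by
  have := hD.map_add 0 0
  simpa using this

theorem IsConnection.map_mem_span (hE : IsConnection ε E) {s : Set V}
    (h : ∀ x ∈ s, E x ∈ Submodule.span F s) {x : V} (hx : x ∈ Submodule.span F s) :
    E x ∈ Submodule.span F s := by
  induction hx using Submodule.span_induction with
  | mem x hx => exact h x hx
  | zero => rw [hE.map_zero]; exact Submodule.zero_mem _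
  | add x y _ _ hx hy => rw [hE.map_add]; exact Submodule.add_mem _ hx hy
  | smul a x hx' hx =>
    rw [hE.map_smul]
    exact Submodule.add_mem _ (Submodule.smul_mem _ _ hx') (Submodule.smul_mem _ _ hx)

theorem IsConnection.map_mem_gSpan (hD : IsConnection δ D) {x : V} (hx : x ∈ gSpan F D v) :
    D x ∈ gSpan F D v := by
  refine hD.map_mem_span ?_ hx
  rintro _ ⟨i, rfl⟩
  exact Submodule.subset_span ⟨i + 1, Function.iterate_succ_apply' D i v⟩

theorem IsConnection.iterate_mem_gSpan (hD : IsConnection δ D) {x : V} (hx : x ∈ gSpan F D v)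
    (i : ℕ) : D^[i] x ∈ gSpan F D v := by
  induction i with
  | zero => exact hx
  | succ i ih => rw [Function.iterate_succ_apply']; exact hD.map_mem_gSpan ih

/-- If `E` commutes with `D`, then `gSpan F D v` is stable under `E` as soon as it contains
`E v`. -/
theorem IsConnection.map_mem_gSpan_of_comm (hD : IsConnection δ D) (hE : IsConnection ε E)
    (hDE : ∀ x, E (D x) = D (E x)) (hv : E v ∈ gSpan F D v) {x : V} (hx : x ∈ gSpan F D v) :
    E x ∈ gSpan F D v := by
  refine hE.map_mem_span ?_ hx
  rintro _ ⟨i, rfl⟩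
  have : E (D^[i] v) = D^[i] (E v) :=
    Function.Semiconj.eq ((show Function.Semiconj E D D from hDE).iterate_right i) v
  change E (D^[i] v) ∈ _
  rw [this]
  exact hD.iterate_mem_gSpan hv i

end gSpan

theorem isConnection_covD {F : Type*} [Field F] {δ : F → F} (h0 : ∀ a b, δ (a + b) = δ a + δ b)
    (h1 : ∀ a b, δ (a * b) = a * δ b + b * δ a) (k : ℤ) : IsConnection δ (covD δ k) where
  map_add x y := by
    funext i
    simp only [covD, Pi.add_apply, h0]
    ring
  map_smul a x := by
    funext i
    simp only [covD, Pi.add_apply, Pi.smul_apply, smul_eq_mul, h1]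
    ring

theorem covD_comm {F : Type*} [Field F] {δ ε : F → F} (hδ : ∀ a b, δ (a + b) = δ a + δ b)
    (hε : ∀ a b, ε (a + b) = ε a + ε b) (h : ∀ a, δ (ε a) = ε (δ a)) (j k : ℤ) (A : ℤ → F) :
    covD δ j (covD ε k A) = covD ε k (covD δ j A) := by
  funext i
  simp only [covD, hδ, hε, h, sub_right_comm i j k]
  ring

/-- The left module over the differential operators generated by the symbol `A`: the span of all
`∂ⁱ ∘ A`, `i ≥ 0`. -/
abbrev dSpan {F : Type*} [Field F] (δ : F → F) (A : ℤ → F) : Submodule F (ℤ → F) :=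
  gSpan F (covD δ 1) A

namespace MicroDiffOp

theorem dpow_natCast {b : ℤ} {B : ℤ → TimeField} (hB : OrdLE b B) (i : ℕ) :
    dpow i B = (covD (dt 1) 1)^[i] B := by
  induction i with
  | zero => funext m; exact dpow_zero B m
  | succ i ih => rw [Nat.cast_succ, dpow_succ hB, ih, Function.iterate_succ_apply']

/-- Differential operators, that is, operators without terms of negative order, map `W` into the
left module it generates; `exists_of_mem_dSpan` is the converse. -/
theorem mul_mem_dSpan {P : MicroDiffOp} (hP : ∀ i, i < 0 → P.coeff i = 0) (W : MicroDiffOp) :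
    (P * W).coeff ∈ dSpan (dt 1) W.coeff := by
  obtain ⟨a, ha⟩ := P.exists_ordLE
  obtain ⟨b, hb⟩ := W.exists_ordLE
  rw [mem_gSpan_iff]
  refine ⟨(a + 1).toNat, fun i => P.coeff i, ?_⟩
  funext m
  rw [coeff_mul_finsum, finsum_eq_sum_of_support_subset (s := (Finset.range (a + 1).toNat).map
    Nat.castEmbedding), Finset.sum_map, Finset.sum_apply]
  · refine Finset.sum_congr rfl fun i _ => ?_
    simp [← dpow_natCast hb]
  · intro i hi
    by_contra hn
    simp only [Finset.coe_map, Finset.coe_range, Set.mem_image, Set.mem_Iio, not_exists, not_and]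
      at hn
    refine hi ?_
    rcases lt_or_ge i 0 with h | h
    · simp [hP i h]
    · lift i to ℕ using h
      by_cases h2 : i < (a + 1).toNat
      · exact absurd rfl (hn i h2)
      · simp [ha i (by omega)]

theorem exists_of_mem_dSpan {W : MicroDiffOp} {x : ℤ → TimeField}
    (hx : x ∈ dSpan (dt 1) W.coeff) :
    ∃ P : MicroDiffOp, (∀ i, i < 0 → P.coeff i = 0) ∧ (P * W).coeff = x := by
  obtain ⟨b, hb⟩ := W.exists_ordLE
  obtain ⟨m, g, rfl⟩ := mem_gSpan_iff.1 hx
  let P : MicroDiffOp := ⟨fun i => if 0 ≤ i ∧ i < m then g i.toNat else 0, m, fun i hi =>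
    if_neg (by omega)⟩
  refine ⟨P, fun i hi => if_neg (by omega), ?_⟩
  funext j
  rw [coeff_mul_finsum, finsum_eq_sum_of_support_subset (s := (Finset.range m).map
    Nat.castEmbedding), Finset.sum_map, Finset.sum_apply]
  · refine Finset.sum_congr rfl fun i hi => ?_
    have : P.coeff (i : ℤ) = g i := by
      change (if 0 ≤ (i : ℤ) ∧ (i : ℤ) < m then g (i : ℤ).toNat else 0) = g i
      rw [if_pos (by have := Finset.mem_range.1 hi; omega), Int.toNat_natCast]
    simp [← dpow_natCast hb, this]
  · intro i hi
    have : P.coeff i ≠ 0 := fun h => hi (by simp [h])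
    have h2 : 0 ≤ i ∧ i < m := by
      by_contra h
      exact this (if_neg h)
    simp only [Finset.coe_map, Finset.coe_range, Set.mem_image, Set.mem_Iio]
    exact ⟨i.toNat, by omega, by simp; omega⟩

theorem IsWaveOperator.ordLE {W : MicroDiffOp} (hW : W.IsWaveOperator) : OrdLE 0 W.coeff := hW.2

theorem IsWaveOperator.dpow_self {W : MicroDiffOp} (hW : W.IsWaveOperator) (m : ℤ) :
    dpow m W.coeff m = 1 := by
  rw [dpow_eq_sum hW.ordLE m m (n := 1) (by simp)]
  simp [hW.1]

theorem ordLE_one : OrdLE 0 (1 : MicroDiffOp).coeff := ordLE_del 0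

theorem IsWaveOperator.exists_left_inverse {W : MicroDiffOp} (hW : W.IsWaveOperator) :
    ∃ V : MicroDiffOp, V.IsWaveOperator ∧ V * W = 1 := by
  -- the coefficients `v j` of `∂⁻ʲ` in the inverse are determined recursively
  obtain ⟨v, hv⟩ : ∃ v : ℕ → TimeField, ∀ j, v j = (if j = 0 then 1 else 0) -
      ∑ i ∈ Finset.range j, v i * dpow (-(i : ℤ)) W.coeff (-(j : ℤ)) := by
    let v : ℕ → TimeField := fun j => Nat.strongRec
      (fun j ih => (if j = 0 then 1 else 0) -
        ∑ i ∈ (Finset.range j).attach, ih i.1 (Finset.mem_range.1 i.2) *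
          dpow (-(i.1 : ℤ)) W.coeff (-(j : ℤ))) j
    refine ⟨v, fun j => ?_⟩
    have h : v j = (if j = 0 then 1 else 0) - ∑ i ∈ (Finset.range j).attach, v i.1 *
        dpow (-(i.1 : ℤ)) W.coeff (-(j : ℤ)) := by
      simp only [v]
      rw [Nat.strongRec]
    rw [h, Finset.sum_attach (Finset.range j) fun i => v i * dpow (-(i : ℤ)) W.coeff (-(j : ℤ))]
  let V : MicroDiffOp := ⟨fun i => if i ≤ 0 then v (-i).toNat else 0, 0, fun i hi =>
    if_neg (by omega)⟩
  have hV : ∀ j : ℕ, V.coeff (-(j : ℤ)) = v j := fun j => by simp [V]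
  have hV0 : OrdLE 0 V.coeff := fun i hi => if_neg (by omega)
  refine ⟨V, ⟨?_, hV0⟩, ?_⟩
  · have := hV 0
    simp only [Nat.cast_zero, neg_zero] at this
    rw [this, hv]
    simp
  · ext m
    rcases lt_or_ge 0 m with h | h
    · rw [ordLE_mul hV0 hW.ordLE m (by simpa using h), ordLE_one m h]
    · obtain ⟨j, rfl⟩ : ∃ j : ℕ, m = -(j : ℤ) := ⟨(-m).toNat, by omega⟩
      rw [coeff_mul_eq_sum hV0 hW.ordLE _ (lo := -(j : ℤ)) (by simp) le_rfl]
      have e : ∑ i ∈ Finset.Icc (-(j : ℤ)) 0, V.coeff i * dpow i W.coeff (-(j : ℤ)) =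
          ∑ i ∈ Finset.range (j + 1), v i * dpow (-(i : ℤ)) W.coeff (-(j : ℤ)) := by
        refine Finset.sum_nbij' (fun i => (-i).toNat) (fun i => -(i : ℤ)) ?_ ?_ ?_ ?_ ?_ <;>
          simp only [Finset.mem_Icc, Finset.mem_range] <;> intro i hi
        · omega
        · omega
        · omega
        · omega
        · obtain ⟨k, rfl⟩ : ∃ k : ℕ, i = -(k : ℤ) := ⟨(-i).toNat, by omega⟩
          rw [hV]
          simp
      rw [e, Finset.sum_range_succ, hW.dpow_self, mul_one, hv j]
      change _ = (if -(j : ℤ) = 0 then (1 : TimeField) else 0)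
      simp

/-- A left inverse of the left inverse is `W`, by associativity. -/
theorem IsWaveOperator.exists_inverse {W : MicroDiffOp} (hW : W.IsWaveOperator) :
    ∃ V : MicroDiffOp, V.IsWaveOperator ∧ W * V = 1 ∧ V * W = 1 := by
  obtain ⟨V, hV, h1⟩ := hW.exists_left_inverse
  obtain ⟨V', -, h2⟩ := hV.exists_left_inverse
  have : V' = W := by rw [← mul_one' V', ← h1, ← MicroDiffOp.mul_assoc, h2, one_mul']
  exact ⟨V, hV, this ▸ h2, h1⟩

/-- The part of nonnegative order. -/
def posPart (A : MicroDiffOp) : MicroDiffOp where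
  coeff i := if i < 0 then 0 else A.coeff i
  bounded := by
    obtain ⟨N, hN⟩ := A.bounded
    exact ⟨N, fun i hi => by simp [hN i hi]⟩

theorem coeff_negPart_add_posPart (A : MicroDiffOp) (i : ℤ) :
    A.coeff i = A.negPart.coeff i + A.posPart.coeff i := by
  simp only [negPart, posPart]
  split_ifs <;> simp

/-- The Sato equation of the `k`-th flow says that `∂W/∂tₖ + W ∂ᵏ` lies in the left module
generated by `W`. -/
theorem sato_iff {W V : MicroDiffOp} (hW : W.IsWaveOperator) (hWV : W * V = 1) (hVW : V * W = 1)
    (hV : V.IsWaveOperator) (k : ℕ+) :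
    timeDeriv k W = -(negPart (W * del (k : ℕ) * V) * W) ↔
      covD (dt k) (k : ℕ) W.coeff ∈ dSpan (dt 1) W.coeff := by
  set X := W * del (k : ℕ) * V with hX
  have hXW : X * W = W * del (k : ℕ) := by rw [hX, MicroDiffOp.mul_assoc, hVW, mul_one']
  have hsum : ∀ m, W.coeff (m - (k : ℕ)) = (X.negPart * W).coeff m + (X.posPart * W).coeff m := by
    intro m
    rw [← coeff_mul_del, ← hXW]
    exact coeff_mul_add_left X.coeff_negPart_add_posPart W m
  constructor
  · intro h
    have : covD (dt k) (k : ℕ) W.coeff = (X.posPart * W).coeff := by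
      funext m
      have h1 : dt k (W.coeff m) = -(X.negPart * W).coeff m :=
        congrArg (fun A : MicroDiffOp => A.coeff m) h
      rw [covD, hsum, h1]
      ring
    rw [this]
    exact mul_mem_dSpan (fun i hi => if_pos hi) W
  · intro h
    obtain ⟨P, hP, hPW⟩ := exists_of_mem_dSpan h
    have h1 : ∀ m, (W * del (k : ℕ)).coeff m = (P * W).coeff m + (-timeDeriv k W).coeff m := by
      intro m
      rw [hPW, coeff_mul_del, coeff_neg, covD, timeDeriv]
      ring
    have h2 : ∀ m, X.coeff m = P.coeff m + (-timeDeriv k W * V).coeff m := by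
      intro m
      rw [hX, coeff_mul_add_left h1, MicroDiffOp.mul_assoc P, hWV, mul_one']
    have h3 : OrdLE (-1 + 0) (-timeDeriv k W * V).coeff := by
      refine ordLE_mul (fun i hi => ?_) hV.ordLE
      rw [coeff_neg, timeDeriv, neg_eq_zero]
      rcases eq_or_lt_of_le (show 0 ≤ i by omega) with h0 | h0
      · simp only [← h0, hW.1, dt_one]
      · simp only [hW.2 i h0, dt_zero]
    have h4 : X.negPart = -timeDeriv k W * V := by
      ext m
      simp only [negPart]
      split_ifs with hm
      · rw [h2, hP m hm, zero_add]
      · rw [h3 m (by omega)]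
    rw [h4, MicroDiffOp.mul_assoc, hVW, mul_one']
    ext m
    rw [coeff_neg, coeff_neg, neg_neg]

/-- The relation between consecutive wave operators says that `W' ∂ᵐ` lies in the left module
generated by `W`. -/
theorem negPart_eq_zero_iff {W W' V : MicroDiffOp} (hWV : W * V = 1) (hVW : V * W = 1) (m : ℤ) :
    negPart (W' * del m * V) = 0 ↔ (fun i => W'.coeff (i - m)) ∈ dSpan (dt 1) W.coeff := by
  have e : (fun i => W'.coeff (i - m)) = (W' * del m).coeff := by
    funext i
    rw [coeff_mul_del]
  constructor
  · intro h
    have hP : ∀ i, i < 0 → (W' * del m * V).coeff i = 0 := by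
      intro i hi
      have := congrArg (fun A : MicroDiffOp => A.coeff i) h
      simp only [negPart, if_pos hi] at this
      exact this
    have := mul_mem_dSpan hP W
    rwa [MicroDiffOp.mul_assoc _ V, hVW, mul_one', ← e] at this
  · intro h
    obtain ⟨P, hP, hPW⟩ := exists_of_mem_dSpan h
    have h1 : P * W = W' * del m := MicroDiffOp.ext (by rw [hPW, e])
    rw [← h1, MicroDiffOp.mul_assoc, hWV, mul_one']
    ext i
    simp only [negPart]
    split_ifs with hi
    · exact hP i hi
    · rfl

end MicroDiffOp

/-! ### Weights of power series in the times -/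

/-- The weight `∑ₙ n αₙ` of the monomial `tᵅ`. -/
def wt (α : ℕ+ →₀ ℕ) : ℕ := α.sum fun n a => (n : ℕ) * a

theorem wt_add (α β : ℕ+ →₀ ℕ) : wt (α + β) = wt α + wt β :=
  Finsupp.sum_add_index' (fun _ => by simp) fun _ _ _ => by ring

theorem wt_single (n : ℕ+) (a : ℕ) : wt (Finsupp.single n a) = n * a :=
  Finsupp.sum_single_index (by simp)

theorem wt_of_mem_antidiagonal {α : ℕ+ →₀ ℕ} {p : (ℕ+ →₀ ℕ) × (ℕ+ →₀ ℕ)}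
    (h : p ∈ Finset.HasAntidiagonal.antidiagonal α) : wt p.1 + wt p.2 = wt α := by
  rw [← wt_add, Finset.HasAntidiagonal.mem_antidiagonal.1 h]

theorem finite_setOf_wt_eq (d : ℕ) : {α : ℕ+ →₀ ℕ | wt α = d}.Finite := by
  let N : ℕ+ := ⟨d + 1, d.succ_pos⟩
  let β : ℕ+ →₀ ℕ := Finsupp.indicator (Finset.Icc 1 N) fun _ _ => d
  refine (Set.finite_Iic β).subset fun α hα => ?_
  have hα' : wt α = d := hα
  intro (n : ℕ+)
  rcases Nat.eq_zero_or_pos (α n) with h0 | h0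
  · rw [h0]; exact Nat.zero_le _
  have h1 : (n : ℕ) * α n ≤ d := by
    rw [← hα']
    exact Finset.single_le_sum (f := fun n : ℕ+ => (n : ℕ) * α n) (fun _ _ => Nat.zero_le _)
      (Finsupp.mem_support_iff.2 h0.ne')
  have h2 : (n : ℕ) ≤ d := le_trans (Nat.le_mul_of_pos_right _ h0) h1
  have h3 : α n ≤ d := le_trans (Nat.le_mul_of_pos_left _ n.pos) h1
  have : n ∈ Finset.Icc (1 : ℕ+) N := by
    rw [Finset.mem_Icc]
    refine ⟨one_le, ?_⟩
    rw [← PNat.coe_le_coe]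
    exact h2.trans (Nat.le_succ d)
  rw [Finsupp.indicator_of_mem this]
  exact h3

/-- Polynomials in the times. -/
abbrev TimePoly : Type := MvPolynomial ℕ+ ℂ

/-- The component of weight `d` of a power series; a polynomial, as there are finitely many
monomials of weight `d`. -/
def comp (d : ℕ) (f : TimeSeries) : TimePoly :=
  ∑ α ∈ (finite_setOf_wt_eq d).toFinset, MvPolynomial.monomial α (MvPowerSeries.coeff α f)

theorem coeff_comp (d : ℕ) (f : TimeSeries) (α : ℕ+ →₀ ℕ) :
    MvPolynomial.coeff α (comp d f) = if wt α = d then MvPowerSeries.coeff α f else 0 := by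
  classical
  rw [comp, MvPolynomial.coeff_sum]
  simp only [MvPolynomial.coeff_monomial]
  rw [Finset.sum_ite_eq']
  simp

theorem comp_add (d : ℕ) (f g : TimeSeries) : comp d (f + g) = comp d f + comp d g := by
  ext α
  simp only [coeff_comp, MvPolynomial.coeff_add, map_add]
  split_ifs <;> simp

theorem comp_zero (d : ℕ) : comp d 0 = 0 := by
  ext α
  simp [coeff_comp]

theorem comp_neg (d : ℕ) (f : TimeSeries) : comp d (-f) = -comp d f := by
  ext α
  simp only [coeff_comp, MvPolynomial.coeff_neg, map_neg]
  split_ifs <;> simp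

theorem comp_sum {ι : Type*} (d : ℕ) (s : Finset ι) (f : ι → TimeSeries) :
    comp d (∑ i ∈ s, f i) = ∑ i ∈ s, comp d (f i) := by
  classical
  induction s using Finset.induction_on with
  | empty => simp [comp_zero]
  | insert a s h ih => rw [Finset.sum_insert h, Finset.sum_insert h, comp_add, ih]

theorem comp_pderiv (d : ℕ) (n : ℕ+) (f : TimeSeries) :
    comp d (MvPowerSeries.pderiv ℂ n f) = MvPolynomial.pderiv n (comp (d + n) f) := by
  ext α
  rw [coeff_comp, MvPolynomial.coeff_pderiv, coeff_comp, MvPowerSeries.coeff_pderiv, wt_add,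
    wt_single, mul_one]
  simp only [add_left_inj, ite_mul, zero_mul]

/-- The ideal of power series of order at least `d` with respect to the weight. -/
def ordIdeal (d : ℕ) : Ideal TimeSeries where
  carrier := {f | ∀ α, wt α < d → MvPowerSeries.coeff α f = 0}
  zero_mem' := fun _ _ => map_zero _
  add_mem' := fun hf hg α hα => by rw [map_add, hf α hα, hg α hα, add_zero]
  smul_mem' := fun c f hf α hα => by
    classical
    rw [smul_eq_mul, MvPowerSeries.coeff_mul]
    refine Finset.sum_eq_zero fun p hp => ?_
    have := wt_of_mem_antidiagonal hp
    rw [hf p.2 (by omega), mul_zero]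

theorem ordIdeal_anti {d e : ℕ} (h : d ≤ e) : ordIdeal e ≤ ordIdeal d :=
  fun _ hf α hα => hf α (by omega)

theorem mem_ordIdeal_zero (f : TimeSeries) : f ∈ ordIdeal 0 :=
  fun _ h => absurd h (Nat.not_lt_zero _)

theorem eq_zero_of_forall_mem_ordIdeal {f : TimeSeries} (h : ∀ d, f ∈ ordIdeal d) : f = 0 := by
  ext α
  rw [h (wt α + 1) α (Nat.lt_succ_self _), map_zero]

theorem eq_of_forall_sub_mem_ordIdeal {f g : TimeSeries} (h : ∀ d, f - g ∈ ordIdeal d) : f = g :=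
  sub_eq_zero.1 (eq_zero_of_forall_mem_ordIdeal h)

theorem comp_eq_zero_of_mem {d i : ℕ} {f : TimeSeries} (hf : f ∈ ordIdeal d) (h : i < d) :
    comp i f = 0 := by
  ext α
  rw [coeff_comp, MvPolynomial.coeff_zero]
  split_ifs with h1
  · exact hf α (by omega)
  · rfl

theorem mem_ordIdeal_succ {d : ℕ} {f : TimeSeries} (hf : f ∈ ordIdeal d) (h : comp d f = 0) :
    f ∈ ordIdeal (d + 1) := by
  intro α hα
  rcases Nat.lt_succ_iff_lt_or_eq.1 hα with h1 | h1
  · exact hf α h1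
  · have := congrArg (MvPolynomial.coeff α) h
    rwa [coeff_comp, if_pos h1, MvPolynomial.coeff_zero] at this

theorem exists_order {f : TimeSeries} (hf : f ≠ 0) : ∃ d, f ∈ ordIdeal d ∧ comp d f ≠ 0 := by
  by_contra! h
  refine hf (eq_zero_of_forall_mem_ordIdeal fun d => ?_)
  induction d with
  | zero => exact mem_ordIdeal_zero f
  | succ d ih => exact mem_ordIdeal_succ ih (h d ih)

theorem mul_mem_ordIdeal {d e : ℕ} {f g : TimeSeries} (hf : f ∈ ordIdeal d) (hg : g ∈ ordIdeal e) :
    f * g ∈ ordIdeal (d + e) := by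
  classical
  intro α hα
  rw [MvPowerSeries.coeff_mul]
  refine Finset.sum_eq_zero fun p hp => ?_
  have := wt_of_mem_antidiagonal hp
  rcases lt_or_ge (wt p.1) d with h | h
  · rw [hf p.1 h, zero_mul]
  · rw [hg p.2 (by omega), mul_zero]

/-- Components of lowest weight are multiplicative. -/
theorem comp_mul {d e : ℕ} {f g : TimeSeries} (hf : f ∈ ordIdeal d) (hg : g ∈ ordIdeal e) :
    comp (d + e) (f * g) = comp d f * comp e g := by
  classical
  ext α
  rw [coeff_comp, MvPowerSeries.coeff_mul, MvPolynomial.coeff_mul]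
  simp only [coeff_comp]
  split_ifs with h
  · refine Finset.sum_congr rfl fun p hp => ?_
    have := wt_of_mem_antidiagonal hp
    rcases lt_trichotomy (wt p.1) d with h1 | h1 | h1
    · rw [hf p.1 h1]; simp
    · rw [if_pos h1, if_pos (by omega)]
    · rw [hg p.2 (by omega)]; simp
  · symm
    refine Finset.sum_eq_zero fun p hp => ?_
    have := wt_of_mem_antidiagonal hp
    split_ifs <;> first | omega | simp

theorem pderiv_mem_ordIdeal {d : ℕ} (n : ℕ+) {f : TimeSeries} (hf : f ∈ ordIdeal (d + n)) :
    MvPowerSeries.pderiv ℂ n f ∈ ordIdeal d := by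
  intro α hα
  rw [MvPowerSeries.coeff_pderiv, hf _ (by rw [wt_add, wt_single]; omega), zero_mul]

/-! ### The pairing of symbols with vectors -/

/-- The coefficient `∏ₙ 1/αₙ!` of `tᵅ` in `exp (∑ₙ tₙ)`. -/
def invFact (α : ℕ+ →₀ ℕ) : ℂ := α.prod fun _ a => ((Nat.factorial a : ℂ))⁻¹

/-- The series `exp (∑ₙ tₙ)` is its own derivative with respect to `tₙ`, in terms of coefficients.
-/
theorem invFact_add_single (α : ℕ+ →₀ ℕ) (n : ℕ+) :
    invFact (α + Finsupp.single n 1) * ((α n : ℂ) + 1) = invFact α := by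
  classical
  have h : ∀ β : ℕ+ →₀ ℕ, invFact β = ((Nat.factorial (β n) : ℂ))⁻¹ *
      (β.erase n).prod fun _ a => ((Nat.factorial a : ℂ))⁻¹ := fun β =>
    (Finsupp.mul_prod_erase' β n _ fun _ => by simp).symm
  have he : (α + Finsupp.single n 1).erase n = α.erase n := by
    rw [Finsupp.erase_add, Finsupp.erase_single, add_zero]
  rw [h, h α, he, Finsupp.add_apply, Finsupp.single_eq_same, Nat.factorial_succ]
  have h1 : ((α n : ℂ) + 1) ≠ 0 := Nat.cast_add_one_ne_zero _
  have h2 : (Nat.factorial (α n) : ℂ) ≠ 0 := Nat.cast_ne_zero.2 (Nat.factorial_ne_zero _)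
  push_cast
  field_simp

theorem coeff_expXi (k : ℕ) (α : ℕ+ →₀ ℕ) :
    MvPowerSeries.coeff α (expXi k) = if wt α = k then invFact α else 0 := rfl

/-- The coefficient of `e_i` in `e^{ξ(t;Λ)} u`, where `Λ e_ν = e_{ν-1}`: the residue of
`λⁱ e^{ξ(t;λ)} u(λ)`. -/
def flow (u : SatoSpace) (i : ℤ) : TimeSeries := fun α => invFact α * u.coeff (i + wt α)

theorem coeff_flow (u : SatoSpace) (i : ℤ) (α : ℕ+ →₀ ℕ) :
    MvPowerSeries.coeff α (flow u i) = invFact α * u.coeff (i + wt α) := rfl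

/-- `∂/∂tₙ e^{ξ(t;Λ)} u = Λⁿ e^{ξ(t;Λ)} u`. -/
theorem pderiv_flow (n : ℕ+) (u : SatoSpace) (i : ℤ) :
    MvPowerSeries.pderiv ℂ n (flow u i) = flow u (i + n) := by
  ext α
  rw [MvPowerSeries.coeff_pderiv, coeff_flow, coeff_flow, mul_right_comm, invFact_add_single,
    wt_add, wt_single]
  congr 2
  push_cast
  ring

theorem flow_add (u v : SatoSpace) (i : ℤ) : flow (u + v) i = flow u i + flow v i := by
  ext α
  rw [map_add, coeff_flow, coeff_flow, coeff_flow, SatoSpace.coeff_add, mul_add]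

theorem flow_smul (c : ℂ) (u : SatoSpace) (i : ℤ) : flow (c • u) i = c • flow u i := by
  ext α
  rw [MvPowerSeries.coeff_smul, coeff_flow, coeff_flow, SatoSpace.coeff_smul, mul_left_comm]

/-- `u_ν = 0` for `ν < N`. -/
def SuppGE (N : ℤ) (u : SatoSpace) : Prop := ∀ ν, ν < N → u.coeff ν = 0

theorem SatoSpace.exists_suppGE (u : SatoSpace) : ∃ N, SuppGE N u := u.2

theorem flow_mem_ordIdeal {N : ℤ} {u : SatoSpace} (hu : SuppGE N u) {i : ℤ} {d : ℕ}
    (h : d ≤ N - i) : flow u i ∈ ordIdeal d := by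
  intro α hα
  rw [coeff_flow, hu _ (by omega), mul_zero]

/-- The pairing `∑ᵢ aᵢ fᵢ`, `fᵢ = flow u i`, of the symbol `∑ᵢ aᵢ ∂ⁱ` with the vector `u`: the
residue of `(∑ᵢ aᵢ λⁱ) e^{ξ(t;λ)} u(λ)`. -/
def pairing (a : ℤ → TimeSeries) (u : SatoSpace) : TimeSeries :=
  fun α => ∑ᶠ i, MvPowerSeries.coeff α (a i * flow u i)

theorem coeff_pairing {n N : ℤ} {a : ℤ → TimeSeries} {u : SatoSpace} (ha : OrdLE n a)
    (hu : SuppGE N u) {lo hi : ℤ} (hhi : n ≤ hi) {α : ℕ+ →₀ ℕ} (hlo : lo ≤ N - wt α) :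
    MvPowerSeries.coeff α (pairing a u) =
      MvPowerSeries.coeff α (∑ i ∈ Finset.Icc lo hi, a i * flow u i) := by
  rw [map_sum]
  refine finsum_eq_sum_of_support_subset _ fun i hi' => ?_
  by_contra hn
  simp only [Finset.coe_Icc, Set.mem_Icc, not_and_or, not_le] at hn
  refine hi' ?_
  rcases hn with h | h
  · have h' : ((wt α + 1 : ℕ) : ℤ) ≤ N - i := by push_cast; omega
    have : a i * flow u i ∈ ordIdeal (wt α + 1) :=
      Ideal.mul_mem_left _ _ (flow_mem_ordIdeal hu h')
    exact this α (Nat.lt_succ_self _)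
  · simp [ha i (by omega)]

/-- Modulo terms of high weight, the pairing is a finite sum. -/
theorem pairing_sub_sum_mem {n N : ℤ} {a : ℤ → TimeSeries} {u : SatoSpace} (ha : OrdLE n a)
    (hu : SuppGE N u) {lo hi : ℤ} (hhi : n ≤ hi) {d : ℕ} (hlo : lo + d ≤ N + 1) :
    pairing a u - ∑ i ∈ Finset.Icc lo hi, a i * flow u i ∈ ordIdeal d := by
  intro α hα
  rw [map_sub, coeff_pairing ha hu hhi (lo := lo) (α := α) (by omega), sub_self]

theorem OrdLE.mul_left {n : ℤ} {a : ℤ → TimeSeries} (ha : OrdLE n a) (f : TimeSeries) :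
    OrdLE n fun i => f * a i := fun i hi => by simp only [ha i hi, mul_zero]

/-- The pairing is determined by its approximations by finite sums. -/
theorem pairing_eq_of_forall {n N : ℤ} {a : ℤ → TimeSeries} {u : SatoSpace} (ha : OrdLE n a)
    (hu : SuppGE N u) {f : TimeSeries} (h : ∀ d : ℕ, ∃ lo hi : ℤ, n ≤ hi ∧ lo + d ≤ N + 1 ∧
      ∑ i ∈ Finset.Icc lo hi, a i * flow u i - f ∈ ordIdeal d) : pairing a u = f := by
  refine eq_of_forall_sub_mem_ordIdeal fun d => ?_
  obtain ⟨lo, hi, h1, h2, h3⟩ := h d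
  have := Ideal.add_mem _ (pairing_sub_sum_mem ha hu h1 h2) h3
  rwa [sub_add_sub_cancel] at this

theorem pairing_add_left {n : ℤ} {a b : ℤ → TimeSeries} (ha : OrdLE n a) (hb : OrdLE n b)
    (u : SatoSpace) : pairing (fun i => a i + b i) u = pairing a u + pairing b u := by
  obtain ⟨N, hu⟩ := u.exists_suppGE
  refine pairing_eq_of_forall (n := n) (fun i hi => by rw [ha i hi, hb i hi, add_zero]) hu
    fun d => ⟨N - d, n, le_rfl, by omega, ?_⟩
  have h := Ideal.add_mem _ (pairing_sub_sum_mem ha hu le_rfl (show N - d + d ≤ N + 1 by omega))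
    (pairing_sub_sum_mem hb hu le_rfl (show N - d + d ≤ N + 1 by omega))
  rw [← Ideal.neg_mem_iff] at h
  convert h using 1
  simp only [add_mul, Finset.sum_add_distrib]
  ring

theorem pairing_mul_left {n : ℤ} {a : ℤ → TimeSeries} (ha : OrdLE n a) (f : TimeSeries)
    (u : SatoSpace) : pairing (fun i => f * a i) u = f * pairing a u := by
  obtain ⟨N, hu⟩ := u.exists_suppGE
  refine pairing_eq_of_forall (n := n) (fun i hi => by rw [ha i hi, mul_zero]) hu
    fun d => ⟨N - d, n, le_rfl, by omega, ?_⟩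
  have h := Ideal.mul_mem_left _ f
    (pairing_sub_sum_mem ha hu le_rfl (show N - d + d ≤ N + 1 by omega))
  rw [← Ideal.neg_mem_iff] at h
  convert h using 1
  simp only [mul_assoc, ← Finset.mul_sum]
  ring

/-- Two finite sums approximating the pairing agree modulo terms of high weight. -/
theorem sum_sub_sum_mem {N : ℤ} {u : SatoSpace} (hu : SuppGE N u) (a : ℤ → TimeSeries)
    {lo lo' hi : ℤ} {d : ℕ} (h : lo ≤ lo') (hd : lo' + d ≤ N + 1) :
    ∑ i ∈ Finset.Icc lo hi, a i * flow u i - ∑ i ∈ Finset.Icc lo' hi, a i * flow u i ∈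
      ordIdeal d := by
  rw [← Finset.sum_sdiff (Finset.Icc_subset_Icc_left h (b := hi)), add_sub_cancel_right]
  refine Ideal.sum_mem _ fun i hi => Ideal.mul_mem_left _ _ (flow_mem_ordIdeal hu ?_)
  simp only [Finset.mem_sdiff, Finset.mem_Icc] at hi
  omega

/-- The pairing intertwines `a ↦ ∂a/∂tₖ + a ∂ᵏ` with `∂/∂tₖ`. -/
theorem pairing_covD {n : ℤ} {a : ℤ → TimeSeries} (ha : OrdLE n a) (k : ℕ+) (u : SatoSpace) :
    pairing (covD (MvPowerSeries.pderiv ℂ k) (k : ℕ) a) u =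
      MvPowerSeries.pderiv ℂ k (pairing a u) := by
  have hk := k.pos
  obtain ⟨N, hu⟩ := u.exists_suppGE
  refine pairing_eq_of_forall (n := n + k) (fun i hi => ?_) hu
    fun d => ⟨N - d - k, n + k, le_rfl, by omega, ?_⟩
  · rw [covD, ha i (by omega), ha (i - (k : ℕ)) (by omega), map_zero, add_zero]
  have h1 := pderiv_mem_ordIdeal k (pairing_sub_sum_mem ha hu (lo := N - d - k) (hi := n + k)
    (d := d + k) (by omega) (by push_cast; omega))
  have e : ∑ i ∈ Finset.Icc (N - d - k) (n + k), a i * flow u (i + k) =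
      ∑ i ∈ Finset.Icc (N - d) (n + k + k), a (i - k) * flow u i := by
    refine Finset.sum_nbij' (fun i => i + k) (fun i => i - k) ?_ ?_ ?_ ?_ ?_ <;>
      simp only [Finset.mem_Icc] <;> intros <;> first | omega | skip
    simp
  have e2 : ∑ i ∈ Finset.Icc (N - d) (n + k + k), a (i - k) * flow u i =
      ∑ i ∈ Finset.Icc (N - d) (n + k), a (i - k) * flow u i := by
    symm
    refine Finset.sum_subset (Finset.Icc_subset_Icc le_rfl (by omega)) fun i hi hn => ?_
    simp only [Finset.mem_Icc] at hi hn
    rw [ha (i - k) (by omega), zero_mul]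
  have h2 := sum_sub_sum_mem hu (fun i => a (i - k)) (lo := N - d - k) (lo' := N - d)
    (hi := n + k) (d := d) (by omega) (by omega)
  have h3 := Ideal.sub_mem _ h2 h1
  convert h3 using 1
  simp only [map_sub, map_sum, Derivation.leibniz, smul_eq_mul, pderiv_flow,
    Finset.sum_add_distrib, e, e2, covD, add_mul]
  have e3 : ∀ i, flow u i * MvPowerSeries.pderiv ℂ k (a i) =
      MvPowerSeries.pderiv ℂ k (a i) * flow u i := fun i => mul_comm _ _
  simp only [e3]
  ring

theorem pairing_zero_right (a : ℤ → TimeSeries) : pairing a 0 = 0 := by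
  have h : ∀ i, flow (0 : SatoSpace) i = 0 := fun i => by
    ext α
    rw [coeff_flow, SatoSpace.coeff_zero, mul_zero, map_zero]
  funext α
  change ∑ᶠ i, MvPowerSeries.coeff α (a i * flow 0 i) = 0
  simp [h]

theorem pairing_add_right {n : ℤ} {a : ℤ → TimeSeries} (ha : OrdLE n a) (u v : SatoSpace) :
    pairing a (u + v) = pairing a u + pairing a v := by
  obtain ⟨N, hu⟩ := u.exists_suppGE
  obtain ⟨M, hv⟩ := v.exists_suppGE
  have huv : SuppGE (min N M) (u + v) := fun ν hν => by
    rw [SatoSpace.coeff_add, hu ν (by omega), hv ν (by omega), add_zero]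
  refine pairing_eq_of_forall ha huv fun d => ⟨min N M - d, n, le_rfl, by omega, ?_⟩
  have h := Ideal.add_mem _
    (pairing_sub_sum_mem ha hu le_rfl (show min N M - d + d ≤ N + 1 by omega))
    (pairing_sub_sum_mem ha hv le_rfl (show min N M - d + d ≤ M + 1 by omega))
  rw [← Ideal.neg_mem_iff] at h
  convert h using 1
  simp only [flow_add, mul_add, Finset.sum_add_distrib]
  ring

theorem pairing_smul_right {n : ℤ} {a : ℤ → TimeSeries} (ha : OrdLE n a) (c : ℂ) (u : SatoSpace) :
    pairing a (c • u) = c • pairing a u := by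
  obtain ⟨N, hu⟩ := u.exists_suppGE
  have hcu : SuppGE N (c • u) := fun ν hν => by rw [SatoSpace.coeff_smul, hu ν hν, mul_zero]
  ext α
  rw [MvPowerSeries.coeff_smul, coeff_pairing ha hu (le_refl n) (le_refl (N - wt α)),
    coeff_pairing ha hcu (le_refl n) (le_refl (N - wt α))]
  simp only [flow_smul, mul_smul_comm, ← Finset.smul_sum, MvPowerSeries.coeff_smul]

/-- The symbol `∑_{j ≥ 0} a_j ∂ⁿ⁻ʲ`. -/
def extendSymbol (n : ℤ) (a : ℕ → TimeSeries) : ℤ → TimeSeries :=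
  fun i => if i ≤ n then a (n - i).toNat else 0

theorem ordLE_extendSymbol (n : ℤ) (a : ℕ → TimeSeries) : OrdLE n (extendSymbol n a) :=
  fun i hi => if_neg (by omega)

/-- The residue that defines the subspace of an operator is an instance of the pairing. -/
theorem residue_eq_pairing (n : ℤ) (a : ℕ → TimeSeries) (u : SatoSpace) :
    residue n a u = pairing (extendSymbol n a) u := by
  classical
  obtain ⟨N, hu⟩ := u.exists_suppGE
  ext α
  rw [coeff_pairing (ordLE_extendSymbol n a) hu (le_refl n) (lo := N - wt α) le_rfl]
  change ∑ᶠ p : ℕ × ℕ, residueTerm n a u α p = _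
  rw [finsum_eq_sum_of_support_subset (s := (Finset.range (n - N + wt α + 1).toNat) ×ˢ
    Finset.range (wt α + 1)), Finset.sum_product, map_sum]
  · refine Finset.sum_nbij' (fun j => n - j) (fun i => (n - i).toNat) ?_ ?_ ?_ ?_ ?_ <;>
      simp only [Finset.mem_Icc, Finset.mem_range] <;> intro j hj
    · omega
    · omega
    · omega
    · omega
    · have e : extendSymbol n a (n - j) = a j := by
        rw [extendSymbol, if_pos (by omega)]
        congr 1
        omega
      rw [e, MvPowerSeries.coeff_mul]
      simp only [residueTerm, MvPowerSeries.coeff_mul, Finset.sum_mul]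
      rw [Finset.sum_comm]
      refine Finset.sum_congr rfl fun p hp => ?_
      have hw := wt_of_mem_antidiagonal hp
      rw [Finset.sum_eq_single (wt p.2)]
      · rw [coeff_expXi, if_pos rfl, coeff_flow, mul_assoc]
      · intro k _ hk
        rw [coeff_expXi, if_neg (Ne.symm hk), mul_zero, zero_mul]
      · intro h
        exact absurd (Finset.mem_range.2 (by omega)) h
  · intro p hp
    by_contra hn
    simp only [Finset.coe_product, Finset.coe_range, Set.mem_prod, Set.mem_Iio, not_and_or,
      not_lt] at hn
    refine hp ?_
    have hk : wt α < p.2 → residueTerm n a u α p = 0 := by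
      intro hlt
      rw [residueTerm, MvPowerSeries.coeff_mul, Finset.sum_eq_zero, zero_mul]
      intro q hq
      have hw := wt_of_mem_antidiagonal hq
      rw [coeff_expXi, if_neg (by omega), mul_zero]
    rcases lt_or_ge (wt α) p.2 with h | h
    · exact hk h
    · rw [residueTerm, hu _ (by omega), mul_zero]

/-! ### The pairing over the field of fractions -/

theorem algebraMap_injective : Function.Injective (algebraMap TimeSeries TimeField) :=
  IsFractionRing.injective _ _

theorem algebraMap_ne_zero {τ : TimeSeries} (h : τ ≠ 0) : algebraMap TimeSeries TimeField τ ≠ 0 :=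
  fun h' => h (algebraMap_injective (by rw [h', map_zero]))

/-- The pairs `(A, y)` such that the symbol `A` over the field of fractions has bounded order and a
common denominator, and its pairing with `u` is `y`. -/
def PairRel (u : SatoSpace) : Submodule TimeField ((ℤ → TimeField) × TimeField) where
  carrier := {x | ∃ (τ : TimeSeries) (a : ℤ → TimeSeries) (N : ℤ), τ ≠ 0 ∧ OrdLE N a ∧
    (∀ i, algebraMap TimeSeries TimeField (a i) = algebraMap TimeSeries TimeField τ * x.1 i) ∧
    algebraMap TimeSeries TimeField (pairing a u) = algebraMap TimeSeries TimeField τ * x.2}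
  zero_mem' := by
    refine ⟨1, fun _ => 0, 0, one_ne_zero, fun _ _ => rfl, fun i => by simp, ?_⟩
    have := pairing_mul_left (n := 0) (a := fun _ => 0) (fun _ _ => rfl) 0 u
    simp only [mul_zero, zero_mul] at this
    simp [this]
  add_mem' := by
    rintro x y ⟨τ, a, N, h1, h2, h3, h4⟩ ⟨τ', a', N', h1', h2', h3', h4'⟩
    have h5 : OrdLE (max N N') fun i => τ' * a i :=
      (h2.mul_left τ').mono (le_max_left N N')
    have h6 : OrdLE (max N N') fun i => τ * a' i :=
      (h2'.mul_left τ).mono (le_max_right N N')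
    refine ⟨τ * τ', fun i => τ' * a i + τ * a' i, max N N', mul_ne_zero h1 h1',
      fun i hi => by simp only [h5 i hi, h6 i hi, add_zero], fun i => ?_, ?_⟩
    · simp only [map_add, map_mul, h3, h3', Prod.fst_add, Pi.add_apply]
      ring
    · rw [pairing_add_left h5 h6, pairing_mul_left h2, pairing_mul_left h2']
      simp only [map_add, map_mul, h4, h4', Prod.snd_add]
      ring
  smul_mem' := by
    rintro c x ⟨τ, a, N, h1, h2, h3, h4⟩
    obtain ⟨p, q, hq, rfl⟩ := IsFractionRing.div_surjective (A := TimeSeries) c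
    have hq0 : q ≠ 0 := nonZeroDivisors.ne_zero hq
    have hq1 := algebraMap_ne_zero hq0
    refine ⟨q * τ, fun i => p * a i, N, mul_ne_zero hq0 h1,
      fun i hi => by simp only [h2 i hi, mul_zero], fun i => ?_, ?_⟩
    · simp only [map_mul, h3, Prod.smul_fst, Pi.smul_apply, smul_eq_mul]
      field_simp
    · rw [pairing_mul_left h2]
      simp only [map_mul, h4, Prod.smul_snd, smul_eq_mul]
      field_simp

theorem mem_pairRel {u : SatoSpace} {A : ℤ → TimeField} {y : TimeField} :
    (A, y) ∈ PairRel u ↔ ∃ (τ : TimeSeries) (a : ℤ → TimeSeries) (N : ℤ), τ ≠ 0 ∧ OrdLE N a ∧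
    (∀ i, algebraMap TimeSeries TimeField (a i) = algebraMap TimeSeries TimeField τ * A i) ∧
    algebraMap TimeSeries TimeField (pairing a u) = algebraMap TimeSeries TimeField τ * y := Iff.rfl

/-- The pairing does not depend on the denominator. -/
theorem pairRel_unique {u : SatoSpace} {A : ℤ → TimeField} {y : TimeField} (h : (A, y) ∈ PairRel u)
    {τ : TimeSeries} {a : ℤ → TimeSeries} {N : ℤ} (ha : OrdLE N a)
    (hτ : ∀ i, algebraMap TimeSeries TimeField (a i) = algebraMap TimeSeries TimeField τ * A i) :
    algebraMap TimeSeries TimeField (pairing a u) = algebraMap TimeSeries TimeField τ * y := by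
  obtain ⟨σ, b, M, h1, h2, h3, h4⟩ := h
  have e : (fun i => σ * a i) = fun i => τ * b i := by
    funext i
    apply algebraMap_injective
    rw [map_mul, map_mul, hτ, h3]
    ring
  have h5 := pairing_mul_left ha σ u
  rw [e, pairing_mul_left h2] at h5
  have h6 := congrArg (algebraMap TimeSeries TimeField) h5
  rw [map_mul, map_mul, h4] at h6
  apply mul_left_cancel₀ (algebraMap_ne_zero h1)
  rw [← h6]
  ring

theorem pairRel_zero_left {u : SatoSpace} {y : TimeField} (h : (0, y) ∈ PairRel u) : y = 0 := by
  obtain ⟨σ, b, M, h1, h2, h3, h4⟩ := h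
  have e : b = fun i => 0 * b i := by
    funext i
    apply algebraMap_injective
    rw [h3]
    simp
  rw [e, pairing_mul_left h2] at h4
  simp only [zero_mul, map_zero] at h4
  exact (mul_eq_zero.1 h4.symm).resolve_left (algebraMap_ne_zero h1)

/-- The pairing over the field of fractions intertwines `A ↦ ∂A/∂tₖ + A ∂ᵏ` with `∂/∂tₖ`. -/
theorem pairRel_covD {u : SatoSpace} {A : ℤ → TimeField} {y : TimeField} (h : (A, y) ∈ PairRel u)
    (k : ℕ+) : (covD (dt k) (k : ℕ) A, dt k y) ∈ PairRel u := by
  obtain ⟨τ, a, N, h1, h2, h3, h4⟩ := h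
  have hk := k.pos
  have h5 : OrdLE (N + k) (covD (MvPowerSeries.pderiv ℂ k) (k : ℕ) a) := fun i hi => by
    rw [covD, h2 i (by omega), h2 _ (by omega), map_zero, add_zero]
  have h6 : OrdLE (N + k) fun i => τ * covD (MvPowerSeries.pderiv ℂ k) (k : ℕ) a i :=
    h5.mul_left τ
  have h7 : OrdLE (N + k) fun i => -MvPowerSeries.pderiv ℂ k τ * a i :=
    (h2.mul_left _).mono (by omega)
  refine ⟨τ * τ, fun i => τ * covD (MvPowerSeries.pderiv ℂ k) (k : ℕ) a i +
    -MvPowerSeries.pderiv ℂ k τ * a i, N + k, mul_ne_zero h1 h1,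
    fun i hi => by simp only [h6 i hi, h7 i hi, add_zero], fun i => ?_, ?_⟩
  · have h8 := congrArg (dt k) (h3 i)
    rw [dt_algebraMap, dt_mul, dt_algebraMap] at h8
    simp only [covD, map_add, map_mul, map_neg, h8, h3]
    ring
  · have h8 := congrArg (dt k) h4
    rw [dt_algebraMap, dt_mul, dt_algebraMap] at h8
    rw [pairing_add_left h6 h7, pairing_mul_left h5, pairing_mul_left h2, pairing_covD h2]
    simp only [map_add, map_mul, map_neg, h8, h4]
    ring

/-! ### Rational functions of the times -/

/-- Rational functions of finitely many times. -/
abbrev TimeRat : Type := FractionRing TimePoly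

theorem coe_injective_timePoly :
    Function.Injective ((algebraMap TimeSeries TimeField).comp
      (MvPolynomial.coeToMvPowerSeries.ringHom (σ := ℕ+) (R := ℂ))) :=
  algebraMap_injective.comp (MvPolynomial.coe_injective _ _)

/-- The inclusion of rational functions into formal meromorphic functions. -/
def ratIncl : TimeRat →+* TimeField := IsFractionRing.lift coe_injective_timePoly

theorem ratIncl_algebraMap (p : TimePoly) :
    ratIncl (algebraMap TimePoly TimeRat p) =
      algebraMap TimeSeries TimeField (p : MvPowerSeries ℕ+ ℂ) :=
  IsFractionRing.lift_algebraMap coe_injective_timePoly p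

theorem ratIncl_injective : Function.Injective ratIncl := ratIncl.injective

theorem coe_pderiv (n : ℕ+) (p : TimePoly) :
    ((MvPolynomial.pderiv n p : TimePoly) : MvPowerSeries ℕ+ ℂ) =
      MvPowerSeries.pderiv ℂ n (p : MvPowerSeries ℕ+ ℂ) := by
  ext α
  rw [MvPowerSeries.coeff_pderiv, MvPolynomial.coeff_coe, MvPolynomial.coeff_coe,
    MvPolynomial.coeff_pderiv]

/-- The rational functions are stable under `∂/∂tₙ` inside the formal meromorphic functions. -/
theorem exists_ratIncl_eq_dt (n : ℕ+) (x : TimeRat) :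
    ∃ y : TimeRat, ratIncl y = dt n (ratIncl x) := by
  obtain ⟨p, q, hq, rfl⟩ := IsFractionRing.div_surjective (A := TimePoly) x
  have hq0 : q ≠ 0 := nonZeroDivisors.ne_zero hq
  set P := algebraMap TimePoly TimeRat p
  set Q := algebraMap TimePoly TimeRat q
  have hQ : ratIncl Q ≠ 0 := by
    rw [map_ne_zero]
    exact fun h => hq0 ((IsFractionRing.injective TimePoly TimeRat) (by rw [map_zero]; exact h))
  have hd : ∀ r : TimePoly, ratIncl (algebraMap TimePoly TimeRat (MvPolynomial.pderiv n r)) =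
      dt n (ratIncl (algebraMap TimePoly TimeRat r)) := fun r => by
    rw [ratIncl_algebraMap, ratIncl_algebraMap, dt_algebraMap, coe_pderiv]
  refine ⟨(Q * algebraMap TimePoly TimeRat (MvPolynomial.pderiv n p) -
    P * algebraMap TimePoly TimeRat (MvPolynomial.pderiv n q)) / Q ^ 2, ?_⟩
  have h := dt_mul n (ratIncl P / ratIncl Q) (ratIncl Q)
  rw [div_mul_cancel₀ _ hQ] at h
  simp only [map_div₀, map_sub, map_mul, map_pow, hd]
  field_simp
  field_simp at h
  linear_combination h

/-- The partial derivative `∂/∂tₙ` of rational functions. -/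
def ratD (n : ℕ+) : TimeRat →+ TimeRat where
  toFun x := (exists_ratIncl_eq_dt n x).choose
  map_zero' := ratIncl_injective (by
    rw [(exists_ratIncl_eq_dt n 0).choose_spec, map_zero, dt_zero])
  map_add' x y := ratIncl_injective (by
    rw [(exists_ratIncl_eq_dt n (x + y)).choose_spec, map_add, map_add, dt_add,
      (exists_ratIncl_eq_dt n x).choose_spec, (exists_ratIncl_eq_dt n y).choose_spec])

theorem ratIncl_ratD (n : ℕ+) (x : TimeRat) : ratIncl (ratD n x) = dt n (ratIncl x) :=
  (exists_ratIncl_eq_dt n x).choose_spec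

theorem ratD_mul (n : ℕ+) (x y : TimeRat) : ratD n (x * y) = x * ratD n y + y * ratD n x :=
  ratIncl_injective (by simp only [map_add, map_mul, ratIncl_ratD, dt_mul])

theorem ratD_algebraMap (n : ℕ+) (p : TimePoly) :
    ratD n (algebraMap TimePoly TimeRat p) =
      algebraMap TimePoly TimeRat (MvPolynomial.pderiv n p) :=
  ratIncl_injective (by
    rw [ratIncl_ratD, ratIncl_algebraMap, ratIncl_algebraMap, dt_algebraMap, coe_pderiv])

theorem dt_comm (j k : ℕ+) (x : TimeField) : dt j (dt k x) = dt k (dt j x) := by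
  have hR : ∀ f : TimeSeries, dt j (dt k (algebraMap TimeSeries TimeField f)) =
      dt k (dt j (algebraMap TimeSeries TimeField f)) := by
    intro f
    simp only [dt_algebraMap]
    congr 1
    ext α
    simp only [MvPowerSeries.coeff_pderiv, Finsupp.add_apply]
    rw [add_right_comm]
    rcases eq_or_ne j k with rfl | h
    · rfl
    · rw [Finsupp.single_eq_of_ne h, Finsupp.single_eq_of_ne h.symm]
      simp only [add_zero]
      ring
  obtain ⟨p, q, hq, rfl⟩ := IsFractionRing.div_surjective (A := TimeSeries) x
  have hq1 := algebraMap_ne_zero (nonZeroDivisors.ne_zero hq)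
  have h := hR p
  have hpq : algebraMap TimeSeries TimeField p = algebraMap TimeSeries TimeField q *
    (algebraMap TimeSeries TimeField p / algebraMap TimeSeries TimeField q) := by field_simp
  rw [hpq] at h
  simp only [dt_mul, dt_add, hR q] at h
  apply mul_left_cancel₀ hq1
  linear_combination h

theorem ratD_comm (j k : ℕ+) (x : TimeRat) : ratD j (ratD k x) = ratD k (ratD j x) :=
  ratIncl_injective (by simp only [ratIncl_ratD, dt_comm j k])

theorem timePoly_const_of_pderiv {p : TimePoly} (h : ∀ n, MvPolynomial.pderiv n p = 0) :
    p = MvPolynomial.C (MvPolynomial.coeff 0 p) := by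
  classical
  ext β
  rw [MvPolynomial.coeff_C]
  split_ifs with hβ
  · rw [hβ]
  · obtain ⟨n, hn⟩ : ∃ n, β n ≠ 0 := by
      by_contra! h0
      exact hβ (Finsupp.ext h0).symm
    have h1 : β - Finsupp.single n 1 + Finsupp.single n 1 = β :=
      tsub_add_cancel_of_le (Finsupp.single_le_iff.2 (Nat.one_le_iff_ne_zero.2 hn))
    have h2 := congrArg (MvPolynomial.coeff (β - Finsupp.single n 1)) (h n)
    rw [MvPolynomial.coeff_pderiv, h1, MvPolynomial.coeff_zero] at h2
    exact (mul_eq_zero.1 h2).resolve_right (Nat.cast_add_one_ne_zero _)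

/-- A nonzero derivative has smaller degree in `tₙ` than `p`, so it is not divisible by `p`. -/
theorem pderiv_eq_zero_of_dvd {n : ℕ+} {p : TimePoly} (h : p ∣ MvPolynomial.pderiv n p) :
    MvPolynomial.pderiv n p = 0 := by
  by_contra h0
  have hp : p ≠ 0 := by rintro rfl; simp at h0
  obtain ⟨q, hq⟩ := h
  have hq0 : q ≠ 0 := by rintro rfl; simp [hq] at h0
  have h1 : p.degreeOf n ≤ (MvPolynomial.pderiv n p).degreeOf n := by
    rw [hq, MvPolynomial.degreeOf_mul_eq hp hq0]
    exact Nat.le_add_right _ _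
  obtain ⟨α, hα⟩ := MvPolynomial.ne_zero_iff.1 h0
  rw [MvPolynomial.coeff_pderiv] at hα
  have h2 : 0 < p.degreeOf n := by
    have := MvPolynomial.monomial_le_degreeOf n
      (MvPolynomial.mem_support_iff.2 (left_ne_zero_of_mul hα))
    simp at this
    omega
  have h3 : (MvPolynomial.pderiv n p).degreeOf n < p.degreeOf n := by
    rw [MvPolynomial.degreeOf_lt_iff h2]
    intro β hβ
    rw [MvPolynomial.mem_support_iff, MvPolynomial.coeff_pderiv] at hβ
    have := MvPolynomial.monomial_le_degreeOf n
      (MvPolynomial.mem_support_iff.2 (left_ne_zero_of_mul hβ))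
    simp at this
    omega
  omega

/-- A rational function all of whose partial derivatives vanish is a constant: in lowest terms, the
denominator divides its derivatives. -/
theorem exists_const_of_ratD_eq_zero {x : TimeRat} (h : ∀ n, ratD n x = 0) :
    ∃ c : ℂ, x = algebraMap ℂ TimeRat c := by
  set p := IsFractionRing.num TimePoly x
  set q := (IsFractionRing.den TimePoly x : TimePoly)
  have hq : q ≠ 0 := nonZeroDivisors.ne_zero (IsFractionRing.den TimePoly x).2
  have hrel : IsRelPrime p q := IsFractionRing.num_den_reduced TimePoly x
  have hinj := IsFractionRing.injective TimePoly TimeRat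
  have hq1 : algebraMap TimePoly TimeRat q ≠ 0 := fun h0 => hq (hinj (by rw [h0, map_zero]))
  have hx : algebraMap TimePoly TimeRat p = algebraMap TimePoly TimeRat q * x := by
    have h1 := IsFractionRing.mk'_num_den TimePoly x
    rw [mul_comm, ← IsLocalization.mk'_spec TimeRat p (IsFractionRing.den TimePoly x)]
    rw [h1]
  have key : ∀ n, q * MvPolynomial.pderiv n p = p * MvPolynomial.pderiv n q := by
    intro n
    apply hinj
    have h1 := congrArg (ratD n) hx
    rw [ratD_mul, h n, mul_zero, zero_add, ratD_algebraMap, ratD_algebraMap] at h1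
    rw [map_mul, map_mul, h1, hx]
    ring
  have hq2 : ∀ n, MvPolynomial.pderiv n q = 0 := fun n =>
    pderiv_eq_zero_of_dvd (hrel.symm.dvd_of_dvd_mul_left ⟨_, (key n).symm⟩)
  have hp2 : ∀ n, MvPolynomial.pderiv n p = 0 := fun n => by
    have := key n
    rw [hq2, mul_zero] at this
    exact (mul_eq_zero.1 this).resolve_left hq
  have e1 := timePoly_const_of_pderiv hp2
  have e2 := timePoly_const_of_pderiv hq2
  have hC : ∀ c : ℂ, algebraMap TimePoly TimeRat (MvPolynomial.C c) = algebraMap ℂ TimeRat c :=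
    fun c => (IsScalarTower.algebraMap_apply ℂ TimePoly TimeRat c).symm
  refine ⟨MvPolynomial.coeff 0 p / MvPolynomial.coeff 0 q, ?_⟩
  rw [e1, e2, hC, hC] at hx
  rw [e2, hC] at hq1
  rw [map_div₀, hx]
  field_simp

theorem exists_pderiv_eq_zero (p : TimePoly) :
    ∃ N : ℕ, ∀ n : ℕ+, N ≤ n → MvPolynomial.pderiv n p = 0 := by
  refine ⟨(p.vars.sup fun n : ℕ+ => (n : ℕ)) + 1, fun n hn => ?_⟩
  refine MvPolynomial.pderiv_eq_zero_of_notMem_vars fun h => ?_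
  have : (n : ℕ) ≤ p.vars.sup fun n : ℕ+ => (n : ℕ) :=
    Finset.le_sup (f := fun n : ℕ+ => (n : ℕ)) h
  omega

/-- A rational function depends on finitely many times. -/
theorem exists_ratD_eq_zero (x : TimeRat) : ∃ N : ℕ, ∀ n : ℕ+, N ≤ n → ratD n x = 0 := by
  obtain ⟨p, q, hq, rfl⟩ := IsFractionRing.div_surjective (A := TimePoly) x
  have hq1 : algebraMap TimePoly TimeRat q ≠ 0 := fun h0 => nonZeroDivisors.ne_zero hq
    (IsFractionRing.injective TimePoly TimeRat (by rw [h0, map_zero]))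
  obtain ⟨N, hN⟩ := exists_pderiv_eq_zero p
  obtain ⟨M, hM⟩ := exists_pderiv_eq_zero q
  refine ⟨max N M, fun n hn => ?_⟩
  have h := ratD_mul n (algebraMap TimePoly TimeRat q)
    (algebraMap TimePoly TimeRat p / algebraMap TimePoly TimeRat q)
  rw [mul_div_cancel₀ _ hq1, ratD_algebraMap, ratD_algebraMap, hN n (by omega), hM n (by omega),
    map_zero, mul_zero, add_zero] at h
  exact (mul_eq_zero.1 h.symm).resolve_left hq1

/-! ### Leading forms -/

/-- `x` has order at least `d` with respect to the weight, and its component of weight `d` is `ℓ`: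
`x = a / b` where `b` has order exactly `j`, `a` has order at least `i = d + j`, and `ℓ` is the
quotient of the components of `a` and `b` of weights `i` and `j`. -/
def HasLead (d : ℤ) (x : TimeField) (ℓ : TimeRat) : Prop :=
  ∃ (a b : TimeSeries) (i j : ℕ), (i : ℤ) - j = d ∧ a ∈ ordIdeal i ∧ b ∈ ordIdeal j ∧
    comp j b ≠ 0 ∧ x * algebraMap TimeSeries TimeField b = algebraMap TimeSeries TimeField a ∧
    ℓ * algebraMap TimePoly TimeRat (comp j b) = algebraMap TimePoly TimeRat (comp i a)

theorem algebraMap_timePoly_ne_zero {p : TimePoly} (h : p ≠ 0) :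
    algebraMap TimePoly TimeRat p ≠ 0 := fun h0 =>
  h (IsFractionRing.injective TimePoly TimeRat (by rw [h0, map_zero]))

/-- The power series `t₁ᵐ`, of order `m`. -/
theorem exists_ord_eq (m : ℕ) : ∃ f : TimeSeries, f ∈ ordIdeal m ∧ comp m f ≠ 0 := by
  classical
  refine ⟨MvPowerSeries.monomial (Finsupp.single 1 m) 1, fun α hα => ?_, fun h => ?_⟩
  · rw [MvPowerSeries.coeff_monomial, if_neg]
    rintro rfl
    rw [wt_single] at hα
    simp at hα
  · have := congrArg (MvPolynomial.coeff (Finsupp.single 1 m)) h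
    rw [coeff_comp, wt_single, if_pos (by simp), MvPowerSeries.coeff_monomial, if_pos rfl,
      MvPolynomial.coeff_zero] at this
    exact one_ne_zero this

/-- Numerator and denominator can be multiplied by a power of `t₁`, so their orders may be taken as
large as desired. -/
theorem HasLead.exists_shift {d : ℤ} {x : TimeField} {ℓ : TimeRat} (h : HasLead d x ℓ) (m : ℕ) :
    ∃ (a b : TimeSeries) (i j : ℕ), m ≤ i ∧ m ≤ j ∧ (i : ℤ) - j = d ∧ a ∈ ordIdeal i ∧
      b ∈ ordIdeal j ∧ comp j b ≠ 0 ∧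
      x * algebraMap TimeSeries TimeField b = algebraMap TimeSeries TimeField a ∧
      ℓ * algebraMap TimePoly TimeRat (comp j b) = algebraMap TimePoly TimeRat (comp i a) := by
  obtain ⟨a, b, i, j, h1, h2, h3, h4, h5, h6⟩ := h
  obtain ⟨f, hf, hf'⟩ := exists_ord_eq m
  refine ⟨a * f, b * f, i + m, j + m, by omega, by omega, by push_cast; omega,
    mul_mem_ordIdeal h2 hf, mul_mem_ordIdeal h3 hf, ?_, ?_, ?_⟩
  · rw [comp_mul h3 hf]
    exact mul_ne_zero h4 hf'
  · rw [map_mul, map_mul, ← h5, mul_assoc]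
  · rw [comp_mul h3 hf, comp_mul h2 hf, map_mul, map_mul, ← h6, mul_assoc]

/-- An element of order at least `d` has component zero in all weights below `d`. -/
theorem HasLead.lower {d d' : ℤ} {x : TimeField} {ℓ : TimeRat} (h : HasLead d x ℓ) (hd : d' < d) :
    HasLead d' x 0 := by
  obtain ⟨a, b, i, j, h1, h2, h3, h4, h5, h6⟩ := h
  obtain ⟨m, hm⟩ : ∃ m : ℕ, d - d' = m := ⟨(d - d').toNat, by omega⟩
  obtain ⟨f, hf, hf'⟩ := exists_ord_eq m
  have h7 := mul_mem_ordIdeal h2 hf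
  refine ⟨a * f, b * f, i, j + m, by push_cast; omega, ordIdeal_anti (by omega) h7,
    mul_mem_ordIdeal h3 hf, ?_, ?_, ?_⟩
  · rw [comp_mul h3 hf]
    exact mul_ne_zero h4 hf'
  · rw [map_mul, map_mul, ← h5, mul_assoc]
  · rw [comp_eq_zero_of_mem h7 (by omega), zero_mul, map_zero]

theorem HasLead.zero (d : ℤ) : HasLead d 0 0 := by
  obtain ⟨f, hf, hf'⟩ := exists_ord_eq (-d).toNat
  exact ⟨0, f, d.toNat, (-d).toNat, by omega, Ideal.zero_mem _, hf, hf', by simp,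
    by simp [comp_zero]⟩

theorem HasLead.add {d : ℤ} {x y : TimeField} {ℓ m : TimeRat} (hx : HasLead d x ℓ)
    (hy : HasLead d y m) : HasLead d (x + y) (ℓ + m) := by
  obtain ⟨a, b, i, j, h1, h2, h3, h4, h5, h6⟩ := hx
  obtain ⟨a', b', i', j', h1', h2', h3', h4', h5', h6'⟩ := hy
  have e : i + j' = i' + j := by omega
  have h7 := mul_mem_ordIdeal h2 h3'
  have h8 := mul_mem_ordIdeal h2' h3
  have h9 := comp_mul h2' h3
  rw [← e] at h8 h9
  refine ⟨a * b' + a' * b, b * b', i + j', j + j', by push_cast; omega, Ideal.add_mem _ h7 h8,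
    mul_mem_ordIdeal h3 h3', ?_, ?_, ?_⟩
  · rw [comp_mul h3 h3']
    exact mul_ne_zero h4 h4'
  · simp only [map_add, map_mul, ← h5, ← h5']
    ring
  · rw [comp_add, comp_mul h3 h3', comp_mul h2 h3', h9]
    simp only [map_add, map_mul, ← h6, ← h6']
    ring

theorem HasLead.mul {d e : ℤ} {x y : TimeField} {ℓ m : TimeRat} (hx : HasLead d x ℓ)
    (hy : HasLead e y m) : HasLead (d + e) (x * y) (ℓ * m) := by
  obtain ⟨a, b, i, j, h1, h2, h3, h4, h5, h6⟩ := hx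
  obtain ⟨a', b', i', j', h1', h2', h3', h4', h5', h6'⟩ := hy
  refine ⟨a * a', b * b', i + i', j + j', by push_cast; omega, mul_mem_ordIdeal h2 h2',
    mul_mem_ordIdeal h3 h3', ?_, ?_, ?_⟩
  · rw [comp_mul h3 h3']
    exact mul_ne_zero h4 h4'
  · simp only [map_mul, ← h5, ← h5']
    ring
  · rw [comp_mul h3 h3', comp_mul h2 h2']
    simp only [map_mul, ← h6, ← h6']
    ring

theorem HasLead.sum {ι : Type*} {d : ℤ} (s : Finset ι) {x : ι → TimeField} {ℓ : ι → TimeRat}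
    (h : ∀ i ∈ s, HasLead d (x i) (ℓ i)) : HasLead d (∑ i ∈ s, x i) (∑ i ∈ s, ℓ i) := by
  classical
  induction s using Finset.induction_on with
  | empty => simpa using HasLead.zero d
  | insert a s ha ih =>
    rw [Finset.sum_insert ha, Finset.sum_insert ha]
    exact (h a (Finset.mem_insert_self a s)).add
      (ih fun i hi => h i (Finset.mem_insert_of_mem hi))

theorem HasLead.dt {d : ℤ} {x : TimeField} {ℓ : TimeRat} (h : HasLead d x ℓ) (k : ℕ+) :
    HasLead (d - k) (dt k x) (ratD k ℓ) := by
  obtain ⟨a, b, i, j, hi, hj, h1, h2, h3, h4, h5, h6⟩ := h.exists_shift k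
  obtain ⟨i, rfl⟩ := Nat.exists_eq_add_of_le' hi
  obtain ⟨j, rfl⟩ := Nat.exists_eq_add_of_le' hj
  have h7 := mul_mem_ordIdeal h3 (pderiv_mem_ordIdeal k h2)
  have h8 := mul_mem_ordIdeal (pderiv_mem_ordIdeal k h3) h2
  have h9 := comp_mul (pderiv_mem_ordIdeal k h3) h2
  have e : j + (i + k) = j + k + i := by omega
  rw [e] at h8 h9
  have h10 := congrArg (MKP.dt k) h5
  have h11 := congrArg (ratD k) h6
  rw [dt_mul, dt_algebraMap, dt_algebraMap] at h10
  rw [ratD_mul, ratD_algebraMap, ratD_algebraMap] at h11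
  refine ⟨b * MvPowerSeries.pderiv ℂ k a - MvPowerSeries.pderiv ℂ k b * a, b * b, j + k + i,
    j + k + (j + k), by push_cast at h1 ⊢; omega, Ideal.sub_mem _ h7 h8, mul_mem_ordIdeal h3 h3, ?_,
    ?_, ?_⟩
  · rw [comp_mul h3 h3]
    exact mul_ne_zero h4 h4
  · simp only [map_sub, map_mul, ← h5]
    linear_combination algebraMap TimeSeries TimeField b * h10
  · rw [comp_mul h3 h3, sub_eq_add_neg, comp_add, comp_neg, comp_mul h3 (pderiv_mem_ordIdeal k h2),
      h9, comp_pderiv, comp_pderiv]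
    simp only [map_add, map_neg, map_mul, ← h6]
    linear_combination algebraMap TimePoly TimeRat (comp (j + k) b) * h11

/-- The leading part does not depend on the representation as a quotient. -/
theorem HasLead.unique {d : ℤ} {x : TimeField} {ℓ m : TimeRat} (hx : HasLead d x ℓ)
    (hy : HasLead d x m) : ℓ = m := by
  obtain ⟨a, b, i, j, h1, h2, h3, h4, h5, h6⟩ := hx
  obtain ⟨a', b', i', j', h1', h2', h3', h4', h5', h6'⟩ := hy
  have e : i + j' = i' + j := by omega
  have h7 : a * b' = a' * b := by
    apply algebraMap_injective
    rw [map_mul, map_mul, ← h5, ← h5']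
    ring
  have h8 := comp_mul h2 h3'
  rw [h7, e, comp_mul h2' h3] at h8
  have h9 := congrArg (algebraMap TimePoly TimeRat) h8
  rw [map_mul, map_mul, ← h6, ← h6'] at h9
  have := mul_ne_zero (algebraMap_timePoly_ne_zero h4) (algebraMap_timePoly_ne_zero h4')
  apply mul_right_cancel₀ this
  linear_combination -h9

/-- Every nonzero element has a leading part. -/
theorem exists_hasLead {x : TimeField} (hx : x ≠ 0) : ∃ (d : ℤ) (ℓ : TimeRat), ℓ ≠ 0 ∧
    HasLead d x ℓ := by
  obtain ⟨p, q, hq, rfl⟩ := IsFractionRing.div_surjective (A := TimeSeries) x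
  have hq0 := nonZeroDivisors.ne_zero hq
  have hp0 : p ≠ 0 := by rintro rfl; simp at hx
  obtain ⟨i, h1, h2⟩ := exists_order hp0
  obtain ⟨j, h3, h4⟩ := exists_order hq0
  have h5 := algebraMap_ne_zero hq0
  have h6 := algebraMap_timePoly_ne_zero h4
  exact ⟨(i : ℤ) - j,
    algebraMap TimePoly TimeRat (comp i p) / algebraMap TimePoly TimeRat (comp j q),
    div_ne_zero (algebraMap_timePoly_ne_zero h2) h6,
    p, q, i, j, rfl, h1, h3, h4, div_mul_cancel₀ _ h5, div_mul_cancel₀ _ h6⟩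

open Polynomial

/-! ### Subspaces stable under differentiation -/

theorem ratD_one (k : ℕ+) : ratD k 1 = 0 := by
  have h := ratD_mul k 1 1
  simpa using h

/-- A subspace of a finite-dimensional coordinate space over the rational functions that is stable
under all `∂/∂tₖ` is spanned by constant vectors. -/
theorem mem_span_const {ι : Type*} [Fintype ι] {N : Submodule TimeRat (ι → TimeRat)}
    (hN : ∀ (k : ℕ+), ∀ x ∈ N, (fun i => ratD k (x i)) ∈ N) {x : ι → TimeRat} (hx : x ∈ N) :
    x ∈ Submodule.span TimeRat
      {y | y ∈ N ∧ ∃ c : ι → ℂ, y = fun i => algebraMap ℂ TimeRat (c i)} := by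
  classical
  induction hn : (Finset.univ.filter fun i => x i ≠ 0).card using Nat.strong_induction_on
    generalizing x with
  | _ n ih =>
  by_cases hx0 : x = 0
  · rw [hx0]; exact Submodule.zero_mem _
  obtain ⟨i₀, hi₀⟩ : ∃ i, x i ≠ 0 := Function.ne_iff.1 hx0
  -- elements of `N` whose support is contained in that of `x` and misses a point of it
  have small : ∀ y ∈ N, (∀ i, x i = 0 → y i = 0) → (∃ i, x i ≠ 0 ∧ y i = 0) →
      y ∈ Submodule.span TimeRat
        {y | y ∈ N ∧ ∃ c : ι → ℂ, y = fun i => algebraMap ℂ TimeRat (c i)} := by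
    rintro y hy h1 ⟨i, hi, hyi⟩
    refine ih _ ?_ hy rfl
    rw [← hn]
    refine Finset.card_lt_card ⟨fun j hj => ?_, fun h => ?_⟩
    · simp only [Finset.mem_filter, Finset.mem_univ, true_and] at hj ⊢
      exact fun h => hj (h1 j h)
    · have := h (show i ∈ _ by simpa using hi)
      simp [hyi] at this
  -- after normalising one coordinate to `1`, all derivatives have smaller support
  set z : ι → TimeRat := (x i₀)⁻¹ • x with hz
  have hzN : z ∈ N := Submodule.smul_mem _ _ hx
  have hzx : x = x i₀ • z := by rw [hz, smul_smul, mul_inv_cancel₀ hi₀, one_smul]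
  by_cases hc : ∀ (k : ℕ+) i, ratD k (z i) = 0
  · rw [hzx]
    refine Submodule.smul_mem _ _ (Submodule.subset_span ⟨hzN, ?_⟩)
    choose c hc using fun i => exists_const_of_ratD_eq_zero fun k => hc k i
    exact ⟨c, funext hc⟩
  · push Not at hc
    obtain ⟨k, i₁, hi₁⟩ := hc
    set y : ι → TimeRat := fun i => ratD k (z i) with hy
    have hyN : y ∈ N := hN k z hzN
    have hyx : ∀ i, x i = 0 → y i = 0 := fun i hi => by
      simp [hy, hz, hi]
    have hy0 : y i₀ = 0 := by
      simp [hy, hz, hi₀, ratD_one]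
    have h1 := small y hyN hyx ⟨i₀, hi₀, hy0⟩
    -- subtracting a multiple of the derivative cancels another coordinate
    have h2 := small (x - (x i₁ / y i₁) • y) (Submodule.sub_mem _ hx (Submodule.smul_mem _ _ hyN))
      (fun i hi => by simp [hi, hyx i hi])
      ⟨i₁, fun h => hi₁ (hyx i₁ h), by simp [div_mul_cancel₀ _ (show y i₁ ≠ 0 from hi₁)]⟩
    have h3 := Submodule.add_mem _ h2 (Submodule.smul_mem _ (x i₁ / y i₁) h1)
    rwa [sub_add_cancel] at h3

/-! ### Connections on polynomials -/

section PolyD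

variable {F : Type*} [Field F]

/-- Application of an additive map to the coefficients of a polynomial. -/
def coefD (δ : F →+ F) (p : F[X]) : F[X] := p.sum fun i a => monomial i (δ a)

theorem coeff_coefD (δ : F →+ F) (p : F[X]) (i : ℕ) : (coefD δ p).coeff i = δ (p.coeff i) := by
  classical
  rw [coefD, Polynomial.sum, finsetSum_coeff]
  simp only [coeff_monomial]
  rw [Finset.sum_ite_eq']
  split_ifs with h
  · rfl
  · rw [notMem_support_iff.1 h, map_zero]

/-- The operator `p ↦ δp + λᵏ p` on polynomials in `λ` (written `X`). -/
def polyD (δ : F →+ F) (k : ℕ) (p : F[X]) : F[X] := coefD δ p + X ^ k * p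

theorem coeff_polyD (δ : F →+ F) (k : ℕ) (p : F[X]) (i : ℕ) :
    (polyD δ k p).coeff i = δ (p.coeff i) + if k ≤ i then p.coeff (i - k) else 0 := by
  rw [polyD, coeff_add, coeff_coefD, coeff_X_pow_mul']

theorem isConnection_polyD {δ : F →+ F} (h1 : ∀ a b, δ (a * b) = a * δ b + b * δ a) (k : ℕ) :
    IsConnection δ (polyD δ k) where
  map_add p q := by
    ext i
    simp only [coeff_polyD, coeff_add, map_add]
    split_ifs <;> ring
  map_smul a p := by
    ext i
    simp only [coeff_polyD, coeff_add, coeff_smul, smul_eq_mul, h1]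
    split_ifs <;> ring

theorem polyD_comm {δ ε : F →+ F} (h : ∀ a, δ (ε a) = ε (δ a)) (j k : ℕ) (p : F[X]) :
    polyD δ j (polyD ε k p) = polyD ε k (polyD δ j p) := by
  ext i
  simp only [coeff_polyD, map_add, h, apply_ite δ, apply_ite ε, map_zero]
  split_ifs <;> first | omega | (rw [Nat.sub_right_comm]; ring) | ring

/-- `(δ + λ)ⁱ P` has degree `deg P + i` and the same leading coefficient as `P`. -/
theorem coeff_iterate_polyD (δ : F →+ F) (P : F[X]) (i : ℕ) :
    (∀ j, P.natDegree + i < j → ((polyD δ 1)^[i] P).coeff j = 0) ∧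
      ((polyD δ 1)^[i] P).coeff (P.natDegree + i) = P.leadingCoeff := by
  induction i with
  | zero => exact ⟨fun j hj => coeff_eq_zero_of_natDegree_lt hj, rfl⟩
  | succ i ih =>
    rw [Function.iterate_succ_apply']
    refine ⟨fun j hj => ?_, ?_⟩
    · rw [coeff_polyD, ih.1 j (by omega), ih.1 (j - 1) (by omega)]
      simp
    · rw [coeff_polyD, if_pos (by omega), ih.1 _ (by omega), map_zero, zero_add]
      exact ih.2

/-- The polynomials `(δ + λ)ⁱ P` are independent modulo polynomials of smaller degree than `P`. -/
theorem eq_zero_of_sum_iterate_polyD {δ : F →+ F} {P : F[X]} (hP : P ≠ 0) {m : ℕ}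
    {g : ℕ → F} (h : ∀ j, P.natDegree ≤ j →
      (∑ i ∈ Finset.range m, g i • (polyD δ 1)^[i] P).coeff j = 0) : ∀ i < m, g i = 0 := by
  induction m with
  | zero => intro i hi; omega
  | succ m ih =>
    have hm : g m = 0 := by
      have h2 := h (P.natDegree + m) (by omega)
      rw [Finset.sum_range_succ, coeff_add, coeff_smul, (coeff_iterate_polyD δ P m).2,
        finsetSum_coeff, Finset.sum_eq_zero, zero_add] at h2
      · simpa [hP] using h2
      · intro i hi
        rw [coeff_smul, (coeff_iterate_polyD δ P i).1 _ (by have := Finset.mem_range.1 hi; omega),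
          smul_zero]
    intro i hi
    rcases Nat.lt_succ_iff_lt_or_eq.1 hi with h3 | rfl
    · refine ih (fun j hj => ?_) i h3
      have := h j hj
      rwa [Finset.sum_range_succ, hm, zero_smul, add_zero] at this
    · exact hm

/-- Division with remainder by a monic `P` in the module spanned by the `(δ + λ)ⁱ P`. -/
theorem exists_sub_mem_gSpan {δ : F →+ F} {P : F[X]} (hP : P.Monic) (q : F[X]) :
    ∃ m ∈ gSpan F (polyD δ 1) P, ∀ j, P.natDegree ≤ j → (q - m).coeff j = 0 := by
  obtain ⟨n, hn⟩ : ∃ n, ∀ j, P.natDegree + n ≤ j → q.coeff j = 0 :=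
    ⟨q.natDegree + 1, fun j hj => coeff_eq_zero_of_natDegree_lt (by omega)⟩
  induction n generalizing q with
  | zero => exact ⟨0, Submodule.zero_mem _, fun j hj => by simpa using hn j hj⟩
  | succ n ih =>
    have hit := coeff_iterate_polyD δ P n
    rw [hP.leadingCoeff] at hit
    set c := q.coeff (P.natDegree + n)
    obtain ⟨m, hm, hq⟩ := ih (q - c • (polyD δ 1)^[n] P) fun j hj => by
      rw [coeff_sub, coeff_smul]
      rcases eq_or_lt_of_le hj with rfl | hj
      · rw [hit.2]; simp [c]
      · rw [hit.1 j hj, hn j (by omega)]; simp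
    refine ⟨m + c • (polyD δ 1)^[n] P,
      Submodule.add_mem _ hm (Submodule.smul_mem _ _ (iterate_mem_gSpan n)), fun j hj => ?_⟩
    rw [show q - (m + c • (polyD δ 1)^[n] P) = q - c • (polyD δ 1)^[n] P - m by ring]
    exact hq j hj

end PolyD

/-! ### The flat module generated by a polynomial -/

/-- The polynomial `h_j(t)`, the coefficient of `λʲ` in `e^{ξ(t;λ)}`. -/
def hPoly (j : ℕ) : TimePoly := comp j (expXi j)

theorem coeff_hPoly (j : ℕ) (α : ℕ+ →₀ ℕ) :
    MvPolynomial.coeff α (hPoly j) = if wt α = j then invFact α else 0 := by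
  rw [hPoly, coeff_comp, coeff_expXi]
  split_ifs <;> rfl

theorem wt_eq_zero_iff {α : ℕ+ →₀ ℕ} : wt α = 0 ↔ α = 0 := by
  refine ⟨fun h0 => Finsupp.ext fun n => ?_, fun h => by rw [h]; rfl⟩
  have h1 : (n : ℕ) * α n ≤ wt α := by
    by_cases hn : n ∈ α.support
    · exact Finset.single_le_sum (f := fun n : ℕ+ => (n : ℕ) * α n) (fun _ _ => Nat.zero_le _) hn
    · simp [Finsupp.notMem_support_iff.1 hn]
  have h2 := n.pos
  rw [h0] at h1
  simpa [h2.ne'] using h1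

theorem hPoly_zero : hPoly 0 = 1 := by
  classical
  ext α
  rw [coeff_hPoly, MvPolynomial.coeff_one]
  by_cases h : α = 0
  · subst h; simp [wt, invFact]
  · rw [if_neg (Ne.symm h), if_neg]
    intro h0
    exact h (wt_eq_zero_iff.1 h0)

theorem pderiv_hPoly (k : ℕ+) (j : ℕ) :
    MvPolynomial.pderiv k (hPoly j) = if (k : ℕ) ≤ j then hPoly (j - k) else 0 := by
  ext α
  rw [MvPolynomial.coeff_pderiv, coeff_hPoly, wt_add, wt_single, mul_one, apply_ite
    (MvPolynomial.coeff α), coeff_hPoly, MvPolynomial.coeff_zero, ite_mul, zero_mul,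
    invFact_add_single]
  split_ifs <;> first | rfl | omega

/-- The exponential `e^{ξ(t;λ)}` as a power series in `λ`. -/
def expSeries : PowerSeries TimeRat :=
  PowerSeries.mk fun j => algebraMap TimePoly TimeRat (hPoly j)

theorem isUnit_expSeries : IsUnit expSeries := by
  rw [PowerSeries.isUnit_iff_constantCoeff, ← PowerSeries.coeff_zero_eq_constantCoeff_apply,
    expSeries, PowerSeries.coeff_mk, hPoly_zero, map_one]
  exact isUnit_one

/-- `∂/∂tₖ e^{ξ(t;λ)} = λᵏ e^{ξ(t;λ)}`. -/
theorem ratD_coeff_expSeries (k : ℕ+) (j : ℕ) :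
    ratD k (PowerSeries.coeff j expSeries) =
      PowerSeries.coeff j (PowerSeries.X ^ (k : ℕ) * expSeries) := by
  rw [PowerSeries.coeff_X_pow_mul', expSeries, PowerSeries.coeff_mk, ratD_algebraMap, pderiv_hPoly]
  split_ifs
  · rw [PowerSeries.coeff_mk]
  · rw [map_zero]

/-- The coefficients of `p(λ) e^{ξ(t;λ)}`. -/
def expVec : TimeRat[X] →ₗ[TimeRat] ℕ → TimeRat where
  toFun p d := PowerSeries.coeff d ((p : PowerSeries TimeRat) * expSeries)
  map_add' p q := by
    funext d
    simp [add_mul]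
  map_smul' c p := by
    funext d
    simp [Polynomial.smul_eq_C_mul, mul_assoc]

theorem expVec_apply (p : TimeRat[X]) (d : ℕ) :
    expVec p d = PowerSeries.coeff d ((p : PowerSeries TimeRat) * expSeries) := rfl

/-- Multiplication by `e^{ξ(t;λ)}` trivialises the connections `∂/∂tₖ + λᵏ`. -/
theorem expVec_polyD (k : ℕ+) (p : TimeRat[X]) (d : ℕ) :
    expVec (polyD (ratD k) k p) d = ratD k (expVec p d) := by
  have e : ((polyD (ratD k) k p : TimeRat[X]) : PowerSeries TimeRat) * expSeries =
      (coefD (ratD k) p : PowerSeries TimeRat) * expSeries +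
        (p : PowerSeries TimeRat) * (PowerSeries.X ^ (k : ℕ) * expSeries) := by
    simp only [polyD, Polynomial.coe_add, Polynomial.coe_mul, Polynomial.coe_pow, Polynomial.coe_X]
    ring
  rw [expVec_apply, expVec_apply, e, map_add, PowerSeries.coeff_mul, PowerSeries.coeff_mul,
    PowerSeries.coeff_mul, map_sum, ← Finset.sum_add_distrib]
  refine Finset.sum_congr rfl fun x _ => ?_
  rw [ratD_mul, ratD_coeff_expSeries, Polynomial.coeff_coe, Polynomial.coeff_coe, coeff_coefD]
  ring

/-- Since `e^{ξ(t;λ)}` is a unit, `p` and `p e^{ξ(t;λ)}` are divisible by the same powers of `λ`. -/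
theorem dvd_of_expVec_eq_zero {D : ℕ} {p : TimeRat[X]} (h : ∀ d < D, expVec p d = 0) :
    X ^ D ∣ p := by
  have h1 : PowerSeries.X ^ D ∣ (p : PowerSeries TimeRat) * expSeries :=
    PowerSeries.X_pow_dvd_iff.2 h
  have h2 := isUnit_expSeries.dvd_mul_right.1 h1
  rw [PowerSeries.X_pow_dvd_iff] at h2
  rw [Polynomial.X_pow_dvd_iff]
  exact fun d hd => by simpa using h2 d hd

/-- Finitely many coefficients of `p(λ) e^{ξ(t;λ)}` can be prescribed. -/
theorem exists_expVec_eq (D : ℕ) (x : ℕ → TimeRat) :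
    ∃ p : TimeRat[X], ∀ d < D, expVec p d = x d := by
  obtain ⟨v, hv⟩ := isUnit_expSeries.exists_left_inv
  refine ⟨PowerSeries.trunc D (PowerSeries.mk x * v), fun d hd => ?_⟩
  have h := PowerSeries.coeff_mul_eq_coeff_trunc_mul_trunc (PowerSeries.mk x * v) expSeries hd
  rw [mul_assoc, hv, mul_one, PowerSeries.coeff_mk] at h
  rw [expVec_apply, PowerSeries.coeff_mul_eq_coeff_trunc_mul_trunc _ _ hd, h,
    PowerSeries.trunc_trunc]

section Flat

variable {P : TimeRat[X]}

theorem isConnection_polyD_ratD (k : ℕ+) : IsConnection (ratD k) (polyD (ratD k) (k : ℕ)) :=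
  isConnection_polyD (ratD_mul k) k

/-- The left module generated by `P`. -/
abbrev flatModule (P : TimeRat[X]) : Submodule TimeRat TimeRat[X] :=
  gSpan TimeRat (polyD (ratD 1) 1) P

/-- If the connections map the generator `P` into the module, they preserve the module. -/
theorem polyD_mem_flatModule (hflat : ∀ k : ℕ+, polyD (ratD k) k P ∈ flatModule P) (k : ℕ+)
    {p : TimeRat[X]} (hp : p ∈ flatModule P) : polyD (ratD k) k p ∈ flatModule P :=
  (isConnection_polyD_ratD 1).map_mem_gSpan_of_comm (isConnection_polyD_ratD k)
    (fun x => polyD_comm (ratD_comm k 1) k 1 x) (hflat k) hp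

/-- Polynomials `g` with `λᵏ g` in the module for all large `k`. -/
def satIdeal (M : Submodule TimeRat TimeRat[X]) : Ideal TimeRat[X] where
  carrier := {g | ∃ k₀ : ℕ, ∀ k, k₀ ≤ k → X ^ k * g ∈ M}
  zero_mem' := ⟨0, fun k _ => by rw [mul_zero]; exact Submodule.zero_mem _⟩
  add_mem' := by
    rintro f g ⟨a, ha⟩ ⟨b, hb⟩
    refine ⟨max a b, fun k hk => ?_⟩
    rw [mul_add]
    exact Submodule.add_mem _ (ha k (by omega)) (hb k (by omega))
  smul_mem' := by
    rintro c g ⟨a, ha⟩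
    refine ⟨a, fun k hk => ?_⟩
    induction c using Polynomial.induction_on' with
    | add p q hp hq =>
      rw [add_smul, mul_add]
      exact Submodule.add_mem _ hp hq
    | monomial n b =>
      have : X ^ k * (monomial n b • g) = b • (X ^ (k + n) * g) := by
        rw [smul_eq_mul, ← C_mul_X_pow_eq_monomial, Polynomial.smul_eq_C_mul]
        ring
      rw [this]
      exact Submodule.smul_mem _ _ (ha _ (by omega))

theorem coefD_eq (k : ℕ+) (p : TimeRat[X]) :
    coefD (ratD k) p = polyD (ratD k) k p - X ^ (k : ℕ) * p := by
  rw [polyD, add_sub_cancel_right]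

theorem coefD_X_pow_mul (δ : TimeRat →+ TimeRat) (l : ℕ) (p : TimeRat[X]) :
    coefD δ (X ^ l * p) = X ^ l * coefD δ p := by
  ext i
  simp only [coeff_coefD, coeff_X_pow_mul']
  split_ifs
  · rfl
  · exact map_zero δ

/-- A polynomial over the rational functions depends on finitely many times. -/
theorem exists_coefD_eq_zero (p : TimeRat[X]) :
    ∃ N : ℕ, ∀ n : ℕ+, N ≤ n → coefD (ratD n) p = 0 := by
  choose N hN using fun i => exists_ratD_eq_zero (p.coeff i)
  refine ⟨(Finset.range (p.natDegree + 1)).sup N, fun n hn => ?_⟩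
  ext i
  rw [coeff_coefD, coeff_zero]
  rcases lt_or_ge p.natDegree i with h | h
  · rw [coeff_eq_zero_of_natDegree_lt h, map_zero]
  · exact hN i n (le_trans (Finset.le_sup (Finset.mem_range.2 (by omega))) hn)

/-- The polynomials `(∂ + λ)ⁱ P` do not depend on any time on which `P` does not depend. -/
theorem coefD_iterate_polyD {k : ℕ+} (h : coefD (ratD k) P = 0) (i : ℕ) :
    coefD (ratD k) ((polyD (ratD 1) 1)^[i] P) = 0 := by
  induction i with
  | zero => exact h
  | succ i ih =>
    rw [Function.iterate_succ_apply']
    ext j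
    have h1 : ∀ j, ratD k (((polyD (ratD 1) 1)^[i] P).coeff j) = 0 := fun j => by
      rw [← coeff_coefD, ih, coeff_zero]
    rw [coeff_coefD, coeff_polyD, map_add, ratD_comm, h1, map_zero, zero_add, apply_ite (ratD k),
      h1, map_zero, ite_self, coeff_zero]

/-- Since `P` depends on finitely many times, `∂P/∂tₖ + λᵏ P = λᵏ P` for `k` large; a flat module is
thus stable under multiplication by high powers of `λ`. -/
theorem self_mem_satIdeal (hflat : ∀ k : ℕ+, polyD (ratD k) k P ∈ flatModule P) :
    P ∈ satIdeal (flatModule P) := by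
  obtain ⟨N, hN⟩ := exists_coefD_eq_zero P
  refine ⟨N + 1, fun k hk => ?_⟩
  obtain ⟨n, rfl⟩ : ∃ n : ℕ+, (n : ℕ) = k := ⟨⟨k, by omega⟩, rfl⟩
  have h1 := hN n (by omega)
  rw [coefD_eq, sub_eq_zero] at h1
  exact h1 ▸ hflat n

/-- The saturation of a flat module is stable under differentiation of coefficients, because both
`∂/∂tₙ + λⁿ` and multiplication by `λⁿ` preserve it. -/
theorem coefD_mem_satIdeal (hflat : ∀ k : ℕ+, polyD (ratD k) k P ∈ flatModule P) (n : ℕ+)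
    {g : TimeRat[X]} (hg : g ∈ satIdeal (flatModule P)) :
    coefD (ratD n) g ∈ satIdeal (flatModule P) := by
  obtain ⟨k₀, hk⟩ := hg
  refine ⟨k₀, fun k h => ?_⟩
  rw [← coefD_X_pow_mul, coefD_eq, ← mul_assoc, ← pow_add]
  exact Submodule.sub_mem _ (polyD_mem_flatModule hflat n (hk k h)) (hk _ (by omega))

theorem exists_eq_span_singleton {F : Type*} [Field F] (J : Ideal F[X]) :
    ∃ f, J = Ideal.span {f} :=
  (IsPrincipalIdealRing.principal J).principal

/-- The generator of the saturation of a flat module has constant coefficients and divides `P`, so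
it is `1` if `P` has no constant root other than `0`. -/
theorem exists_X_pow_mem (hP : P.Monic) (hflat : ∀ k : ℕ+, polyD (ratD k) k P ∈ flatModule P)
    (hroot : ∀ μ : ℂ, μ ≠ 0 → P.eval (algebraMap ℂ TimeRat μ) ≠ 0) :
    ∃ k₀ : ℕ, ∀ k, k₀ ≤ k → X ^ k ∈ flatModule P := by
  set J := satIdeal (flatModule P)
  have hPJ : P ∈ J := self_mem_satIdeal hflat
  obtain ⟨f, hf⟩ : ∃ f, J = Ideal.span {f} := exists_eq_span_singleton J
  have hf0 : f ≠ 0 := by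
    rintro rfl
    rw [hf, Ideal.mem_span_singleton, zero_dvd_iff] at hPJ
    exact hP.ne_zero hPJ
  set g := f * C f.leadingCoeff⁻¹ with hg
  have hmonic : g.Monic := monic_mul_leadingCoeff_inv hf0
  have hdvd : ∀ q, q ∈ J ↔ g ∣ q := by
    intro q
    rw [hf, Ideal.mem_span_singleton, hg]
    have hu : IsUnit (C f.leadingCoeff⁻¹) :=
      Polynomial.isUnit_C.2 (IsUnit.mk0 _ (inv_ne_zero (leadingCoeff_ne_zero.2 hf0)))
    exact (hu.mul_right_dvd).symm
  have hgJ : g ∈ J := (hdvd g).2 dvd_rfl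
  -- the derivative of a monic generator lies in the ideal and has smaller degree
  have hconst : ∀ n, coefD (ratD n) g = 0 := by
    intro n
    refine eq_zero_of_dvd_of_degree_lt ((hdvd _).1 (coefD_mem_satIdeal hflat n hgJ)) ?_
    rw [degree_eq_natDegree hmonic.ne_zero, degree_lt_iff_coeff_zero]
    intro m hm
    rw [coeff_coefD]
    rcases eq_or_lt_of_le hm with rfl | hm
    · rw [hmonic.coeff_natDegree, ratD_one]
    · rw [coeff_eq_zero_of_natDegree_lt hm, map_zero]
  obtain ⟨g₀, hg₀⟩ : ∃ g₀ : ℂ[X], g = g₀.map (algebraMap ℂ TimeRat) := by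
    have h : g ∈ Polynomial.lifts (algebraMap ℂ TimeRat) := by
      rw [Polynomial.lifts_iff_coeff_lifts]
      intro i
      obtain ⟨c, hc⟩ := exists_const_of_ratD_eq_zero (x := g.coeff i) fun n => by
        rw [← coeff_coefD, hconst, coeff_zero]
      exact ⟨c, hc.symm⟩
    obtain ⟨g₀, h⟩ := (Polynomial.mem_lifts g).1 h
    exact ⟨g₀, h.symm⟩
  have hg0 : g₀.Monic := by
    have := hmonic
    rw [hg₀] at this
    exact monic_of_injective (algebraMap ℂ TimeRat).injective this
  by_cases hdeg : g₀.degree = 0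
  · have : g = 1 := by rw [hg₀, hg0.degree_le_zero_iff_eq_one.1 hdeg.le, Polynomial.map_one]
    rw [this] at hgJ
    obtain ⟨k₀, hk⟩ := hgJ
    exact ⟨k₀, fun k h => by simpa using hk k h⟩
  · exfalso
    obtain ⟨μ, hμ⟩ := IsAlgClosed.exists_root g₀ hdeg
    have hroot' : g.eval (algebraMap ℂ TimeRat μ) = 0 := by
      rw [hg₀, eval_map_algebraMap, aeval_algebraMap_apply, aeval_def, Algebra.algebraMap_self]
      simpa using hμ
    -- the ideal is saturated, so a generator divisible by `λ` could be divided by it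
    by_cases hμ0 : μ = 0
    · subst hμ0
      rw [map_zero, ← coeff_zero_eq_eval_zero, ← X_dvd_iff] at hroot'
      obtain ⟨q, hq⟩ := hroot'
      have hqJ : q ∈ J := by
        obtain ⟨k₀, hk⟩ := hgJ
        refine ⟨k₀ + 1, fun k h => ?_⟩
        obtain ⟨k, rfl⟩ := Nat.exists_eq_add_of_le' (show 1 ≤ k by omega)
        rw [pow_add, pow_one, mul_assoc, ← hq]
        exact hk k (by omega)
      have hq0 : q ≠ 0 := by rintro rfl; rw [mul_zero] at hq; exact hmonic.ne_zero hq
      have h1 := natDegree_le_of_dvd ((hdvd q).1 hqJ) hq0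
      rw [hq, natDegree_X_mul hq0] at h1
      omega
    · obtain ⟨q, hq⟩ := (hdvd P).1 hPJ
      refine hroot μ hμ0 ?_
      rw [hq, eval_mul, hroot', zero_mul]

end Flat

/-! ### Coefficients of flat modules after multiplication by the exponential -/

/-- A constant vector outside a subspace stable under all `∂/∂tₖ` is separated from it by a linear
form with constant coefficients. -/
theorem exists_const_form {ι : Type*} [Fintype ι] {N : Submodule TimeRat (ι → TimeRat)}
    (hN : ∀ (k : ℕ+), ∀ x ∈ N, (fun i => ratD k (x i)) ∈ N) {c : ι → ℂ}
    (hc : (fun i => algebraMap ℂ TimeRat (c i)) ∉ N) :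
    ∃ u : ι → ℂ, (∀ x ∈ N, ∑ i, algebraMap ℂ TimeRat (u i) * x i = 0) ∧ ∑ i, u i * c i ≠ 0 := by
  classical
  -- the constant vectors of `N`, as a subspace over `ℂ`
  let N₀ : Submodule ℂ (ι → ℂ) :=
    { carrier := {c | (fun i => algebraMap ℂ TimeRat (c i)) ∈ N}
      zero_mem' := by
        have e : (fun i => algebraMap ℂ TimeRat ((0 : ι → ℂ) i)) = 0 := by
          funext i; simp
        change _ ∈ N
        rw [e]; exact N.zero_mem
      add_mem' := fun {a b} ha hb => by
        have e : (fun i => algebraMap ℂ TimeRat ((a + b) i)) =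
          (fun i => algebraMap ℂ TimeRat (a i)) + fun i => algebraMap ℂ TimeRat (b i) := by
          funext i; simp
        change _ ∈ N
        rw [e]; exact N.add_mem ha hb
      smul_mem' := fun z a ha => by
        have e : (fun i => algebraMap ℂ TimeRat ((z • a) i)) =
          algebraMap ℂ TimeRat z • fun i => algebraMap ℂ TimeRat (a i) := by
          funext i; simp
        change _ ∈ N
        rw [e]; exact N.smul_mem _ ha }
  obtain ⟨φ, hφ, hker⟩ := N₀.exists_le_ker_of_notMem (v := c) hc
  have hsum : ∀ b : ι → ℂ, φ b = ∑ i, φ (Pi.single i 1) * b i := by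
    intro b
    conv_lhs => rw [pi_eq_sum_univ' b]
    rw [map_sum]
    refine Finset.sum_congr rfl fun i _ => ?_
    rw [map_smul, smul_eq_mul, mul_comm]
  refine ⟨fun i => φ (Pi.single i 1), fun x hx => ?_, by rwa [← hsum]⟩
  -- the form vanishes on the constant vectors of `N`, which span it
  have h := mem_span_const hN hx
  let ψ : (ι → TimeRat) →ₗ[TimeRat] TimeRat :=
    ∑ i, algebraMap ℂ TimeRat (φ (Pi.single i 1)) • LinearMap.proj i
  have hψ : ∀ y, ψ y = ∑ i, algebraMap ℂ TimeRat (φ (Pi.single i 1)) * y i := fun y => by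
    simp only [ψ, LinearMap.sum_apply, LinearMap.smul_apply, LinearMap.proj_apply, smul_eq_mul]
  rw [← hψ, ← LinearMap.mem_ker]
  refine Submodule.span_le.2 ?_ h
  rintro _ ⟨h1, b, rfl⟩
  rw [SetLike.mem_coe, LinearMap.mem_ker, hψ]
  simp only [← map_mul, ← map_sum]
  rw [← hsum, LinearMap.mem_ker.1 (hker (show b ∈ N₀ from h1)), map_zero]

variable {P : TimeRat[X]}

theorem expVec_iterate_polyD (p : TimeRat[X]) (i d : ℕ) :
    expVec ((polyD (ratD 1) 1)^[i] p) d = (ratD 1)^[i] (expVec p d) := by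
  induction i with
  | zero => rfl
  | succ i ih =>
    rw [Function.iterate_succ_apply', Function.iterate_succ_apply', ← ih]
    exact expVec_polyD 1 _ d

/-- A coefficient that vanishes for `P` vanishes for the whole module: passing from `P` to
`(∂ + λ)ⁱ P` differentiates the coefficients of `P(λ) e^{ξ(t;λ)}`. -/
theorem expVec_eq_zero_of_mem {p : TimeRat[X]} (hp : p ∈ flatModule P) {d : ℕ}
    (hd : expVec P d = 0) : expVec p d = 0 := by
  obtain ⟨m, g, rfl⟩ := mem_gSpan_iff.1 hp
  rw [map_sum, Finset.sum_apply]
  refine Finset.sum_eq_zero fun i _ => ?_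
  rw [map_smul, Pi.smul_apply, expVec_iterate_polyD, hd, iterate_map_zero, smul_zero]

theorem map_X_pow_mul_mem {V : Type*} [AddCommGroup V] [Module TimeRat V] {N : Submodule TimeRat V}
    {f : TimeRat[X] →ₗ[TimeRat] V} {D : ℕ} (h : ∀ k, D ≤ k → f (X ^ k) ∈ N) (q : TimeRat[X]) :
    f (X ^ D * q) ∈ N := by
  induction q using Polynomial.induction_on' with
  | add p q hp hq => rw [mul_add, map_add]; exact N.add_mem hp hq
  | monomial n b =>
    have : X ^ D * monomial n b = b • (X ^ (D + n) : TimeRat[X]) := by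
      rw [← C_mul_X_pow_eq_monomial, Polynomial.smul_eq_C_mul]
      ring
    rw [this, map_smul]
    exact N.smul_mem _ (h _ (by omega))

/-- If the linear relations with constant coefficients between the coefficients of
`P(λ) e^{ξ(t;λ)}` are the trivial ones, the flat module of `P` is cut out by the vanishing of those
coefficients of `p(λ) e^{ξ(t;λ)}` whose counterparts vanish for `P`. -/
theorem mem_flatModule_iff (hflat : ∀ k : ℕ+, polyD (ratD k) k P ∈ flatModule P) {D : ℕ}
    (hD : ∀ k, D ≤ k → X ^ k ∈ flatModule P)
    (hgr : ∀ u : Fin D → ℂ, ∑ d, algebraMap ℂ TimeRat (u d) * expVec P d = 0 →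
      ∀ d, u d = 0 ∨ expVec P d = 0) {p : TimeRat[X]} :
    p ∈ flatModule P ↔ ∀ d < D, expVec P d = 0 → expVec p d = 0 := by
  classical
  refine ⟨fun hp d _ hd => expVec_eq_zero_of_mem hp hd, fun hp => ?_⟩
  let T : TimeRat[X] →ₗ[TimeRat] (Fin D → TimeRat) :=
    LinearMap.funLeft TimeRat TimeRat (fun d : Fin D => (d : ℕ)) ∘ₗ expVec
  have hT : ∀ p d, T p d = expVec p d := fun _ _ => rfl
  set N := (flatModule P).map T
  have hN : ∀ (k : ℕ+), ∀ x ∈ N, (fun i => ratD k (x i)) ∈ N := by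
    rintro k _ ⟨p, hp, rfl⟩
    exact ⟨_, polyD_mem_flatModule hflat k hp, funext fun d => expVec_polyD k p d⟩
  -- otherwise a constant linear form would vanish on the image of `P` but not on this basis vector
  have hsingle : ∀ d : Fin D, expVec P d ≠ 0 → (Pi.single d 1 : Fin D → TimeRat) ∈ N := by
    intro d hd
    by_contra hnot
    have e : (Pi.single d 1 : Fin D → TimeRat) =
        fun i => algebraMap ℂ TimeRat ((Pi.single d 1 : Fin D → ℂ) i) := by
      funext i
      rw [Pi.single_apply, Pi.single_apply]
      split_ifs <;> simp
    rw [e] at hnot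
    obtain ⟨u, h1, h2⟩ := exists_const_form hN hnot
    rcases hgr u (h1 (T P) ⟨P, self_mem_gSpan, rfl⟩) d with h | h
    · refine h2 ?_
      rw [Finset.sum_eq_zero]
      intro i _
      rw [Pi.single_apply]
      split_ifs with hi
      · rw [hi, h, zero_mul]
      · rw [mul_zero]
    · exact hd h
  have hx : T p ∈ N := by
    rw [pi_eq_sum_univ' (T p)]
    refine N.sum_mem fun d _ => ?_
    by_cases hd : expVec P d = 0
    · rw [hT, hp d d.2 hd, zero_smul]
      exact N.zero_mem
    · exact N.smul_mem _ (hsingle d hd)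
  obtain ⟨m, hm, hmp⟩ := hx
  have h0 : X ^ D ∣ p - m := dvd_of_expVec_eq_zero fun d hd => by
    rw [map_sub, Pi.sub_apply, sub_eq_zero]
    exact (congrFun hmp ⟨d, hd⟩).symm
  obtain ⟨q, hq⟩ := h0
  have h3 : X ^ D * q ∈ flatModule P := map_X_pow_mul_mem (f := LinearMap.id) hD q
  rw [← hq] at h3
  simpa using Submodule.add_mem _ h3 hm

/-- Nonzero elements of the module have degree at least `deg P`. -/
theorem eq_zero_of_mem_flatModule (hP : P.Monic) {p : TimeRat[X]} (hp : p ∈ flatModule P)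
    (h : ∀ j, P.natDegree ≤ j → p.coeff j = 0) : p = 0 := by
  obtain ⟨m, g, rfl⟩ := mem_gSpan_iff.1 hp
  have := eq_zero_of_sum_iterate_polyD hP.ne_zero h
  exact Finset.sum_eq_zero fun i hi => by rw [this i (Finset.mem_range.1 hi), zero_smul]

/-- The number of vanishing coefficients of `P(λ) e^{ξ(t;λ)}` is the degree of `P`. -/
theorem card_expVec_eq_zero (hP : P.Monic) (hflat : ∀ k : ℕ+, polyD (ratD k) k P ∈ flatModule P)
    {D : ℕ} (hD : ∀ k, D ≤ k → X ^ k ∈ flatModule P)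
    (hgr : ∀ u : Fin D → ℂ, ∑ d, algebraMap ℂ TimeRat (u d) * expVec P d = 0 →
      ∀ d, u d = 0 ∨ expVec P d = 0) :
    Nat.card {d : ℕ // d < D ∧ expVec P d = 0} = P.natDegree := by
  classical
  let Z := {d : ℕ // d < D ∧ expVec P d = 0}
  have : Finite Z := Set.Finite.subset (Set.finite_Iio D) fun d hd => hd.1
  have := Fintype.ofFinite Z
  -- the polynomials of degree less than `deg P` represent the quotient by the flat module, which is
  -- mapped isomorphically onto the coordinates in `Z`
  let T : degreeLT TimeRat P.natDegree →ₗ[TimeRat] (Z → TimeRat) :=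
    LinearMap.funLeft TimeRat TimeRat (fun d : Z => (d : ℕ)) ∘ₗ expVec ∘ₗ Submodule.subtype _
  have hT : ∀ p d, T p d = expVec p.1 d := fun _ _ => rfl
  have hbij : Function.Bijective T := by
    constructor
    · rw [injective_iff_map_eq_zero]
      rintro ⟨p, hp⟩ h
      have h1 : p ∈ flatModule P := (mem_flatModule_iff hflat hD hgr).2 fun d h2 h3 =>
        congrFun h (⟨d, h2, h3⟩ : Z)
      rw [mem_degreeLT, degree_lt_iff_coeff_zero] at hp
      exact Subtype.ext (eq_zero_of_mem_flatModule hP h1 hp)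
    · intro x
      obtain ⟨q, hq⟩ := exists_expVec_eq D fun d =>
        if h : d < D ∧ expVec P d = 0 then x ⟨d, h⟩ else 0
      obtain ⟨m, hm, hqm⟩ := exists_sub_mem_gSpan (δ := ratD 1) hP q
      refine ⟨⟨q - m, by rwa [mem_degreeLT, degree_lt_iff_coeff_zero]⟩, funext fun d => ?_⟩
      rw [hT, map_sub, Pi.sub_apply, expVec_eq_zero_of_mem hm d.2.2, sub_zero, hq d d.2.1,
        dif_pos d.2]
  have h1 := ((degreeLTEquiv TimeRat P.natDegree).symm.trans
    (LinearEquiv.ofBijective T hbij)).finrank_eq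
  rw [Module.finrank_fintype_fun_eq_card, Module.finrank_fintype_fun_eq_card, Fintype.card_fin,
    ← Nat.card_eq_fintype_card] at h1
  exact h1.symm

theorem isConnection_ratD (k : ℕ+) : IsConnection (ratD k) (ratD k) where
  map_add := map_add _
  map_smul a x := by
    rw [smul_eq_mul, ratD_mul, smul_eq_mul, smul_eq_mul]
    ring

theorem IsConnection.prodMap {F V V' : Type*} [Field F] [AddCommGroup V] [Module F V]
    [AddCommGroup V'] [Module F V'] {δ : F → F} {D : V → V} {E : V' → V'} (hD : IsConnection δ D)
    (hE : IsConnection δ E) : IsConnection δ (Prod.map D E) where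
  map_add _ _ := Prod.ext (hD.map_add _ _) (hE.map_add _ _)
  map_smul _ _ := Prod.ext (hD.map_smul _ _) (hE.map_smul _ _)

theorem iterate_prodMap {V V' : Type*} (D : V → V) (E : V' → V') (i : ℕ) (x : V × V') :
    (Prod.map D E)^[i] x = (D^[i] x.1, E^[i] x.2) := by
  rw [Prod.map_iterate, Prod.map_apply']

/-- If `η` satisfies the linear differential equations satisfied by the coefficients of
`P(λ) e^{ξ(t;λ)}`, it is a combination of them with constant coefficients. -/
theorem exists_eq_sum_expVec (hP : P.Monic) (hX : ∃ k₀ : ℕ, ∀ k, k₀ ≤ k → X ^ k ∈ flatModule P)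
    {η : TimeRat} (hη : ∀ k : ℕ+, (polyD (ratD k) k P, ratD k η) ∈
      gSpan TimeRat (Prod.map (polyD (ratD 1) 1) (ratD 1)) (P, η)) :
    ∃ (D : ℕ) (u : Fin D → ℂ), η = ∑ d, algebraMap ℂ TimeRat (u d) * expVec P d := by
  classical
  set E : ℕ+ → TimeRat[X] × TimeRat → TimeRat[X] × TimeRat :=
    fun k => Prod.map (polyD (ratD k) k) (ratD k) with hE
  have hconn : ∀ k, IsConnection (ratD k) (E k) := fun k =>
    (isConnection_polyD_ratD k).prodMap (isConnection_ratD k)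
  set Γ := gSpan TimeRat (E 1) (P, η) with hΓ
  have hstab : ∀ (k : ℕ+), ∀ z ∈ Γ, E k z ∈ Γ := fun k z hz =>
    (hconn 1).map_mem_gSpan_of_comm (hconn k)
      (fun z => Prod.ext (polyD_comm (ratD_comm k 1) k 1 z.1) (ratD_comm k 1 z.2)) (hη k) hz
  have hit : ∀ i, (E 1)^[i] (P, η) = ((polyD (ratD 1) 1)^[i] P, (ratD 1)^[i] η) := fun i =>
    iterate_prodMap _ _ i _
  -- high powers of `λ`
  obtain ⟨k₁, hk₁⟩ : ∃ k₁ : ℕ, ∀ k, k₁ ≤ k → ∀ p ∈ flatModule P,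
      (X ^ k * p, (0 : TimeRat)) ∈ Γ := by
    obtain ⟨N, hN⟩ := exists_coefD_eq_zero P
    obtain ⟨M, hM⟩ := exists_ratD_eq_zero η
    refine ⟨N + M + 1, fun k hk p hp => ?_⟩
    obtain ⟨n, rfl⟩ : ∃ n : ℕ+, (n : ℕ) = k := ⟨⟨k, by omega⟩, rfl⟩
    obtain ⟨m, g, rfl⟩ := mem_gSpan_iff.1 hp
    have e : (X ^ (n : ℕ) * ∑ i ∈ Finset.range m, g i • (polyD (ratD 1) 1)^[i] P, (0 : TimeRat)) =
        ∑ i ∈ Finset.range m, g i • E n ((E 1)^[i] (P, η)) := by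
      refine Prod.ext ?_ ?_
      · rw [Prod.fst_sum, Finset.mul_sum]
        dsimp only
        refine Finset.sum_congr rfl fun i _ => ?_
        rw [Prod.smul_fst, hit, mul_smul_comm]
        have := coefD_iterate_polyD (hN n (by omega)) i
        rw [coefD_eq, sub_eq_zero] at this
        rw [← this]
        rfl
      · rw [Prod.snd_sum]
        refine (Finset.sum_eq_zero fun i _ => ?_).symm
        rw [Prod.smul_snd, hit]
        have : ratD n ((ratD 1)^[i] η) = 0 := by
          clear * - hM hk
          induction i with
          | zero => exact hM n (by omega)
          | succ i ih => rw [Function.iterate_succ_apply', ratD_comm, ih, map_zero]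
        change g i • ratD n ((ratD 1)^[i] η) = 0
        rw [this, smul_zero]
    rw [e]
    exact Submodule.sum_mem _ fun i _ => Γ.smul_mem _ (hstab n _ (iterate_mem_gSpan i))
  obtain ⟨k₀, hk₀⟩ := hX
  set D := k₀ + k₁
  have hXD : ∀ q, (X ^ D * q, (0 : TimeRat)) ∈ Γ := by
    refine map_X_pow_mul_mem (f := LinearMap.inl TimeRat TimeRat[X] TimeRat) fun k hk => ?_
    obtain ⟨l, rfl⟩ := Nat.exists_eq_add_of_le hk
    have := hk₁ k₁ le_rfl _ (hk₀ (k₀ + l) (by omega))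
    rw [← pow_add] at this
    rw [show k₀ + k₁ + l = k₁ + (k₀ + l) by ring]
    exact this
  -- `Γ` is the graph of a linear map on the flat module
  have hzero : ∀ y, ((0 : TimeRat[X]), y) ∈ Γ → y = 0 := by
    intro y hy
    obtain ⟨m, g, hg⟩ := mem_gSpan_iff.1 hy
    have h1 := congrArg Prod.fst hg
    have h2 := congrArg Prod.snd hg
    rw [Prod.fst_sum] at h1
    rw [Prod.snd_sum] at h2
    simp only [Prod.smul_fst, Prod.smul_snd, hit] at h1 h2
    have h3 := eq_zero_of_sum_iterate_polyD (δ := ratD 1) hP.ne_zero (m := m) (g := g) fun j _ => by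
      rw [← h1, coeff_zero]
    rw [h2]
    exact Finset.sum_eq_zero fun i hi => by rw [h3 i (Finset.mem_range.1 hi), zero_smul]
  let T : TimeRat[X] × TimeRat →ₗ[TimeRat] (Option (Fin D) → TimeRat) :=
    LinearMap.pi fun o => match o with
      | none => LinearMap.snd TimeRat TimeRat[X] TimeRat
      | some d => LinearMap.proj (d : ℕ) ∘ₗ expVec ∘ₗ LinearMap.fst TimeRat TimeRat[X] TimeRat
  have hT1 : ∀ z, T z none = z.2 := fun _ => rfl
  have hT2 : ∀ z d, T z (some d) = expVec z.1 d := fun _ _ => rfl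
  set N := Γ.map T
  have hN : ∀ (k : ℕ+), ∀ x ∈ N, (fun i => ratD k (x i)) ∈ N := by
    rintro k _ ⟨z, hz, rfl⟩
    refine ⟨_, hstab k z hz, funext fun o => ?_⟩
    cases o with
    | none => rfl
    | some d => exact expVec_polyD k z.1 d
  -- so `(0, 1)` does not lie in the image of `Γ`, and a constant linear form separates it
  have hnot : (fun i => algebraMap ℂ TimeRat ((Pi.single none 1 : Option (Fin D) → ℂ) i)) ∉ N := by
    rintro ⟨⟨p, y⟩, hz, hp⟩
    have hy : y = 1 := (congrFun hp none).trans (by simp)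
    obtain ⟨q, rfl⟩ : X ^ D ∣ p := dvd_of_expVec_eq_zero fun d hd => by
      exact (congrFun hp (some ⟨d, hd⟩)).trans (by simp)
    have := Γ.sub_mem hz (hXD q)
    rw [Prod.mk_sub_mk, sub_self, sub_zero] at this
    exact one_ne_zero (hy ▸ hzero y this)
  obtain ⟨u, h1, h2⟩ := exists_const_form hN hnot
  have hu : u none ≠ 0 := by simpa [Fintype.sum_option] using h2
  have h3 := h1 _ ⟨(P, η), self_mem_gSpan, rfl⟩
  rw [Fintype.sum_option, hT1] at h3
  refine ⟨D, fun d => -(u none)⁻¹ * u (some d), ?_⟩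
  have hu' : algebraMap ℂ TimeRat (u none) ≠ 0 := by
    simpa using hu
  have h4 : η = -(algebraMap ℂ TimeRat (u none))⁻¹ *
      ∑ d, algebraMap ℂ TimeRat (u (some d)) * expVec P d := by
    have h5 : algebraMap ℂ TimeRat (u none) * η =
      -∑ d, algebraMap ℂ TimeRat (u (some d)) * expVec P d := by
      rw [eq_neg_iff_add_eq_zero]; exact h3
    rw [neg_mul, ← mul_neg, ← h5, inv_mul_cancel_left₀ hu']
  rw [h4, Finset.mul_sum]
  refine Finset.sum_congr rfl fun d _ => ?_
  simp only [map_mul, map_neg, map_inv₀]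
  ring

/-! ### Leading parts of symbols -/

/-- An element of order at least `d` whose component of weight `d` vanishes has order at least
`d + 1`. -/
theorem HasLead.raise {d : ℤ} {x : TimeField} (h : HasLead d x 0) : ∃ ℓ, HasLead (d + 1) x ℓ := by
  obtain ⟨a, b, i, j, h1, h2, h3, h4, h5, h6⟩ := h
  rw [zero_mul] at h6
  have h7 : comp i a = 0 := IsFractionRing.injective TimePoly TimeRat (by rw [← h6, map_zero])
  have h8 := algebraMap_timePoly_ne_zero h4
  exact ⟨algebraMap TimePoly TimeRat (comp (i + 1) a) / algebraMap TimePoly TimeRat (comp j b),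
    a, b, i + 1, j, by push_cast; omega, mem_ordIdeal_succ h2 h7, h3, h4, h5, div_mul_cancel₀ _ h8⟩

theorem HasLead.neg_one : HasLead 0 (-1) (-1) := by
  have h : comp 0 (1 : TimeSeries) ≠ 0 := fun h => by
    have := congrArg (MvPolynomial.coeff 0) h
    rw [coeff_comp, if_pos (by simp [wt]), MvPowerSeries.coeff_zero_one] at this
    simp at this
  refine ⟨-1, 1, 0, 0, by simp, mem_ordIdeal_zero _, mem_ordIdeal_zero _, h, by simp, ?_⟩
  rw [comp_neg, map_neg, neg_one_mul]

/-- Every element has a (possibly vanishing) component in each sufficiently low weight. -/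
theorem exists_hasLead_le (x : TimeField) : ∃ d₀ : ℤ, ∀ d ≤ d₀, ∃ ℓ, HasLead d x ℓ := by
  by_cases hx : x = 0
  · exact ⟨0, fun d _ => ⟨0, hx ▸ HasLead.zero d⟩⟩
  · obtain ⟨d₀, ℓ, -, h⟩ := exists_hasLead hx
    refine ⟨d₀, fun d hd => ?_⟩
    rcases eq_or_lt_of_le hd with rfl | hd
    · exact ⟨ℓ, h⟩
    · exact ⟨0, h.lower hd⟩

/-- The coefficient `A (m - e)` of the symbol `A` has order at least `p + m`, and its component of
order `p + m` is the coefficient of `λᵐ` in the polynomial `Q`. -/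
structure SymLead (e p : ℤ) (A : ℤ → TimeField) (Q : TimeRat[X]) : Prop where
  coeff : ∀ m : ℕ, HasLead (p + m) (A (m - e)) (Q.coeff m)
  neg : ∀ m : ℤ, m < 0 → HasLead (p + m) (A (m - e)) 0

namespace SymLead

variable {e p q : ℤ} {A B : ℤ → TimeField} {P Q : TimeRat[X]}

theorem unique (h : SymLead e p A P) (h' : SymLead e p A Q) : P = Q := by
  ext m
  exact (h.coeff m).unique (h'.coeff m)

theorem lower (h : SymLead e p A P) (hq : q < p) : SymLead e q A 0 :=
  ⟨fun m => by rw [coeff_zero]; exact (h.coeff m).lower (by omega),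
    fun m hm => (h.neg m hm).lower (by omega)⟩

theorem covD (h : SymLead e p A P) (k : ℕ+) :
    SymLead e (p - k) (MKP.covD (dt k) (k : ℕ) A) (polyD (ratD k) k P) := by
  have hk := k.pos
  constructor
  · intro m
    rw [coeff_polyD]
    refine HasLead.add ?_ ?_
    · have := (h.coeff m).dt k
      rwa [show p + m - (k : ℕ) = p - (k : ℕ) + m by ring] at this
    · rw [sub_right_comm]
      split_ifs with hkm
      · have := h.coeff (m - k)
        rwa [Nat.cast_sub hkm, show p + ((m : ℤ) - (k : ℕ)) = p - (k : ℕ) + m by ring] at this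
      · have := h.neg (m - (k : ℕ)) (by omega)
        rwa [show p + ((m : ℤ) - (k : ℕ)) = p - (k : ℕ) + m by ring] at this
  · intro m hm
    rw [← add_zero (0 : TimeRat)]
    refine HasLead.add ?_ ?_
    · have := (h.neg m hm).dt k
      rwa [show p + m - (k : ℕ) = p - (k : ℕ) + m by ring, map_zero] at this
    · rw [sub_right_comm]
      have := h.neg (m - (k : ℕ)) (by omega)
      rwa [show p + (m - (k : ℕ)) = p - (k : ℕ) + m by ring] at this

theorem iterate_covD (h : SymLead e p A P) (i : ℕ) :
    SymLead e (p - i) ((MKP.covD (dt 1) 1)^[i] A) ((polyD (ratD 1) 1)^[i] P) := by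
  induction i with
  | zero => simpa using h
  | succ i ih =>
    rw [Function.iterate_succ_apply', Function.iterate_succ_apply']
    have := ih.covD 1
    simp only [PNat.one_coe, Nat.cast_one] at this
    rwa [Nat.cast_succ, ← sub_sub]

theorem smul (h : SymLead e p A P) {c : ℤ} {x : TimeField} {ℓ : TimeRat} (hx : HasLead c x ℓ) :
    SymLead e (c + p) (x • A) (ℓ • P) :=
  ⟨fun m => by rw [coeff_smul, add_assoc]; exact hx.mul (h.coeff m),
    fun m hm => by rw [← mul_zero ℓ, add_assoc]; exact hx.mul (h.neg m hm)⟩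

theorem sum {ι : Type*} (s : Finset ι) {A : ι → ℤ → TimeField} {P : ι → TimeRat[X]}
    (h : ∀ i ∈ s, SymLead e p (A i) (P i)) : SymLead e p (∑ i ∈ s, A i) (∑ i ∈ s, P i) := by
  constructor
  · intro m
    rw [finsetSum_coeff, Finset.sum_apply]
    exact HasLead.sum s fun i hi => (h i hi).coeff m
  · intro m hm
    rw [Finset.sum_apply, ← Finset.sum_const_zero (s := s)]
    exact HasLead.sum s fun i hi => (h i hi).neg m hm

theorem add (h : SymLead e p A P) (h' : SymLead e p B Q) : SymLead e p (A + B) (P + Q) :=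
  ⟨fun m => by rw [coeff_add]; exact (h.coeff m).add (h'.coeff m),
    fun m hm => by rw [← add_zero (0 : TimeRat)]; exact (h.neg m hm).add (h'.neg m hm)⟩

/-- Since the leading parts of the symbols `∂ⁱ A` are independent, no cancellation of leading parts
occurs in a combination of these symbols. -/
theorem exists_lead_of_sum (h : SymLead e p A P) (hP : P ≠ 0) {m : ℕ} {g : ℕ → TimeField} {s : ℤ}
    {Q : TimeRat[X]}
    (hQ : SymLead e (p - s) (∑ i ∈ Finset.range m, g i • (MKP.covD (dt 1) 1)^[i] A) Q) :
    ∃ γ : ℕ → TimeRat, (∀ i < m, HasLead (i - s) (g i) (γ i)) ∧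
      Q = ∑ i ∈ Finset.range m, γ i • (polyD (ratD 1) 1)^[i] P := by
  have hsum : ∀ (q : ℤ) (γ : ℕ → TimeRat), (∀ i < m, HasLead (i - q) (g i) (γ i)) →
      SymLead e (p - q) (∑ i ∈ Finset.range m, g i • (MKP.covD (dt 1) 1)^[i] A)
        (∑ i ∈ Finset.range m, γ i • (polyD (ratD 1) 1)^[i] P) := by
    intro q γ hγ
    refine SymLead.sum _ fun i hi => ?_
    have := (h.iterate_covD i).smul (hγ i (Finset.mem_range.1 hi))
    rwa [show (i : ℤ) - q + (p - i) = p - q by ring] at this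
  -- as long as the orders of the `g i` are too low, their leading parts cancel in the sum, so they
  -- vanish and the orders can be raised
  have hex : ∀ j : ℕ, (∃ γ : ℕ → TimeRat, ∀ i < m, HasLead (i - (s + j)) (g i) (γ i)) →
      ∃ γ : ℕ → TimeRat, ∀ i < m, HasLead (i - s) (g i) (γ i) := by
    intro j
    induction j with
    | zero => simp
    | succ j ih =>
      rintro ⟨γ, hγ⟩
      refine ih ?_
      have h1 := (hsum _ γ hγ).unique (hQ.lower (by push_cast; omega))
      have h2 := eq_zero_of_sum_iterate_polyD (δ := ratD 1) hP (g := γ) (m := m) fun j _ => by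
        rw [h1, coeff_zero]
      have h3 : ∀ i, ∃ ℓ, i < m → HasLead (i - (s + j)) (g i) ℓ := by
        intro i
        by_cases hi : i < m
        · have h4 := hγ i hi
          rw [h2 i hi] at h4
          obtain ⟨ℓ, hℓ⟩ := h4.raise
          refine ⟨ℓ, fun _ => ?_⟩
          rwa [show (i : ℤ) - (s + (j + 1 : ℕ)) + 1 = i - (s + j) by push_cast; ring] at hℓ
        · exact ⟨0, fun h => absurd h hi⟩
      choose γ' hγ' using h3
      exact ⟨γ', hγ'⟩
  choose d₀ hd₀ using fun i => exists_hasLead_le (g i)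
  obtain ⟨j, hj⟩ : ∃ j : ℕ, ∀ i < m, (i : ℤ) - (s + j) ≤ d₀ i := by
    refine ⟨(Finset.range m).sup fun i => (i - s - d₀ i).toNat, fun i hi => ?_⟩
    have := Finset.le_sup (f := fun i : ℕ => ((i : ℤ) - s - d₀ i).toNat) (Finset.mem_range.2 hi)
    omega
  choose γ₀ hγ₀ using fun i => (hd₀ i)
  obtain ⟨γ, hγ⟩ := hex j ⟨fun i => if hi : i < m then γ₀ i _ (hj i hi) else 0, fun i hi => by
    simp only [dif_pos hi]
    exact hγ₀ i _ _⟩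
  exact ⟨γ, hγ, hQ.unique (hsum s γ hγ)⟩

end SymLead

/-! ### The leading polynomial of a wave operator -/

/-- `∂ⁱ W` is monic of order `i`. -/
theorem coeff_iterate_covD {W : ℤ → TimeField} (hW : W 0 = 1) (hW' : OrdLE 0 W)
    (i : ℕ) : OrdLE i ((covD (dt 1) 1)^[i] W) ∧ (covD (dt 1) 1)^[i] W i = 1 := by
  induction i with
  | zero => exact ⟨by simpa using hW', by simpa using hW⟩
  | succ i ih =>
    rw [Function.iterate_succ_apply']
    refine ⟨fun j hj => ?_, ?_⟩
    · push_cast at hj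
      rw [covD, ih.1 j (by omega), ih.1 _ (by omega), dt_zero, add_zero]
    · rw [covD, ih.1 _ (by push_cast; omega), dt_zero, zero_add,
        show ((i + 1 : ℕ) : ℤ) - 1 = i by push_cast; ring]
      exact ih.2

/-- A combination of the symbols `∂ⁱ W` of order less than `k` involves only those with `i < k`. -/
theorem eq_zero_of_ordLE_sum {W : ℤ → TimeField} (hW : W 0 = 1) (hW' : OrdLE 0 W) {m k : ℕ}
    {g : ℕ → TimeField}
    (h : ∀ j : ℕ, k ≤ j → (∑ i ∈ Finset.range m, g i • (covD (dt 1) 1)^[i] W) j = 0) :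
    ∀ i < m, k ≤ i → g i = 0 := by
  induction m with
  | zero => intro i hi; omega
  | succ m ih =>
    intro i hi hki
    have hm : k ≤ m → g m = 0 := by
      intro hkm
      have h2 := h m hkm
      rw [Finset.sum_range_succ, Pi.add_apply, Pi.smul_apply,
        (coeff_iterate_covD hW hW' m).2, Finset.sum_apply, Finset.sum_eq_zero,
        zero_add] at h2
      · simpa using h2
      · intro i hi
        rw [Pi.smul_apply, (coeff_iterate_covD hW hW' i).1 _
          (by have := Finset.mem_range.1 hi; omega), smul_zero]
    rcases Nat.lt_succ_iff_lt_or_eq.1 hi with h3 | rfl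
    · refine ih (fun j hj => ?_) i h3 hki
      have := h j hj
      rwa [Finset.sum_range_succ, hm (by omega), zero_smul, add_zero] at this
    · exact hm hki

section Wave

variable {W : ℤ → TimeField} {e p : ℤ} {P : TimeRat[X]}

/-- The leading coefficient of the leading polynomial of a solution is constant: compare the
coefficients of `λ^{deg P + k}` in the leading part of the operator
`(∂/∂tₖ + λᵏ)² W - (∂/∂t₂ₖ + λ²ᵏ) W`, which is a combination of the `∂ⁱ W` with `i < k`. -/
theorem ratD_leadingCoeff (hW : W 0 = 1) (hW' : OrdLE 0 W)
    (hflat : ∀ k : ℕ+, covD (dt k) (k : ℕ) W ∈ dSpan (dt 1) W) (h : SymLead e p W P) (hP : P ≠ 0)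
    (k : ℕ+) : ratD k P.leadingCoeff = 0 := by
  have hk := k.pos
  have h2k : (((2 * k : ℕ+) : ℕ) : ℤ) = 2 * (k : ℕ) := by push_cast; rfl
  have h2k' : ((2 * k : ℕ+) : ℕ) = 2 * (k : ℕ) := rfl
  set X' := covD (dt k) (k : ℕ) (covD (dt k) (k : ℕ) W) + (-1 : TimeField) •
    covD (dt (2 * k)) (2 * k : ℕ+) W with hX
  have hmem : X' ∈ dSpan (dt 1) W := by
    refine Submodule.add_mem _ ?_ (Submodule.smul_mem _ _ (hflat (2 * k)))
    exact (isConnection_covD (dt_add 1) (dt_mul 1) 1).map_mem_gSpan_of_comm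
      (isConnection_covD (dt_add k) (dt_mul k) _)
      (fun x => covD_comm (dt_add k) (dt_add 1) (fun a => dt_comm k 1 a) _ _ x) (hflat k) (hflat k)
  -- the terms `W ∂²ᵏ` cancel, and the derivatives of `W` have negative order
  have hord : ∀ j : ℕ, (k : ℕ) ≤ j → X' j = 0 := by
    intro j hj
    have e1 : dt k (W (j - (k : ℕ))) = 0 := by
      rcases eq_or_lt_of_le hj with rfl | hj
      · rw [sub_self, hW, dt_one]
      · rw [hW' _ (by omega), dt_zero]
    have e2 : W j = 0 := hW' _ (by omega)
    simp only [hX, Pi.add_apply, Pi.smul_apply, covD, e2, dt_zero, zero_add, h2k, smul_eq_mul, e1]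
    rw [show (j : ℤ) - (k : ℕ) - (k : ℕ) = j - 2 * (k : ℕ) by ring]
    ring
  obtain ⟨m, g, hg⟩ := mem_gSpan_iff.1 hmem
  have hg0 := eq_zero_of_ordLE_sum hW hW' (m := m) (k := k) (g := g) fun j hj => by
    rw [← hg]; exact hord j hj
  have hlead : SymLead e (p - (2 * (k : ℕ) : ℤ)) X'
      (polyD (ratD k) k (polyD (ratD k) k P) + (-1 : TimeRat) •
        polyD (ratD (2 * k)) (2 * k : ℕ+) P) := by
    refine SymLead.add ?_ ?_
    · have := (h.covD k).covD k
      rwa [show p - (k : ℕ) - (k : ℕ) = p - 2 * (k : ℕ) by ring] at this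
    · have := (h.covD (2 * k)).smul HasLead.neg_one
      rwa [zero_add, h2k] at this
  rw [hg] at hlead
  obtain ⟨γ, hγ, hQ⟩ := h.exists_lead_of_sum hP hlead
  have h5 := congrArg (fun Q : TimeRat[X] => Q.coeff (P.natDegree + k)) hQ
  simp only [finsetSum_coeff] at h5
  rw [Finset.sum_eq_zero] at h5
  · have h6 : P.coeff (P.natDegree + k) = 0 := coeff_eq_zero_of_natDegree_lt (by omega)
    simp only [coeff_add, coeff_smul, coeff_polyD, h6, map_zero, zero_add, h2k', smul_eq_mul,
      Nat.add_sub_cancel, if_pos (Nat.le_add_left (k : ℕ) P.natDegree), coeff_natDegree] at h5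
    have h7 : P.natDegree + (k : ℕ) - 2 * (k : ℕ) = P.natDegree - k := by omega
    rw [h7] at h5
    have h8 : (2 * (k : ℕ) ≤ P.natDegree + k) ↔ (k : ℕ) ≤ P.natDegree := by omega
    simp only [h8] at h5
    have h9 : (2 : TimeRat) * ratD k P.leadingCoeff = 0 := by
      rw [← h5]; ring
    exact (mul_eq_zero.1 h9).resolve_left two_ne_zero
  · intro i hi
    have hi' := Finset.mem_range.1 hi
    rw [coeff_smul]
    rcases lt_or_ge i (k : ℕ) with h6 | h6
    · rw [(coeff_iterate_polyD (ratD 1) P i).1 _ (by omega), smul_zero]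
    · have := hγ i hi'
      rw [hg0 i hi' h6] at this
      rw [this.unique (HasLead.zero _), zero_smul]

/-- The leading polynomial of a solution of the hierarchy satisfies the hierarchy. -/
theorem polyD_mem_of_symLead (hflat : ∀ k : ℕ+, covD (dt k) (k : ℕ) W ∈ dSpan (dt 1) W)
    (h : SymLead e p W P) (hP : P ≠ 0) (k : ℕ+) : polyD (ratD k) k P ∈ flatModule P := by
  obtain ⟨m, g, hg⟩ := mem_gSpan_iff.1 (hflat k)
  have h1 := h.covD k
  rw [hg] at h1
  obtain ⟨γ, -, hγ⟩ := h.exists_lead_of_sum hP h1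
  exact mem_gSpan_iff.2 ⟨m, γ, hγ⟩

theorem HasLead.iterate_dt {d : ℤ} {y : TimeField} {η : TimeRat} (hy : HasLead d y η) (i : ℕ) :
    HasLead (d - i) ((MKP.dt 1)^[i] y) ((ratD 1)^[i] η) := by
  induction i with
  | zero => simpa using hy
  | succ i ih =>
    rw [Function.iterate_succ_apply', Function.iterate_succ_apply']
    have := ih.dt 1
    rwa [PNat.one_coe, Nat.cast_one, sub_sub, ← Nat.cast_succ] at this

/-- If `y` satisfies the differential equations of the wave operator, the leading part of `y`
satisfies those of the leading polynomial. -/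
theorem polyD_mem_of_symLead_prod (h : SymLead e p W P) (hP : P ≠ 0) {y : TimeField}
    (hy : ∀ k : ℕ+, (covD (dt k) (k : ℕ) W, dt k y) ∈
      gSpan TimeField (Prod.map (covD (dt 1) 1) (dt 1)) (W, y)) {d : ℤ} {η : TimeRat}
    (hη : HasLead d y η) (k : ℕ+) : (polyD (ratD k) k P, ratD k η) ∈
      gSpan TimeRat (Prod.map (polyD (ratD 1) 1) (ratD 1)) (P, η) := by
  obtain ⟨m, g, hg⟩ := mem_gSpan_iff.1 (hy k)
  simp only [iterate_prodMap] at hg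
  have hg1 := congrArg Prod.fst hg
  have hg2 := congrArg Prod.snd hg
  rw [Prod.fst_sum] at hg1
  rw [Prod.snd_sum] at hg2
  simp only [Prod.smul_fst, Prod.smul_snd] at hg1 hg2
  have h1 := h.covD k
  rw [hg1] at h1
  obtain ⟨γ, hγ1, hγ⟩ := h.exists_lead_of_sum hP h1
  refine mem_gSpan_iff.2 ⟨m, γ, ?_⟩
  simp only [iterate_prodMap]
  refine Prod.ext ?_ ?_
  · rw [Prod.fst_sum]
    exact hγ
  · rw [Prod.snd_sum]
    have h2 := hη.dt k
    rw [hg2] at h2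
    refine h2.unique (HasLead.sum _ fun i hi => ?_)
    have := (hγ1 i (Finset.mem_range.1 hi)).mul (hη.iterate_dt i)
    rwa [show (i : ℤ) - (k : ℕ) + (d - i) = d - (k : ℕ) by ring] at this

end Wave

/-! ### Homogeneity of the leading polynomial -/

/-- `p` is a combination of monomials of weight `d`. -/
def IsHom (d : ℕ) (p : TimePoly) : Prop := ∀ β, MvPolynomial.coeff β p ≠ 0 → wt β = d

theorem isHom_comp (d : ℕ) (f : TimeSeries) : IsHom d (comp d f) := fun β h => by
  rw [coeff_comp] at h
  by_contra h1
  exact h (if_neg h1)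

theorem IsHom.mul {d e : ℕ} {p q : TimePoly} (hp : IsHom d p) (hq : IsHom e q) :
    IsHom (d + e) (p * q) := by
  classical
  intro β h
  rw [MvPolynomial.coeff_mul] at h
  obtain ⟨x, hx, h1⟩ := Finset.exists_ne_zero_of_sum_ne_zero h
  rw [← wt_of_mem_antidiagonal hx, hp _ (left_ne_zero_of_mul h1), hq _ (right_ne_zero_of_mul h1)]

theorem IsHom.sum {ι : Type*} {d : ℕ} (s : Finset ι) {p : ι → TimePoly}
    (h : ∀ i ∈ s, IsHom d (p i)) : IsHom d (∑ i ∈ s, p i) := by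
  intro β hβ
  rw [MvPolynomial.coeff_sum] at hβ
  obtain ⟨i, hi, h1⟩ := Finset.exists_ne_zero_of_sum_ne_zero hβ
  exact h i hi β h1

theorem IsHom.exists_wt_eq {d : ℕ} {p : TimePoly} (h : IsHom d p) (hp : p ≠ 0) :
    ∃ β, wt β = d ∧ MvPolynomial.coeff β p ≠ 0 := by
  obtain ⟨β, hβ⟩ := MvPolynomial.ne_zero_iff.1 hp
  exact ⟨β, h β hβ, hβ⟩

/-- In a sum of polynomials of distinct weights, a monomial occurs only in the summand of its
weight. -/
theorem IsHom.coeff_sum {D : ℕ} {p : ℕ → TimePoly} (h : ∀ d, IsHom d (p d)) (u : Fin D → ℂ)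
    (β : ℕ+ →₀ ℕ) : MvPolynomial.coeff β (∑ d : Fin D, MvPolynomial.C (u d) * p d) =
      if hD : wt β < D then u ⟨wt β, hD⟩ * MvPolynomial.coeff β (p (wt β)) else 0 := by
  classical
  rw [MvPolynomial.coeff_sum]
  simp only [MvPolynomial.coeff_C_mul]
  split_ifs with hD
  · rw [Finset.sum_eq_single ⟨wt β, hD⟩]
    · intro d _ hd
      by_contra h1
      exact hd (Fin.ext (h d β (right_ne_zero_of_mul h1)).symm)
    · simp
  · refine Finset.sum_eq_zero fun d _ => ?_
    by_contra h1
    have := h d β (right_ne_zero_of_mul h1)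
    have := d.2
    omega

theorem algebraMap_complex_timeRat (c : ℂ) :
    algebraMap ℂ TimeRat c = algebraMap TimePoly TimeRat (MvPolynomial.C c) := by
  rw [IsScalarTower.algebraMap_apply ℂ TimePoly TimeRat, MvPolynomial.algebraMap_eq]

theorem algebraMap_timePoly_injective : Function.Injective (algebraMap TimePoly TimeRat) :=
  IsFractionRing.injective TimePoly TimeRat

section Lead

variable {W : MicroDiffOp} {τ : TimeSeries} {a : ℕ → TimeSeries}

theorem clears_zero (hW : W.IsWaveOperator) (ha : W.Clears τ a) : a 0 = τ := by
  have := ha 0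
  rw [Nat.cast_zero, neg_zero, hW.1, mul_one] at this
  exact algebraMap_injective this

/-- If every series `τ w_j` has order at least `e - j`, the components of weight `e - j` are, up to
the factor `comp d τ`, the coefficients of a leading polynomial for `W`. -/
theorem exists_symLead (hW : W.IsWaveOperator) (ha : W.Clears τ a) {e d : ℕ}
    (he : ∀ j, a j ∈ ordIdeal (e - j)) (hd : τ ∈ ordIdeal d) (hd' : comp d τ ≠ 0) :
    ∃ P : TimeRat[X], P.natDegree ≤ e ∧ SymLead e (-d) W.coeff P ∧ ∀ m ≤ e,
      P.coeff m * algebraMap TimePoly TimeRat (comp d τ) =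
        algebraMap TimePoly TimeRat (comp m (a (e - m))) := by
  classical
  have ht := algebraMap_timePoly_ne_zero hd'
  set P : TimeRat[X] := ∑ m ∈ Finset.range (e + 1), monomial m
    (algebraMap TimePoly TimeRat (comp m (a (e - m))) / algebraMap TimePoly TimeRat (comp d τ))
  have hP : ∀ m, P.coeff m = if m ≤ e then algebraMap TimePoly TimeRat (comp m (a (e - m))) /
      algebraMap TimePoly TimeRat (comp d τ) else 0 := by
    intro m
    simp only [P, finsetSum_coeff, coeff_monomial]
    rw [Finset.sum_ite_eq']
    simp only [Finset.mem_range, Nat.lt_succ_iff]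
  have hlead : ∀ j i : ℕ, a j ∈ ordIdeal i → HasLead (i - d) (W.coeff (-(j : ℤ)))
      (algebraMap TimePoly TimeRat (comp i (a j)) / algebraMap TimePoly TimeRat (comp d τ)) :=
    fun j i h => ⟨a j, τ, i, d, rfl, h, hd, hd', by rw [ha j, mul_comm], div_mul_cancel₀ _ ht⟩
  refine ⟨P, natDegree_le_iff_coeff_eq_zero.2 fun m hm => by rw [hP, if_neg (by omega)],
    ⟨fun m => ?_, fun m hm => ?_⟩, fun m hm => by rw [hP, if_pos hm, div_mul_cancel₀ _ ht]⟩
  · rw [hP]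
    split_ifs with h
    · have h1 := hlead (e - m) m (by have := he (e - m); rwa [Nat.sub_sub_self h] at this)
      rwa [Nat.cast_sub h, neg_sub, sub_eq_neg_add (m : ℤ) d] at h1
    · rw [hW.2 _ (by omega)]
      exact HasLead.zero _
  · obtain ⟨j, hj⟩ : ∃ j : ℕ, m - e = -(j : ℤ) := ⟨(e - m).toNat, by omega⟩
    rw [hj]
    exact (hlead j 0 (mem_ordIdeal_zero _)).lower (by push_cast; omega)

/-- With `e` the least value of `i + j` for which `τ w_j` has a component of weight `i`, the leading
polynomial is nonzero. Its leading coefficient is constant, so by homogeneity `τ` has order `e` and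
the polynomial is monic of degree `e`. -/
theorem exists_monic_symLead (hW : W.IsWaveOperator) (hτ : τ ≠ 0) (ha : W.Clears τ a)
    (hflat : ∀ k : ℕ+, covD (dt k) (k : ℕ) W.coeff ∈ dSpan (dt 1) W.coeff) :
    ∃ e : ℕ, (∀ j, a j ∈ ordIdeal (e - j)) ∧ comp e τ ≠ 0 ∧ ∃ P : TimeRat[X], P.Monic ∧
      P.natDegree = e ∧ SymLead e (-e) W.coeff P ∧ ∀ m ≤ e,
        P.coeff m * algebraMap TimePoly TimeRat (comp e τ) =
          algebraMap TimePoly TimeRat (comp m (a (e - m))) := by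
  classical
  obtain ⟨d, hd, hd'⟩ := exists_order hτ
  have h0 := clears_zero hW ha
  have hex : ∃ e j, j ≤ e ∧ comp (e - j) (a j) ≠ 0 := ⟨d, 0, Nat.zero_le _, by rwa [h0]⟩
  set e := Nat.find hex
  obtain ⟨j, hj, hj'⟩ : ∃ j, j ≤ e ∧ comp (e - j) (a j) ≠ 0 := Nat.find_spec hex
  have hmin : ∀ i < e, ∀ j ≤ i, comp (i - j) (a j) = 0 := fun i hi j hj => by
    by_contra h
    exact Nat.find_min hex hi ⟨j, hj, h⟩
  have hed : e ≤ d := Nat.find_min' hex ⟨0, Nat.zero_le _, by rwa [h0]⟩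
  have hord : ∀ j, a j ∈ ordIdeal (e - j) := by
    intro j α hα
    have h1 := congrArg (MvPolynomial.coeff α) (hmin (wt α + j) (by omega) j (by omega))
    rwa [coeff_comp, if_pos (by omega), MvPolynomial.coeff_zero] at h1
  obtain ⟨P, hPe, hlead, hPc⟩ := exists_symLead hW ha hord hd hd'
  have hP0 : P ≠ 0 := by
    rintro rfl
    have := hPc (e - j) (by omega)
    rw [coeff_zero, zero_mul, Nat.sub_sub_self hj] at this
    exact algebraMap_timePoly_ne_zero hj' this.symm
  obtain ⟨c, hc⟩ := exists_const_of_ratD_eq_zero fun k =>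
    ratD_leadingCoeff hW.1 hW.2 hflat hlead hP0 k
  have hc0 : c ≠ 0 := by
    rintro rfl
    rw [map_zero, leadingCoeff_eq_zero] at hc
    exact hP0 hc
  -- a constant has weight `0`, so numerator and denominator of the leading coefficient have the
  -- same weight
  have hdeg : P.natDegree = d := by
    have h1 := hPc P.natDegree hPe
    rw [coeff_natDegree, hc, algebraMap_complex_timeRat, ← map_mul] at h1
    have h2 := algebraMap_timePoly_injective h1
    obtain ⟨β, hβ, hβ'⟩ := (isHom_comp d τ).exists_wt_eq hd'
    have h3 := congrArg (MvPolynomial.coeff β) h2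
    rw [MvPolynomial.coeff_C_mul] at h3
    rw [← hβ]
    exact (isHom_comp _ _ β (h3 ▸ mul_ne_zero hc0 hβ')).symm
  have hde : d = e := by omega
  rw [hde] at hd' hlead hPc hdeg
  refine ⟨e, hord, hd', P, ?_, hdeg, hlead, hPc⟩
  have h1 := hPc e le_rfl
  rw [Nat.sub_self, h0] at h1
  rw [Monic, leadingCoeff, hdeg]
  exact mul_right_cancel₀ (algebraMap_timePoly_ne_zero hd') (h1.trans (one_mul _).symm)

variable {e : ℕ} {P : TimeRat[X]}

/-- A constant nonzero root of the leading polynomial would, by homogeneity, kill its leading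
coefficient. -/
theorem eval_ne_zero (ht : comp e τ ≠ 0) (h0 : a 0 = τ) (hdeg : P.natDegree = e)
    (hP : ∀ m ≤ e, P.coeff m * algebraMap TimePoly TimeRat (comp e τ) =
      algebraMap TimePoly TimeRat (comp m (a (e - m)))) {μ : ℂ} (hμ : μ ≠ 0) :
    P.eval (algebraMap ℂ TimeRat μ) ≠ 0 := by
  intro h
  have h1 : algebraMap TimePoly TimeRat (∑ m : Fin (e + 1),
      MvPolynomial.C (μ ^ (m : ℕ)) * comp m (a (e - m))) = 0 := by
    rw [eval_eq_sum_range, hdeg] at h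
    have h2 := congrArg (· * algebraMap TimePoly TimeRat (comp e τ)) h
    rw [zero_mul, Finset.sum_mul, Finset.sum_range] at h2
    rw [map_sum, ← h2]
    refine Finset.sum_congr rfl fun m _ => ?_
    rw [map_mul, ← hP m (by omega), ← algebraMap_complex_timeRat, map_pow]
    ring
  have h3 := algebraMap_timePoly_injective (h1.trans (map_zero _).symm)
  obtain ⟨β, hβ, hβ'⟩ := (isHom_comp e τ).exists_wt_eq ht
  have h4 := IsHom.coeff_sum (p := fun m => comp m (a (e - m))) (fun m => isHom_comp m _)
    (fun m : Fin (e + 1) => μ ^ (m : ℕ)) β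
  rw [h3, MvPolynomial.coeff_zero, dif_pos (by omega)] at h4
  simp only [hβ, Nat.sub_self, h0] at h4
  exact mul_ne_zero (pow_ne_zero _ hμ) hβ' h4.symm

/-- The coefficient of `λᵈ` in the product of the leading polynomial and `e^{ξ(t;λ)}`, up to the
factor `comp e τ`. -/
def pairingLead (e : ℕ) (a : ℕ → TimeSeries) (d : ℕ) : TimePoly :=
  ∑ m ∈ Finset.range (d + 1), (if m ≤ e then comp m (a (e - m)) else 0) * hPoly (d - m)

theorem isHom_pairingLead (e : ℕ) (a : ℕ → TimeSeries) (d : ℕ) : IsHom d (pairingLead e a d) := by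
  refine IsHom.sum _ fun m hm => ?_
  have hm' := Finset.mem_range.1 hm
  have h : IsHom (m + (d - m)) ((if m ≤ e then comp m (a (e - m)) else 0) * hPoly (d - m)) := by
    refine IsHom.mul ?_ (isHom_comp _ _)
    split_ifs
    · exact isHom_comp _ _
    · intro β hβ
      simp at hβ
  rwa [Nat.add_sub_cancel' (by omega)] at h

/-- The coefficients of `P(λ) e^{ξ(t;λ)}` become homogeneous polynomials after multiplication by
`comp e τ`. -/
theorem expVec_mul (hdeg : P.natDegree = e)
    (hP : ∀ m ≤ e, P.coeff m * algebraMap TimePoly TimeRat (comp e τ) =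
      algebraMap TimePoly TimeRat (comp m (a (e - m)))) (d : ℕ) :
    expVec P d * algebraMap TimePoly TimeRat (comp e τ) =
      algebraMap TimePoly TimeRat (pairingLead e a d) := by
  rw [expVec_apply, PowerSeries.coeff_mul, Finset.Nat.sum_antidiagonal_eq_sum_range_succ_mk,
    Finset.sum_mul, pairingLead, map_sum]
  refine Finset.sum_congr rfl fun m _ => ?_
  rw [Polynomial.coeff_coe, map_mul, expSeries, PowerSeries.coeff_mk, mul_right_comm]
  congr 1
  split_ifs with h
  · exact hP m h
  · rw [coeff_eq_zero_of_natDegree_lt (by omega), zero_mul, map_zero]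

theorem expVec_eq_zero_iff (ht : comp e τ ≠ 0) (hdeg : P.natDegree = e)
    (hP : ∀ m ≤ e, P.coeff m * algebraMap TimePoly TimeRat (comp e τ) =
      algebraMap TimePoly TimeRat (comp m (a (e - m)))) (d : ℕ) :
    expVec P d = 0 ↔ pairingLead e a d = 0 := by
  rw [← (algebraMap_timePoly_injective).eq_iff, map_zero, ← expVec_mul hdeg hP,
    mul_eq_zero_iff_right (algebraMap_timePoly_ne_zero ht)]

theorem sum_expVec_mul (hdeg : P.natDegree = e)
    (hP : ∀ m ≤ e, P.coeff m * algebraMap TimePoly TimeRat (comp e τ) =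
      algebraMap TimePoly TimeRat (comp m (a (e - m)))) {D : ℕ} (u : Fin D → ℂ) :
    (∑ d, algebraMap ℂ TimeRat (u d) * expVec P d) * algebraMap TimePoly TimeRat (comp e τ) =
      algebraMap TimePoly TimeRat (∑ d : Fin D, MvPolynomial.C (u d) * pairingLead e a d) := by
  rw [Finset.sum_mul, map_sum]
  refine Finset.sum_congr rfl fun d _ => ?_
  rw [mul_assoc, expVec_mul hdeg hP, map_mul, algebraMap_complex_timeRat]

/-- By homogeneity, linear relations between the coefficients of `P(λ) e^{ξ(t;λ)}` are trivial. -/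
theorem eq_zero_or_of_sum_expVec (ht : comp e τ ≠ 0) (hdeg : P.natDegree = e)
    (hP : ∀ m ≤ e, P.coeff m * algebraMap TimePoly TimeRat (comp e τ) =
      algebraMap TimePoly TimeRat (comp m (a (e - m)))) {D : ℕ} (u : Fin D → ℂ)
    (h : ∑ d, algebraMap ℂ TimeRat (u d) * expVec P d = 0) (d : Fin D) :
    u d = 0 ∨ expVec P d = 0 := by
  rw [expVec_eq_zero_iff ht hdeg hP]
  by_contra! hne
  have h1 := sum_expVec_mul hdeg hP u
  rw [h, zero_mul] at h1
  have h2 := algebraMap_timePoly_injective (h1.symm.trans (map_zero _).symm)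
  obtain ⟨β, hβ, hβ'⟩ := (isHom_pairingLead e a d).exists_wt_eq hne.2
  have h3 := IsHom.coeff_sum (isHom_pairingLead e a) u β
  rw [h2, MvPolynomial.coeff_zero, dif_pos (by rw [hβ]; exact d.2)] at h3
  simp only [hβ] at h3
  exact mul_ne_zero hne.1 hβ' h3.symm

end Lead

/-! ### The pairing of a wave operator with vectors, order by order -/

section Pairing

variable {a : ℕ → TimeSeries} {e : ℕ}

theorem extendSymbol_mem_ordIdeal (hord : ∀ j, a j ∈ ordIdeal (e - j)) (n i : ℤ) :
    extendSymbol n a i ∈ ordIdeal (i - n + e).toNat := by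
  rw [extendSymbol]
  split_ifs with h
  · exact ordIdeal_anti (by omega) (hord _)
  · exact Ideal.zero_mem _

/-- Each component of a coefficient of `e^{ξ(t;Λ)} u` involves a single coordinate of `u`. -/
theorem comp_flow {N : ℤ} {u : SatoSpace} {i : ℤ} {d : ℕ} (h : i + d = N) :
    comp d (flow u i) = MvPolynomial.C (u.coeff N) * hPoly d := by
  ext α
  rw [coeff_comp, coeff_flow, MvPolynomial.coeff_C_mul, coeff_hPoly]
  split_ifs with h1
  · rw [h1, h, mul_comm]
  · rw [mul_zero]

/-- If `ν = n - e + d` is the lowest index in the support of `u`, the pairing with `u` has order at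
least `d`, and its component of weight `d` is `u_ν` times the `d`-th coefficient of
`P(λ) e^{ξ(t;λ)}`, up to the factor `comp e τ`. -/
theorem pairing_extendSymbol_mem (hord : ∀ j, a j ∈ ordIdeal (e - j)) {n : ℤ} {d : ℕ}
    {u : SatoSpace} (hu : SuppGE (n - e + d) u) :
    pairing (extendSymbol n a) u ∈ ordIdeal d ∧ comp d (pairing (extendSymbol n a) u) =
      MvPolynomial.C (u.coeff (n - e + d)) * pairingLead e a d := by
  set hi := max n (n - e + d) with hhi
  set b := extendSymbol n a with hb
  have hpair := pairing_sub_sum_mem (ordLE_extendSymbol n a) hu (le_max_left n (n - e + d))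
    (lo := n - e) (d := d + 1) (by push_cast; omega)
  rw [← hhi, ← hb] at hpair
  have hterm : ∀ i ∈ Finset.Icc (n - e) hi, b i * flow u i ∈ ordIdeal d ∧
      (n - e + d < i → b i * flow u i ∈ ordIdeal (d + 1)) := by
    intro i hi
    rw [Finset.mem_Icc] at hi
    have hf : flow u i ∈ ordIdeal (n - e + d - i).toNat := by
      rcases le_total i (n - e + d) with h | h
      · exact flow_mem_ordIdeal hu (by omega)
      · rw [Int.toNat_of_nonpos (by omega)]
        exact mem_ordIdeal_zero _
    have h1 := mul_mem_ordIdeal (extendSymbol_mem_ordIdeal hord n i) hf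
    exact ⟨ordIdeal_anti (by omega) h1, fun h => ordIdeal_anti (by omega) h1⟩
  have hmem : ∑ i ∈ Finset.Icc (n - e) hi, b i * flow u i ∈ ordIdeal d :=
    Ideal.sum_mem _ fun i hi => (hterm i hi).1
  refine ⟨by simpa using Ideal.add_mem _ (ordIdeal_anti (Nat.le_succ d) hpair) hmem, ?_⟩
  have h2 : comp d (pairing b u) = ∑ i ∈ Finset.Icc (n - e) hi, comp d (b i * flow u i) := by
    have h := comp_eq_zero_of_mem hpair (Nat.lt_succ_self d)
    rwa [sub_eq_add_neg, comp_add, comp_neg, ← sub_eq_add_neg, sub_eq_zero, comp_sum] at h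
  rw [h2, pairingLead, Finset.mul_sum]
  symm
  refine Finset.sum_of_injOn (fun m : ℕ => n - e + m) (fun x _ y _ h => by simpa using h)
    (fun m hm => ?_) (fun i hi hm => ?_) (fun m hm => ?_)
  · have := Finset.mem_range.1 hm
    simp only [Finset.coe_Icc, Set.mem_Icc]
    omega
  · refine comp_eq_zero_of_mem ((hterm i hi).2 ?_) (Nat.lt_succ_self d)
    by_contra h
    rw [Finset.mem_Icc] at hi
    refine hm ⟨(i - (n - e)).toNat, ?_, ?_⟩
    · simp only [Finset.coe_range, Set.mem_Iio]
      omega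
    · dsimp only
      omega
  · have hm' := Finset.mem_range.1 hm
    have h3 := extendSymbol_mem_ordIdeal hord n (n - e + m)
    rw [show (n - e + m - n + e : ℤ).toNat = m by omega] at h3
    have h4 := flow_mem_ordIdeal hu (i := n - e + m) (d := d - m) (by omega)
    have h5 := comp_mul h3 h4
    rw [Nat.add_sub_cancel' (by omega), comp_flow (N := n - e + d) (by omega)] at h5
    rw [hb, h5, extendSymbol, mul_left_comm]
    congr 2
    split_ifs with h6 h7 h7
    · rw [show (n - (n - e + m) : ℤ).toNat = e - m by omega]
    · omega
    · omega
    · rw [comp_zero]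

end Pairing

/-! ### Complements of the subspace attached to a wave operator -/

/-- The symbol of `A ∂ⁿ`. -/
def shiftSym {F : Type*} (n : ℤ) (A : ℤ → F) : ℤ → F := fun i => A (i - n)

theorem covD_shiftSym {F : Type*} [Add F] (δ : F → F) (k n : ℤ) (A : ℤ → F) :
    covD δ k (shiftSym n A) = shiftSym n (covD δ k A) := by
  funext i
  simp only [covD, shiftSym, sub_right_comm i k n]

theorem iterate_covD_shiftSym {F : Type*} [Add F] (δ : F → F) (k n : ℤ) (A : ℤ → F) (i : ℕ) :
    (covD δ k)^[i] (shiftSym n A) = shiftSym n ((covD δ k)^[i] A) := by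
  induction i with
  | zero => rfl
  | succ i ih => rw [Function.iterate_succ_apply', Function.iterate_succ_apply', ih, covD_shiftSym]

theorem shiftSym_sum {F : Type*} [Field F] (n : ℤ) (m : ℕ) (g : ℕ → F) (A : ℕ → ℤ → F) :
    shiftSym n (∑ i ∈ Finset.range m, g i • A i) =
      ∑ i ∈ Finset.range m, g i • shiftSym n (A i) := by
  funext j
  simp only [shiftSym, Finset.sum_apply, Pi.smul_apply]

theorem shiftSym_shiftSym {F : Type*} (m n : ℤ) (A : ℤ → F) :
    shiftSym m (shiftSym n A) = shiftSym (m + n) A := by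
  funext i
  simp only [shiftSym, sub_sub]

theorem shiftSym_zero {F : Type*} (A : ℤ → F) : shiftSym 0 A = A := by
  funext i
  simp only [shiftSym, sub_zero]

theorem shiftSym_mem_dSpan {F : Type*} [Field F] {δ : F → F} {A B : ℤ → F} (n : ℤ)
    (h : B ∈ dSpan δ A) : shiftSym n B ∈ dSpan δ (shiftSym n A) := by
  obtain ⟨m, g, rfl⟩ := mem_gSpan_iff.1 h
  rw [shiftSym_sum]
  exact mem_gSpan_iff.2 ⟨m, g, by simp only [iterate_covD_shiftSym]⟩

theorem iterate_mem_pairRel {u : SatoSpace} {A : ℤ → TimeField} {y : TimeField}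
    (h : (A, y) ∈ PairRel u) (i : ℕ) : ((covD (dt 1) 1)^[i] A, (dt 1)^[i] y) ∈ PairRel u := by
  induction i with
  | zero => exact h
  | succ i ih =>
    rw [Function.iterate_succ_apply', Function.iterate_succ_apply']
    exact pairRel_covD ih 1

theorem sum_mem_pairRel {u : SatoSpace} {A : ℤ → TimeField} {y : TimeField}
    (h : (A, y) ∈ PairRel u) (m : ℕ) (g : ℕ → TimeField) :
    (∑ i ∈ Finset.range m, g i • (covD (dt 1) 1)^[i] A,
      ∑ i ∈ Finset.range m, g i • (dt 1)^[i] y) ∈ PairRel u := by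
  have h1 := Submodule.sum_mem (PairRel u) (t := Finset.range m)
    (f := fun i => g i • ((covD (dt 1) 1)^[i] A, (dt 1)^[i] y))
    fun i _ => Submodule.smul_mem _ _ (iterate_mem_pairRel h i)
  have e : ∑ i ∈ Finset.range m, g i • ((covD (dt 1) 1)^[i] A, (dt 1)^[i] y) =
      (∑ i ∈ Finset.range m, g i • (covD (dt 1) 1)^[i] A,
        ∑ i ∈ Finset.range m, g i • (dt 1)^[i] y) := by
    refine Prod.ext ?_ ?_
    · rw [Prod.fst_sum]; rfl
    · rw [Prod.snd_sum]; rfl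
  rwa [e] at h1

section

variable {W : MicroDiffOp} {τ : TimeSeries} {a : ℕ → TimeSeries}

theorem algebraMap_extendSymbol (hW : OrdLE 0 W.coeff) (ha : W.Clears τ a) (n i : ℤ) :
    algebraMap TimeSeries TimeField (extendSymbol n a i) =
      algebraMap TimeSeries TimeField τ * shiftSym n W.coeff i := by
  rw [extendSymbol, shiftSym]
  split_ifs with h
  · rw [ha, show (-((n - i).toNat : ℤ)) = i - n by omega]
  · rw [hW _ (by omega), mul_zero, map_zero]

theorem shiftSym_mem_pairRel (hW : OrdLE 0 W.coeff) (hτ : τ ≠ 0) (ha : W.Clears τ a) (n : ℤ)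
    (u : SatoSpace) : (shiftSym n W.coeff, algebraMap TimeSeries TimeField
      (pairing (extendSymbol n a) u) / algebraMap TimeSeries TimeField τ) ∈ PairRel u :=
  mem_pairRel.2 ⟨τ, extendSymbol n a, n, hτ, ordLE_extendSymbol n a,
    algebraMap_extendSymbol hW ha n, (mul_div_cancel₀ _ (algebraMap_ne_zero hτ)).symm⟩

/-- Membership in the subspace can be tested with any one common denominator. -/
theorem mem_subspaceOf_iff (hW : OrdLE 0 W.coeff) (hτ : τ ≠ 0) (ha : W.Clears τ a) (n : ℤ)
    {u : SatoSpace} : u ∈ subspaceOf n W ↔ pairing (extendSymbol n a) u = 0 := by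
  constructor
  · intro h
    rw [← residue_eq_pairing]
    exact h τ a ha
  · intro h σ b hb
    have h1 := shiftSym_mem_pairRel hW hτ ha n u
    rw [h, map_zero, zero_div] at h1
    have h2 := pairRel_unique h1 (ordLE_extendSymbol n b) (algebraMap_extendSymbol hW hb n)
    rw [mul_zero] at h2
    rw [residue_eq_pairing]
    exact algebraMap_injective (h2.trans (map_zero _).symm)

/-- `u` lies in the subspace of `W` if and only if `W ∂ⁿ` annihilates it. -/
theorem mem_subspaceOf_iff_pairRel (hW : OrdLE 0 W.coeff) (hm : W.IsMeromorphic) (n : ℤ)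
    {u : SatoSpace} : u ∈ subspaceOf n W ↔ (shiftSym n W.coeff, 0) ∈ PairRel u := by
  obtain ⟨τ, a, hτ, ha⟩ := hm
  rw [mem_subspaceOf_iff hW hτ ha]
  constructor
  · intro h
    have h1 := shiftSym_mem_pairRel hW hτ ha n u
    rwa [h, map_zero, zero_div] at h1
  · intro h
    have h2 := pairRel_unique h (ordLE_extendSymbol n a) (algebraMap_extendSymbol hW ha n)
    rw [mul_zero] at h2
    exact algebraMap_injective (h2.trans (map_zero _).symm)

/-- The pairings with a solution satisfy the linear differential equations of the solution. -/
theorem covD_prod_mem (hflat : ∀ k : ℕ+, covD (dt k) (k : ℕ) W.coeff ∈ dSpan (dt 1) W.coeff) {n : ℤ}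
    {u : SatoSpace} {y : TimeField} (hy : (shiftSym n W.coeff, y) ∈ PairRel u) (k : ℕ+) :
    (covD (dt k) (k : ℕ) W.coeff, dt k y) ∈
      gSpan TimeField (Prod.map (covD (dt 1) 1) (dt 1)) (W.coeff, y) := by
  obtain ⟨m, g, hg⟩ := mem_gSpan_iff.1 (hflat k)
  refine mem_gSpan_iff.2 ⟨m, g, ?_⟩
  simp only [iterate_prodMap]
  refine Prod.ext ?_ ?_
  · rw [Prod.fst_sum]
    exact hg
  · rw [Prod.snd_sum]
    have h1 := pairRel_covD hy k
    have h2 := (PairRel u).sub_mem h1 (sum_mem_pairRel hy m g)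
    simp only [iterate_covD_shiftSym] at h2
    rw [covD_shiftSym, hg, shiftSym_sum, Prod.mk_sub_mk, sub_self] at h2
    exact sub_eq_zero.1 (pairRel_zero_left h2)

end

/-- The vector `c e_ν`. -/
def SatoSpace.single (ν : ℤ) (c : ℂ) : SatoSpace :=
  ⟨fun i => if i = ν then c else 0, ν, fun i hi => if_neg (by omega)⟩

theorem SatoSpace.coeff_single (ν : ℤ) (c : ℂ) (i : ℤ) :
    (SatoSpace.single ν c).coeff i = if i = ν then c else 0 := rfl

@[ext]
theorem SatoSpace.ext {u v : SatoSpace} (h : ∀ ν, u.coeff ν = v.coeff ν) : u = v :=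
  Subtype.ext (funext h)

theorem SatoSpace.coeff_sub (u v : SatoSpace) (ν : ℤ) :
    (u - v).coeff ν = u.coeff ν - v.coeff ν := rfl

theorem SatoSpace.exists_least {u : SatoSpace} (hu : u ≠ 0) :
    ∃ ν, u.coeff ν ≠ 0 ∧ SuppGE ν u := by
  obtain ⟨N, hN⟩ := u.exists_suppGE
  obtain ⟨ν, h1, h2⟩ := Int.exists_least_of_bdd (P := fun ν => u.coeff ν ≠ 0)
    ⟨N, fun ν hν => by by_contra h; exact hν (hN ν (by omega))⟩
    (by by_contra! h; exact hu (SatoSpace.ext h))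
  exact ⟨ν, h1, fun i hi => by by_contra h; have := h2 i h; omega⟩

theorem pairing_sub_right {n : ℤ} {a : ℤ → TimeSeries} (ha : OrdLE n a) (u v : SatoSpace) :
    pairing a (u - v) = pairing a u - pairing a v := by
  rw [eq_sub_iff_add_eq, ← pairing_add_right ha, sub_add_cancel]

section Complement

variable {W : MicroDiffOp} {τ : TimeSeries} {a : ℕ → TimeSeries} {e : ℕ} {P : TimeRat[X]}

/-- The lowest component of the pairing of a solution with any vector is a multiple of the lowest
component of its pairing with a basis vector. -/
theorem exists_comp_pairing_eq (hW : W.IsWaveOperator) (hτ : τ ≠ 0) (ha : W.Clears τ a)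
    (hflat : ∀ k : ℕ+, covD (dt k) (k : ℕ) W.coeff ∈ dSpan (dt 1) W.coeff)
    (hord : ∀ j, a j ∈ ordIdeal (e - j)) (ht : comp e τ ≠ 0) (hP : P.Monic)
    (hdeg : P.natDegree = e) (hlead : SymLead e (-e) W.coeff P)
    (hPc : ∀ m ≤ e, P.coeff m * algebraMap TimePoly TimeRat (comp e τ) =
      algebraMap TimePoly TimeRat (comp m (a (e - m))))
    (hX : ∃ k₀ : ℕ, ∀ k, k₀ ≤ k → X ^ k ∈ flatModule P) (n : ℤ) (u : SatoSpace) {r : ℕ}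
    (hr : pairing (extendSymbol n a) u ∈ ordIdeal r) :
    ∃ c : ℂ, (pairingLead e a r = 0 → c = 0) ∧
      comp r (pairing (extendSymbol n a) u) = MvPolynomial.C c * pairingLead e a r := by
  have hpair := shiftSym_mem_pairRel hW.2 hτ ha n u
  set ρ := pairing (extendSymbol n a) u
  have hτe : τ ∈ ordIdeal e := by
    rw [← clears_zero hW ha]
    exact hord 0
  have ht' := algebraMap_timePoly_ne_zero ht
  have hy : HasLead ((r : ℤ) - e) (algebraMap TimeSeries TimeField ρ /
      algebraMap TimeSeries TimeField τ) (algebraMap TimePoly TimeRat (comp r ρ) /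
        algebraMap TimePoly TimeRat (comp e τ)) :=
    ⟨ρ, τ, r, e, rfl, hr, hτe, ht, div_mul_cancel₀ _ (algebraMap_ne_zero hτ), div_mul_cancel₀ _ ht'⟩
  obtain ⟨D, c, hc⟩ := exists_eq_sum_expVec hP hX fun k =>
    polyD_mem_of_symLead_prod hlead hP.ne_zero (covD_prod_mem hflat hpair) hy k
  have h1 := sum_expVec_mul hdeg hPc c
  rw [← hc, div_mul_cancel₀ _ ht'] at h1
  have h2 := algebraMap_timePoly_injective h1
  have key : comp r ρ =
      MvPolynomial.C (if hD : r < D then c ⟨r, hD⟩ else 0) * pairingLead e a r := by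
    ext β
    rw [MvPolynomial.coeff_C_mul]
    by_cases hβ : wt β = r
    · subst hβ
      rw [h2, IsHom.coeff_sum (isHom_pairingLead e a)]
      split_ifs
      · rfl
      · rw [zero_mul]
    · have h3 : MvPolynomial.coeff β (pairingLead e a r) = 0 := by
        by_contra h
        exact hβ (isHom_pairingLead e a r β h)
      rw [coeff_comp, if_neg hβ, h3, mul_zero]
  by_cases hl : pairingLead e a r = 0
  · exact ⟨0, fun _ => rfl, by rw [key, hl, mul_zero, mul_zero]⟩
  · exact ⟨_, fun h => absurd h hl, key⟩

/-- The subspace attached to a solution has a complement consisting of the vectors supported in a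
subset of `n - e + ℕ` whose complement there has `e` elements, where `e` is the order of the
denominator. -/
theorem exists_complement (hW : W.IsWaveOperator) (hm : W.IsMeromorphic)
    (hflat : ∀ k : ℕ+, covD (dt k) (k : ℕ) W.coeff ∈ dSpan (dt 1) W.coeff) (n : ℤ) :
    ∃ (e : ℕ) (Z : Set ℕ), Z.Finite ∧ Z.ncard = e ∧
      (∀ u ∈ subspaceOf n W, (∀ ν, u.coeff ν ≠ 0 → ∃ d : ℕ, d ∉ Z ∧ ν = n - e + d) → u = 0) ∧
      ∀ v, ∃ w : SatoSpace, (∀ ν, w.coeff ν ≠ 0 → ∃ d : ℕ, d ∉ Z ∧ ν = n - e + d) ∧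
        v - w ∈ subspaceOf n W := by
  obtain ⟨τ, a, hτ, ha⟩ := hm
  obtain ⟨e, hord, ht, P, hP, hdeg, hlead, hPc⟩ := exists_monic_symLead hW hτ ha hflat
  have hPflat := polyD_mem_of_symLead hflat hlead hP.ne_zero
  have hX := exists_X_pow_mem hP hPflat fun μ hμ => eval_ne_zero ht (clears_zero hW ha) hdeg hPc hμ
  obtain ⟨k₀, hk₀⟩ := hX
  have hcard := card_expVec_eq_zero hP hPflat hk₀ fun u h d =>
    eq_zero_or_of_sum_expVec ht hdeg hPc u h d
  have hZ : {d | pairingLead e a d = 0} = {d | d < k₀ ∧ expVec P d = 0} := by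
    ext d
    simp only [Set.mem_ofPred_eq, expVec_eq_zero_iff ht hdeg hPc]
    refine ⟨fun h => ⟨?_, h⟩, fun h => h.2⟩
    by_contra hd
    have h1 := expVec_eq_zero_of_mem (hk₀ d (by omega)) ((expVec_eq_zero_iff ht hdeg hPc d).2 h)
    rw [expVec_apply, Polynomial.coe_pow, Polynomial.coe_X, PowerSeries.coeff_X_pow_mul',
      if_pos le_rfl, Nat.sub_self, expSeries, PowerSeries.coeff_mk, hPoly_zero, map_one] at h1
    exact one_ne_zero h1
  refine ⟨e, {d | pairingLead e a d = 0}, ?_, ?_, fun u hu hsupp => ?_, fun v => ?_⟩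
  · rw [hZ]
    exact (Set.finite_Iio k₀).subset fun d hd => hd.1
  · rw [hZ, ← hdeg, ← hcard]
    rfl
  · by_contra hu0
    -- the lowest component of the pairing with `u` does not vanish
    obtain ⟨ν, h1, h2⟩ := SatoSpace.exists_least hu0
    obtain ⟨d, hd, rfl⟩ := hsupp ν h1
    have h3 := (pairing_extendSymbol_mem hord h2).2
    rw [(mem_subspaceOf_iff hW.2 hτ ha n).1 hu, comp_zero] at h3
    exact mul_ne_zero (MvPolynomial.C_ne_zero.2 h1) hd h3.symm
  · have hρ := ordLE_extendSymbol n a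
    -- the component of weight `r` of the pairing is removed by subtracting a multiple of a basis
    -- vector; infinitely many of these steps add up to the vector `w`
    have step : ∀ (r : ℕ) (v : SatoSpace), ∃ c : ℂ, (pairingLead e a r = 0 → c = 0) ∧
        (pairing (extendSymbol n a) v ∈ ordIdeal r →
          pairing (extendSymbol n a) (v - SatoSpace.single (n - e + r) c) ∈ ordIdeal (r + 1)) := by
      intro r v
      by_cases hv : pairing (extendSymbol n a) v ∈ ordIdeal r
      · obtain ⟨c, hc0, hc⟩ := exists_comp_pairing_eq hW hτ ha hflat hord ht hP hdeg hlead hPc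
          ⟨k₀, hk₀⟩ n v hv
        refine ⟨c, hc0, fun _ => ?_⟩
        obtain ⟨h1, h2⟩ := pairing_extendSymbol_mem hord (n := n) (d := r)
          (u := SatoSpace.single (n - e + r) c) fun i hi => by
            rw [SatoSpace.coeff_single, if_neg (by omega)]
        rw [pairing_sub_right hρ]
        refine mem_ordIdeal_succ (Ideal.sub_mem _ hv h1) ?_
        rw [sub_eq_add_neg, comp_add, comp_neg, h2, hc, SatoSpace.coeff_single, if_pos rfl,
          add_neg_cancel]
      · exact ⟨0, fun _ => rfl, fun h => absurd h hv⟩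
    choose c hc0 hc using step
    let vs : ℕ → SatoSpace := fun r =>
      Nat.rec v (fun r x => x - SatoSpace.single (n - e + r) (c r x)) r
    have hvs : ∀ r, vs (r + 1) = vs r - SatoSpace.single (n - e + r) (c r (vs r)) := fun _ => rfl
    let w : SatoSpace := ⟨fun ν => if n - e ≤ ν then
      c (ν - (n - e)).toNat (vs (ν - (n - e)).toNat) else 0, n - e, fun ν hν => if_neg (by omega)⟩
    have hw : ∀ ν, w.coeff ν = if n - e ≤ ν then
      c (ν - (n - e)).toNat (vs (ν - (n - e)).toNat) else 0 := fun _ => rfl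
    refine ⟨w, fun ν hν => ?_, (mem_subspaceOf_iff hW.2 hτ ha n).2 ?_⟩
    · rw [hw] at hν
      split_ifs at hν with h
      · exact ⟨(ν - (n - e)).toNat, fun hd => hν (hc0 _ _ hd), by omega⟩
      · exact absurd rfl hν
    · have h1 : ∀ r : ℕ, ∀ ν, (vs r).coeff ν =
          v.coeff ν - if ν < n - e + r then w.coeff ν else 0 := by
        intro r
        induction r with
        | zero =>
          intro ν
          change v.coeff ν = _
          split_ifs with h
          · rw [hw, if_neg (by push_cast at h; omega), sub_zero]
          · rw [sub_zero]
        | succ r ih =>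
          intro ν
          rw [hvs, SatoSpace.coeff_sub, ih, SatoSpace.coeff_single]
          by_cases h : ν = n - e + r
          · subst h
            rw [if_neg (lt_irrefl _), if_pos rfl, if_pos (by push_cast; omega), hw,
              if_pos (by omega), show (n - e + r - (n - e) : ℤ).toNat = r by omega, sub_zero]
          · rw [if_neg h, sub_zero]
            congr 1
            refine if_congr ?_ rfl rfl
            push_cast
            omega
      have h2 : ∀ r : ℕ, pairing (extendSymbol n a) (vs r) ∈ ordIdeal r := by
        intro r
        induction r with
        | zero => exact mem_ordIdeal_zero _
        | succ r ih => exact hc r _ ih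
      refine eq_zero_of_forall_mem_ordIdeal fun r => ?_
      have h3 : SuppGE (n - e + r) (vs r - (v - w)) := fun ν hν => by
        rw [SatoSpace.coeff_sub, h1, SatoSpace.coeff_sub, if_pos hν, sub_self]
      have h4 := Ideal.sub_mem _ (h2 r) (pairing_extendSymbol_mem hord h3).1
      rwa [pairing_sub_right hρ (vs r), sub_sub_cancel] at h4

end Complement

/-! ### The Sato Grassmann manifold -/

/-- The vectors `∑_{ν ≥ M} c_ν e_ν`. -/
def suppGE (M : ℤ) : Submodule ℂ SatoSpace where
  carrier := {u | SuppGE M u}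
  zero_mem' := fun _ _ => rfl
  add_mem' := by
    intro u v hu hv ν hν
    rw [SatoSpace.coeff_add, hu ν hν, hv ν hν, add_zero]
  smul_mem' := by
    intro c u hu ν hν
    rw [SatoSpace.coeff_smul, hu ν hν, mul_zero]

theorem suppGE_anti {M N : ℤ} (h : M ≤ N) : suppGE N ≤ suppGE M :=
  fun _ hu ν hν => hu ν (by omega)

/-- The coordinates in a finite set of indices. -/
def coordMap (s : Finset ℤ) : SatoSpace →ₗ[ℂ] (s → ℂ) where
  toFun u i := u.coeff i
  map_add' _ _ := rfl
  map_smul' _ _ := rfl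

/-- The vector supported in a finite set with given coordinates. -/
def ofCoord (s : Finset ℤ) : (s → ℂ) →ₗ[ℂ] SatoSpace where
  toFun x := ⟨fun ν => if h : ν ∈ s then x ⟨ν, h⟩ else 0, by
    obtain ⟨N, hN⟩ := s.bddBelow
    exact ⟨N, fun ν hν => dif_neg fun h => absurd (hN h) (by omega)⟩⟩
  map_add' x y := by
    ext ν
    change (if h : ν ∈ s then x ⟨ν, h⟩ + y ⟨ν, h⟩ else 0) =
      (if h : ν ∈ s then x ⟨ν, h⟩ else 0) + if h : ν ∈ s then y ⟨ν, h⟩ else 0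
    split_ifs
    · rfl
    · rw [add_zero]
  map_smul' c x := by
    ext ν
    change (if h : ν ∈ s then c * x ⟨ν, h⟩ else 0) = c * if h : ν ∈ s then x ⟨ν, h⟩ else 0
    split_ifs
    · rfl
    · rw [mul_zero]

theorem coeff_ofCoord (s : Finset ℤ) (x : s → ℂ) (ν : ℤ) :
    (ofCoord s x).coeff ν = if h : ν ∈ s then x ⟨ν, h⟩ else 0 := rfl

section Charge

variable {U : Submodule ℂ SatoSpace} {M : ℤ}

theorem mem_ker_projMap {u : U} :
    u ∈ LinearMap.ker (projMap U) ↔ (u : SatoSpace) ∈ SatoSpaceZero := by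
  rw [LinearMap.mem_ker, projMap, LinearMap.comp_apply, Submodule.mkQ_apply,
    Submodule.Quotient.mk_eq_zero]
  rfl

/-- The part of `U ∩ 𝒱⁽ᴹ⁾` in `𝒱⁽⁰⁾`, for `M ≤ 0`. -/
def kerEquiv (hM : M ≤ 0) :
    LinearMap.ker (coordMap (Finset.Ico M 0) ∘ₗ (U ⊓ suppGE M).subtype) ≃ₗ[ℂ]
      LinearMap.ker (projMap U) := by
  refine (Submodule.equivSubtypeMap _ _).trans
    ((LinearEquiv.ofEq _ _ ?_).trans (Submodule.equivSubtypeMap _ _).symm)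
  ext u
  simp only [Submodule.mem_map, Subtype.exists, Submodule.coe_subtype, exists_and_right,
    exists_eq_right, mem_ker_projMap]
  constructor
  · rintro ⟨⟨h1, h2⟩, h3⟩
    refine ⟨h1, fun ν hν => ?_⟩
    by_cases h : ν < M
    · exact h2 ν h
    · exact congrFun (LinearMap.mem_ker.1 h3) ⟨ν, Finset.mem_Ico.2 ⟨by omega, hν⟩⟩
  · rintro ⟨h1, h2⟩
    exact ⟨⟨h1, fun ν hν => h2 ν (by omega)⟩, LinearMap.mem_ker.2 <| funext fun i =>
      h2 i (Finset.mem_Ico.1 i.2).2⟩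

theorem finiteDimensional_inf_suppGE (hM : M ≤ 0)
    [FiniteDimensional ℂ (LinearMap.ker (projMap U))] :
    FiniteDimensional ℂ (U ⊓ suppGE M : Submodule ℂ SatoSpace) := by
  set f := coordMap (Finset.Ico M 0) ∘ₗ (U ⊓ suppGE M).subtype
  have h1 : FiniteDimensional ℂ (LinearMap.ker f) := (kerEquiv hM).symm.finiteDimensional
  have h2 : FiniteDimensional ℂ (_ ⧸ LinearMap.ker f) :=
    f.quotKerEquivRange.symm.finiteDimensional
  exact Module.Finite.of_submodule_quotient (LinearMap.ker f)

/-- If `𝒱 = U + 𝒱⁽ᴹ⁾` with `M ≤ 0`, the charge of `U` is `dim (U ∩ 𝒱⁽ᴹ⁾) + M`. -/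
theorem mem_satoGrassmannian (hM : M ≤ 0) (hU : ∀ v, ∃ u ∈ U, v - u ∈ suppGE M)
    [FiniteDimensional ℂ (U ⊓ suppGE M : Submodule ℂ SatoSpace)] :
    U ∈ SatoGrassmannian (Module.finrank ℂ (U ⊓ suppGE M : Submodule ℂ SatoSpace) + M) := by
  set s := Finset.Ico M 0
  set f := coordMap s ∘ₗ (U ⊓ suppGE M).subtype with hf
  let g : (s → ℂ) →ₗ[ℂ] (SatoSpace ⧸ SatoSpaceZero) ⧸ LinearMap.range (projMap U) :=
    (LinearMap.range (projMap U)).mkQ ∘ₗ SatoSpaceZero.mkQ ∘ₗ ofCoord s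
  have hzero : ∀ v : SatoSpace, (LinearMap.range (projMap U)).mkQ (SatoSpaceZero.mkQ v) = 0 ↔
      ∃ u ∈ U, v - u ∈ SatoSpaceZero := by
    intro v
    rw [Submodule.mkQ_apply, Submodule.Quotient.mk_eq_zero, LinearMap.mem_range]
    constructor
    · rintro ⟨u, hu⟩
      exact ⟨u, u.2, (Submodule.Quotient.eq _).1 hu.symm⟩
    · rintro ⟨u, hu, h⟩
      exact ⟨⟨u, hu⟩, ((Submodule.Quotient.eq _).2 h).symm⟩
  have hg : Function.Surjective g := by
    intro z
    obtain ⟨y, rfl⟩ := Submodule.mkQ_surjective _ z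
    obtain ⟨v, rfl⟩ := Submodule.mkQ_surjective _ y
    obtain ⟨u, hu, h⟩ := hU v
    refine ⟨coordMap s (v - u), ?_⟩
    rw [← sub_eq_zero]
    change (LinearMap.range (projMap U)).mkQ (SatoSpaceZero.mkQ _) - _ = 0
    rw [← map_sub, ← map_sub, hzero]
    refine ⟨-u, U.neg_mem hu, fun ν hν => ?_⟩
    rw [sub_neg_eq_add, SatoSpace.coeff_add, SatoSpace.coeff_sub, coeff_ofCoord]
    by_cases hν' : ν ∈ s
    · rw [dif_pos hν']
      change (v - u).coeff ν - _ + _ = 0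
      rw [SatoSpace.coeff_sub]
      ring
    · have h1 := h ν (by by_contra h2; exact hν' (Finset.mem_Ico.2 ⟨by omega, hν⟩))
      rw [SatoSpace.coeff_sub] at h1
      rw [dif_neg hν', zero_sub, neg_add_eq_zero]
      exact sub_eq_zero.1 h1
  -- exactness of `U ∩ 𝒱⁽ᴹ⁾ → 𝒱⁽ᴹ⁾ / 𝒱⁽⁰⁾ → coker` in the middle
  have hker : LinearMap.ker g = LinearMap.range f := by
    ext x
    rw [LinearMap.mem_ker, LinearMap.mem_range]
    change (LinearMap.range (projMap U)).mkQ (SatoSpaceZero.mkQ (ofCoord s x)) = 0 ↔ _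
    rw [hzero]
    constructor
    · rintro ⟨u, hu, h⟩
      have hux : ∀ ν < 0, u.coeff ν = (ofCoord s x).coeff ν := fun ν hν => by
        have := h ν hν
        rw [SatoSpace.coeff_sub, sub_eq_zero] at this
        exact this.symm
      refine ⟨⟨u, hu, fun ν hν => ?_⟩, funext fun i => ?_⟩
      · rw [hux ν (by omega), coeff_ofCoord, dif_neg]
        intro h
        have := (Finset.mem_Ico.1 h).1
        omega
      · change u.coeff i = x i
        rw [hux i (Finset.mem_Ico.1 i.2).2, coeff_ofCoord, dif_pos i.2]
    · rintro ⟨u, rfl⟩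
      refine ⟨u, u.2.1, fun ν hν => ?_⟩
      rw [SatoSpace.coeff_sub, coeff_ofCoord]
      split_ifs with h
      · exact sub_self _
      · rw [zero_sub, neg_eq_zero]
        exact u.2.2 ν (by by_contra h2; exact h (Finset.mem_Ico.2 ⟨by omega, hν⟩))
  have h1 := LinearMap.finrank_range_add_finrank_ker f
  have h2 := LinearMap.finrank_range_add_finrank_ker g
  have h3 := (kerEquiv (U := U) hM).finrank_eq
  rw [hker, LinearMap.range_eq_top.2 hg, finrank_top, Module.finrank_fintype_fun_eq_card,
    Fintype.card_coe, Int.card_Ico] at h2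
  refine ⟨(kerEquiv hM).finiteDimensional, Module.Finite.of_surjective g hg, ?_⟩
  rw [← h3, ← hf]
  omega

theorem charge_unique {n n' : ℤ} (h : U ∈ SatoGrassmannian n) (h' : U ∈ SatoGrassmannian n') :
    n = n' := h.2.2.symm.trans h'.2.2

/-- As the cokernel is finite-dimensional, `𝒱 = U + 𝒱⁽ᴹ⁾` for some `M`. -/
theorem exists_sup_suppGE {n : ℤ} (h : U ∈ SatoGrassmannian n) :
    ∃ M ≤ 0, ∀ v, ∃ u ∈ U, v - u ∈ suppGE M := by
  have := h.2.1
  obtain ⟨m, s, hs⟩ :=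
    Module.Finite.exists_fin (R := ℂ)
      (M := (SatoSpace ⧸ SatoSpaceZero) ⧸ LinearMap.range (projMap U))
  have hsurj : Function.Surjective fun v : SatoSpace =>
      (LinearMap.range (projMap U)).mkQ (SatoSpaceZero.mkQ v) :=
    (Submodule.mkQ_surjective _).comp (Submodule.mkQ_surjective _)
  choose t ht using fun i => hsurj (s i)
  choose N hN using fun i => (t i).exists_suppGE
  obtain ⟨M, hM0, hMN⟩ : ∃ M ≤ 0, ∀ i, M ≤ N i := by
    obtain ⟨M, hM⟩ := (Set.finite_range N).bddBelow
    exact ⟨min M 0, min_le_right _ _, fun i => (min_le_left _ _).trans (hM ⟨i, rfl⟩)⟩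
  refine ⟨M, hM0, fun v => ?_⟩
  have hv : (LinearMap.range (projMap U)).mkQ (SatoSpaceZero.mkQ v) ∈
      Submodule.span ℂ (Set.range s) := by rw [hs]; trivial
  obtain ⟨c, hc⟩ := (Submodule.mem_span_range_iff_exists_fun ℂ).1 hv
  set w := ∑ i, c i • t i
  have hw : w ∈ suppGE M := Submodule.sum_mem _ fun i _ => Submodule.smul_mem _ _
    (suppGE_anti (hMN i) (hN i))
  have h1 : (LinearMap.range (projMap U)).mkQ (SatoSpaceZero.mkQ (v - w)) = 0 := by
    rw [map_sub, map_sub, ← hc, sub_eq_zero]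
    simp only [w, map_sum, map_smul]
    exact Finset.sum_congr rfl fun i _ => by rw [← ht i]
  rw [Submodule.mkQ_apply, Submodule.Quotient.mk_eq_zero, LinearMap.mem_range] at h1
  obtain ⟨u, hu⟩ := h1
  refine ⟨u, u.2, ?_⟩
  have h2 : v - w - u ∈ suppGE 0 := (Submodule.Quotient.eq _).1 hu.symm
  have h3 := Submodule.add_mem _ (suppGE_anti hM0 h2) hw
  rwa [show v - w - u + w = v - u by abel] at h3

theorem finrank_inf_suppGE {n : ℤ} (h : U ∈ SatoGrassmannian n) (hM : M ≤ 0)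
    (hU : ∀ v, ∃ u ∈ U, v - u ∈ suppGE M) :
    FiniteDimensional ℂ (U ⊓ suppGE M : Submodule ℂ SatoSpace) ∧
      (Module.finrank ℂ (U ⊓ suppGE M : Submodule ℂ SatoSpace) : ℤ) = n - M := by
  have := h.1
  have h1 := finiteDimensional_inf_suppGE (U := U) hM
  exact ⟨h1, by have := charge_unique (mem_satoGrassmannian hM hU) h; omega⟩

theorem exists_sup_suppGE_of_le {U' : Submodule ℂ SatoSpace} (hUU' : U ≤ U') {N : ℤ} (hMN : M ≤ N)
    (hU : ∀ v, ∃ u ∈ U, v - u ∈ suppGE N) : ∀ v, ∃ u ∈ U', v - u ∈ suppGE M := by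
  intro v
  obtain ⟨u, h1, h2⟩ := hU v
  exact ⟨u, hUU' h1, suppGE_anti hMN h2⟩

/-- The charge is monotone. -/
theorem charge_le {U' : Submodule ℂ SatoSpace} (hUU' : U ≤ U') {n n' : ℤ}
    (h : U ∈ SatoGrassmannian n) (h' : U' ∈ SatoGrassmannian n') : n ≤ n' := by
  obtain ⟨M, hM, hU⟩ := exists_sup_suppGE h
  obtain ⟨h1, h2⟩ := finrank_inf_suppGE h hM hU
  obtain ⟨h3, h4⟩ := finrank_inf_suppGE h' hM (exists_sup_suppGE_of_le hUU' le_rfl hU)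
  have := Submodule.finrank_mono (inf_le_inf_right (suppGE M) hUU')
  omega

/-- There are no strict inclusions between points of equal charge. -/
theorem eq_of_le_of_charge {U' : Submodule ℂ SatoSpace} (hUU' : U ≤ U') {n : ℤ}
    (h : U ∈ SatoGrassmannian n) (h' : U' ∈ SatoGrassmannian n) : U = U' := by
  obtain ⟨M, hM, hU⟩ := exists_sup_suppGE h
  obtain ⟨h1, h2⟩ := finrank_inf_suppGE h hM hU
  obtain ⟨h3, h4⟩ := finrank_inf_suppGE h' hM (exists_sup_suppGE_of_le hUU' le_rfl hU)
  have h5 := Submodule.eq_of_le_of_finrank_eq (inf_le_inf_right (suppGE M) hUU') (by omega)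
  refine le_antisymm hUU' fun u hu => ?_
  obtain ⟨w, hw, hwu⟩ := hU u
  have h6 : u - w ∈ U' ⊓ suppGE M := ⟨U'.sub_mem hu (hUU' hw), hwu⟩
  rw [← h5] at h6
  simpa using U.add_mem h6.1 hw

/-- A subspace complementary to the space of vectors supported in a subset of `n - e + ℕ` whose
complement there has `e` elements is of charge `n`. -/
theorem mem_satoGrassmannian_of_complement {n : ℤ} {e : ℕ} {Z : Set ℕ} (hZ : Z.Finite)
    (hcard : Z.ncard = e)
    (h1 : ∀ u ∈ U, (∀ ν, u.coeff ν ≠ 0 → ∃ d : ℕ, d ∉ Z ∧ ν = n - e + d) → u = 0)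
    (h2 : ∀ v, ∃ w : SatoSpace, (∀ ν, w.coeff ν ≠ 0 → ∃ d : ℕ, d ∉ Z ∧ ν = n - e + d) ∧
      v - w ∈ U) : U ∈ SatoGrassmannian n := by
  classical
  set M : ℤ := min 0 (n - e)
  have hM : M ≤ 0 := min_le_left _ _
  have hMn : M ≤ n - e := min_le_right _ _
  have hw : ∀ w : SatoSpace, (∀ ν, w.coeff ν ≠ 0 → ∃ d : ℕ, d ∉ Z ∧ ν = n - e + d) →
      w ∈ suppGE M := by
    intro w hw ν hν
    by_contra h
    obtain ⟨d, -, rfl⟩ := hw ν h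
    omega
  have hU : ∀ v, ∃ u ∈ U, v - u ∈ suppGE M := by
    intro v
    obtain ⟨w, h3, h4⟩ := h2 v
    exact ⟨v - w, h4, by rw [sub_sub_cancel]; exact hw w h3⟩
  -- the indices from `M` on in which the complement has no support
  set F : Finset ℤ := Finset.Ico M (n - e) ∪ hZ.toFinset.image fun d : ℕ => n - e + (d : ℤ) with hF
  have hmemF : ∀ ν, ν ∈ F ↔ (M ≤ ν ∧ ν < n - e) ∨ ∃ d ∈ Z, n - e + (d : ℤ) = ν := by
    intro ν
    simp only [hF, Finset.mem_union, Finset.mem_Ico, Finset.mem_image, Set.Finite.mem_toFinset]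
  have hFcard : (F.card : ℤ) = n - M := by
    rw [hF, Finset.card_union_of_disjoint, Int.card_Ico, Finset.card_image_of_injective _
      (fun x y h => by simpa using h), ← Set.ncard_eq_toFinset_card Z hZ, hcard]
    · push_cast
      omega
    · rw [Finset.disjoint_left]
      intro ν hν hν'
      obtain ⟨d, -, rfl⟩ := Finset.mem_image.1 hν'
      have := (Finset.mem_Ico.1 hν).2
      omega
  have hbij : Function.Bijective (coordMap F ∘ₗ (U ⊓ suppGE M).subtype) := by
    constructor
    · rw [injective_iff_map_eq_zero]
      intro u hu
      refine Subtype.ext (h1 u u.2.1 fun ν hν => ?_)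
      have h3 : ν ∉ F := fun h => hν (congrFun hu ⟨ν, h⟩)
      rw [hmemF, not_or] at h3
      have h4 : M ≤ ν := by
        by_contra h
        exact hν (u.2.2 ν (by omega))
      refine ⟨(ν - (n - e)).toNat, fun h => h3.2 ⟨_, h, ?_⟩, ?_⟩ <;>
      · have := h3.1
        omega
    · intro x
      obtain ⟨w, h3, h4⟩ := h2 (ofCoord F x)
      refine ⟨⟨ofCoord F x - w, h4, Submodule.sub_mem _ (fun ν hν => ?_) (hw w h3)⟩,
        funext fun i => ?_⟩
      · rw [coeff_ofCoord, dif_neg]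
        rw [hmemF]
        rintro (h | ⟨d, -, rfl⟩) <;> omega
      · change (ofCoord F x - w).coeff i = x i
        have h5 : w.coeff i = 0 := by
          by_contra h
          obtain ⟨d, hd, hi⟩ := h3 i h
          rcases (hmemF i).1 i.2 with h6 | ⟨d', hd', h6⟩
          · omega
          · have : d' = d := by omega
            exact hd (this ▸ hd')
        rw [SatoSpace.coeff_sub, coeff_ofCoord, dif_pos i.2, h5, sub_zero]
  let E := LinearEquiv.ofBijective _ hbij
  have hfd : FiniteDimensional ℂ (U ⊓ suppGE M : Submodule ℂ SatoSpace) :=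
    E.symm.finiteDimensional
  have h3 := mem_satoGrassmannian hM hU
  have h4 := E.finrank_eq
  rw [Module.finrank_fintype_fun_eq_card, Fintype.card_coe] at h4
  rwa [show (Module.finrank ℂ (U ⊓ suppGE M : Submodule ℂ SatoSpace) : ℤ) + M = n by omega] at h3

end Charge

/-- The subspace attached to a solution of the KP hierarchy belongs to the Sato Grassmann
manifold. -/
theorem subspaceOf_mem_satoGrassmannian {W : MicroDiffOp} (hW : W.IsWaveOperator)
    (hm : W.IsMeromorphic)
    (hflat : ∀ k : ℕ+, covD (dt k) (k : ℕ) W.coeff ∈ dSpan (dt 1) W.coeff) (n : ℤ) :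
    subspaceOf n W ∈ SatoGrassmannian n := by
  obtain ⟨e, Z, hZ, hcard, h1, h2⟩ := exists_complement hW hm hflat n
  exact mem_satoGrassmannian_of_complement hZ hcard h1 h2

/-! ### Existence of annihilators -/

/-- A map on families of power series that increases orders of differences has a fixed point. -/
theorem exists_fixed_point {ι : Type*} (Φ : (ι → TimeSeries) → ι → TimeSeries)
    (h : ∀ (D : ℕ) (x y : ι → TimeSeries), (∀ i, x i - y i ∈ ordIdeal D) →
      ∀ i, Φ x i - Φ y i ∈ ordIdeal (D + 1)) : ∃ x, Φ x = x := by
  let x : ℕ → ι → TimeSeries := fun k => Φ^[k] 0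
  have hx : ∀ k, x (k + 1) = Φ (x k) := fun k => Function.iterate_succ_apply' Φ k 0
  have h1 : ∀ k i, x (k + 1) i - x k i ∈ ordIdeal k := by
    intro k
    induction k with
    | zero => exact fun i => mem_ordIdeal_zero _
    | succ k ih =>
      intro i
      rw [hx (k + 1), hx k]
      exact h k _ _ (fun i => by rw [← hx k]; exact ih i) i
  have h2 : ∀ j k i, x (j + k) i - x j i ∈ ordIdeal j := by
    intro j k i
    induction k with
    | zero => rw [add_zero, sub_self]; exact Ideal.zero_mem _
    | succ k ih =>
      have := Ideal.add_mem _ (ordIdeal_anti (Nat.le_add_right j k) (h1 (j + k) i)) ih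
      rwa [sub_add_sub_cancel] at this
  let L : ι → TimeSeries := fun i α => MvPowerSeries.coeff α (x (wt α + 1) i)
  have hL : ∀ k i, L i - x k i ∈ ordIdeal k := by
    intro k i α hα
    obtain ⟨m, rfl⟩ := Nat.exists_eq_add_of_le (Nat.succ_le_of_lt hα)
    have := h2 (wt α + 1) m i α (Nat.lt_succ_self _)
    rw [map_sub, sub_eq_zero] at this ⊢
    exact this.symm
  refine ⟨L, funext fun i => eq_of_forall_sub_mem_ordIdeal fun k => ?_⟩
  have h3 := h k L (x k) (hL k) i
  rw [← hx k] at h3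
  have h4 := Ideal.sub_mem _ (ordIdeal_anti (Nat.le_succ k) h3)
    (ordIdeal_anti (Nat.le_succ k) (hL (k + 1) i))
  rwa [sub_sub_sub_cancel_right] at h4

/-- The vectors annihilated by a symbol. -/
def pairingKer {n : ℤ} {a : ℤ → TimeSeries} (ha : OrdLE n a) : Submodule ℂ SatoSpace where
  carrier := {u | pairing a u = 0}
  zero_mem' := pairing_zero_right a
  add_mem' := fun {u v} (hu : pairing a u = 0) (hv : pairing a v = 0) => by
    change pairing a (u + v) = 0
    rw [pairing_add_right ha, hu, hv, add_zero]
  smul_mem' := fun c u (hu : pairing a u = 0) => by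
    change pairing a (c • u) = 0
    rw [pairing_smul_right ha, hu, smul_zero]

section Reduced

variable {M : ℤ} {r : ℤ → SatoSpace}

/-- The reduced vectors `r ν ∈ e_ν + 𝒱⁽ᴹ⁾` agree with `e_ν` in the indices less than `M`. -/
theorem coeff_reduced (hr : ∀ ν, SatoSpace.single ν 1 - r ν ∈ suppGE M) {ν i : ℤ} (hi : i < M) :
    (r ν).coeff i = if i = ν then 1 else 0 := by
  have := hr ν i hi
  rw [SatoSpace.coeff_sub, sub_eq_zero, SatoSpace.coeff_single] at this
  exact this.symm

/-- The vectors `r ν ∈ e_ν + 𝒱⁽ᴹ⁾` pair with the symbols of order less than `M` by a matrix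
congruent to the identity modulo series of positive order. -/
theorem sub_pairing_mem (hr : ∀ ν, SatoSpace.single ν 1 - r ν ∈ suppGE M) {b : ℤ → TimeSeries}
    (hb : OrdLE (M - 1) b) {D : ℕ} (hD : ∀ i, b i ∈ ordIdeal D) {ν : ℤ} (hν : ν < M) :
    b ν - pairing b (r ν) ∈ ordIdeal (D + 1) := by
  have hsupp : SuppGE ν (r ν) := fun i hi => by
    rw [coeff_reduced hr (by omega), if_neg (by omega)]
  have h1 := pairing_sub_sum_mem hb hsupp le_rfl (lo := ν - D) (d := D + 1) (by push_cast; omega)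
  have hflow : ∀ i < M, flow (r ν) i - (if i = ν then 1 else 0) ∈ ordIdeal 1 := by
    intro i hi α hα
    obtain rfl := wt_eq_zero_iff.1 (Nat.lt_one_iff.1 hα)
    rw [map_sub, coeff_flow, wt_eq_zero_iff.2 rfl, Nat.cast_zero, add_zero, coeff_reduced hr hi]
    split_ifs <;> simp [invFact]
  have h2 : ∑ i ∈ Finset.Icc (ν - D) (M - 1), b i * flow (r ν) i - b ν ∈ ordIdeal (D + 1) := by
    have e : b ν = ∑ i ∈ Finset.Icc (ν - D) (M - 1), b i * (if i = ν then 1 else 0) := by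
      rw [Finset.sum_eq_single ν, if_pos rfl, mul_one]
      · intro i _ hi
        rw [if_neg hi, mul_zero]
      · intro h
        exact absurd (Finset.mem_Icc.2 ⟨by omega, by omega⟩) h
    rw [e, ← Finset.sum_sub_distrib]
    refine Ideal.sum_mem _ fun i hi => ?_
    rw [← mul_sub]
    exact mul_mem_ordIdeal (hD i) (hflow i (by have := (Finset.mem_Icc.1 hi).2; omega))
  have h3 := Ideal.neg_mem_iff _ |>.2 (Ideal.add_mem _ h1 h2)
  rwa [sub_add_sub_cancel, neg_sub] at h3

/-- A symbol of order less than `M` annihilating the reduced vectors has coefficients of arbitrarily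
high order, so it vanishes. -/
theorem eq_zero_of_pairing_reduced (hr : ∀ ν, SatoSpace.single ν 1 - r ν ∈ suppGE M)
    {b : ℤ → TimeSeries} (hb : OrdLE (M - 1) b) (h : ∀ ν < M, pairing b (r ν) = 0) : b = 0 := by
  funext i
  refine eq_zero_of_forall_mem_ordIdeal fun D => ?_
  induction D generalizing i with
  | zero => exact mem_ordIdeal_zero _
  | succ D ih =>
    rcases lt_or_ge i M with hi | hi
    · have := sub_pairing_mem hr hb ih hi
      rwa [h i hi, sub_zero] at this
    · rw [hb i (by omega)]
      exact Ideal.zero_mem _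

/-- The coefficients of index at least `M` being given, those of index less than `M` are found as
the fixed point of a contraction. -/
theorem exists_pairing_reduced (hr : ∀ ν, SatoSpace.single ν 1 - r ν ∈ suppGE M) {n : ℤ}
    (hn : M - 1 ≤ n) {c : ℤ → TimeSeries} (hc : OrdLE n c) :
    ∃ a : ℤ → TimeSeries, OrdLE n a ∧ (∀ i, M ≤ i → a i = c i) ∧ ∀ ν < M, pairing a (r ν) = 0 := by
  let glue : (ℤ → TimeSeries) → ℤ → TimeSeries := fun b i => if i < M then b i else c i
  have hglue : ∀ b, OrdLE n (glue b) := fun b i hi => by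
    simp only [glue, if_neg (show ¬ i < M by omega), hc i hi]
  obtain ⟨b, hb⟩ := exists_fixed_point
    (fun b ν => if ν < M then b ν - pairing (glue b) (r ν) else 0) (by
      intro D x y hxy ν
      split_ifs with hν
      · have hd : OrdLE (M - 1) fun i => glue x i + (-1) * glue y i := fun i hi => by
          simp only [glue, if_neg (show ¬ i < M by omega)]
          ring
        have h1 : pairing (fun i => glue x i + (-1) * glue y i) (r ν) =
            pairing (glue x) (r ν) - pairing (glue y) (r ν) := by
          rw [pairing_add_left (hglue x) ((hglue y).mul_left (-1)), pairing_mul_left (hglue y)]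
          ring
        have h2 := sub_pairing_mem hr hd (D := D) (fun i => by
          simp only [glue]
          split_ifs
          · rw [neg_one_mul, ← sub_eq_add_neg]
            exact hxy i
          · rw [neg_one_mul, add_neg_cancel]
            exact Ideal.zero_mem _) hν
        rw [h1] at h2
        simp only [glue, if_pos hν] at h2
        rw [show x ν - pairing (glue x) (r ν) - (y ν - pairing (glue y) (r ν)) =
          x ν + (-1) * y ν - (pairing (glue x) (r ν) - pairing (glue y) (r ν)) by ring]
        exact h2
      · rw [sub_zero]
        exact Ideal.zero_mem _)
  refine ⟨glue b, hglue b, fun i hi => if_neg (by omega), fun ν hν => ?_⟩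
  have := congrFun hb ν
  simp only [if_pos hν] at this
  exact sub_eq_self.1 this

end Reduced

section Annihilator

variable {U : Submodule ℂ SatoSpace}

theorem exists_reduced {M : ℤ} (hU : ∀ v, ∃ u ∈ U, v - u ∈ suppGE M) :
    ∃ r : ℤ → SatoSpace, (∀ ν, r ν ∈ U) ∧ ∀ ν, SatoSpace.single ν 1 - r ν ∈ suppGE M := by
  choose r h1 h2 using fun ν => hU (SatoSpace.single ν 1)
  exact ⟨r, h1, h2⟩

/-- The orders of the symbols annihilating a point of the Sato Grassmann manifold are bounded
below. -/
theorem exists_order_bound {n : ℤ} (h : U ∈ SatoGrassmannian n) :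
    ∃ M : ℤ, ∀ b : ℤ → TimeSeries, OrdLE (M - 1) b → (∀ u ∈ U, pairing b u = 0) → b = 0 := by
  obtain ⟨M, -, hU⟩ := exists_sup_suppGE h
  obtain ⟨r, h1, h2⟩ := exists_reduced hU
  exact ⟨M, fun b hb h3 => eq_zero_of_pairing_reduced h2 hb fun ν _ => h3 _ (h1 ν)⟩

/-- `U` is the sum of the span of the reduced vectors `r ν`, `ν < M`, and of `U ∩ 𝒱⁽ᴹ⁾`: for a
vector with support bounded below a finite combination of reduced vectors suffices. -/
theorem le_pairingKer {M n : ℤ} {r : ℤ → SatoSpace}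
    (hr : ∀ ν, SatoSpace.single ν 1 - r ν ∈ suppGE M) (hrU : ∀ ν, r ν ∈ U) {a : ℤ → TimeSeries}
    (ha : OrdLE n a) (h1 : ∀ ν < M, r ν ∈ pairingKer ha) (h2 : U ⊓ suppGE M ≤ pairingKer ha) :
    U ≤ pairingKer ha := by
  intro u hu
  obtain ⟨N, hN⟩ := u.exists_suppGE
  set w := ∑ ν ∈ Finset.Ico N M, u.coeff ν • r ν
  have hw : w ∈ U := Submodule.sum_mem _ fun ν _ => U.smul_mem _ (hrU ν)
  have hwk : w ∈ pairingKer ha := Submodule.sum_mem _ fun ν hν =>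
    Submodule.smul_mem _ _ (h1 ν (Finset.mem_Ico.1 hν).2)
  have hcoeff : ∀ i, w.coeff i = ∑ ν ∈ Finset.Ico N M, u.coeff ν * (r ν).coeff i := by
    intro i
    let ev : SatoSpace →ₗ[ℂ] ℂ :=
      { toFun := fun u => u.coeff i, map_add' := fun _ _ => rfl, map_smul' := fun _ _ => rfl }
    exact map_sum ev _ _
  have huw : u - w ∈ suppGE M := by
    intro i hi
    rw [SatoSpace.coeff_sub, hcoeff, sub_eq_zero]
    simp only [coeff_reduced hr hi, mul_ite, mul_one, mul_zero]
    rw [Finset.sum_ite_eq]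
    split_ifs with h
    · rfl
    · exact hN i (by by_contra h'; exact h (Finset.mem_Ico.2 ⟨by omega, hi⟩))
  have := Submodule.add_mem _ (h2 ⟨U.sub_mem hu hw, huw⟩) hwk
  simpa using this

/-- A point of charge `n` of the Sato Grassmann manifold is annihilated by a nonzero symbol of order
at most `n`: the equations for the reduced vectors determine the coefficients of order less than
`M`, and `n - M` equations are left for `n - M + 1` coefficients. -/
theorem exists_annihilator {n : ℤ} (h : U ∈ SatoGrassmannian n) :
    ∃ a : ℤ → TimeSeries, a ≠ 0 ∧ OrdLE n a ∧ ∀ u ∈ U, pairing a u = 0 := by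
  obtain ⟨M, hM, hU⟩ := exists_sup_suppGE h
  obtain ⟨hfd, hdim⟩ := finrank_inf_suppGE h hM hU
  obtain ⟨r, hrU, hr⟩ := exists_reduced hU
  -- the symbols of order at most `n` annihilating the reduced vectors; a free module of rank
  -- `n - M + 1`
  let A₀ : Submodule TimeSeries (ℤ → TimeSeries) :=
    { carrier := {a | OrdLE n a ∧ ∀ ν < M, pairing a (r ν) = 0}
      zero_mem' := ⟨fun _ _ => rfl, fun ν _ => by
        have := pairing_mul_left (n := n) (a := 0) (fun _ _ => rfl) 0 (r ν)
        simp only [zero_mul] at this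
        exact this⟩
      add_mem' := fun {a b} ha hb => ⟨fun i hi => by
        rw [Pi.add_apply, ha.1 i hi, hb.1 i hi, add_zero], fun ν hν => by
        have := pairing_add_left ha.1 hb.1 (r ν)
        rw [ha.2 ν hν, hb.2 ν hν, add_zero] at this
        exact this⟩
      smul_mem' := fun f a ha => ⟨ha.1.mul_left f, fun ν hν => by
        have := pairing_mul_left ha.1 f (r ν)
        rw [ha.2 ν hν, mul_zero] at this
        exact this⟩ }
  let res : A₀ →ₗ[TimeSeries] (Finset.Icc M n → TimeSeries) :=
    LinearMap.funLeft TimeSeries TimeSeries (fun i : Finset.Icc M n => (i : ℤ)) ∘ₗ A₀.subtype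
  have hres : Function.Bijective res := by
    constructor
    · rw [injective_iff_map_eq_zero]
      rintro ⟨a, ha⟩ h0
      refine Subtype.ext (eq_zero_of_pairing_reduced hr (fun i hi => ?_) ha.2)
      by_cases hin : i ≤ n
      · exact congrFun h0 ⟨i, Finset.mem_Icc.2 ⟨by omega, hin⟩⟩
      · exact ha.1 i (by omega)
    · intro x
      obtain ⟨a, h1, h2, h3⟩ := exists_pairing_reduced hr (show M - 1 ≤ n by omega)
        (c := fun i => if hi : i ∈ Finset.Icc M n then x ⟨i, hi⟩ else 0) fun i hi =>
          dif_neg fun h => by have := (Finset.mem_Icc.1 h).2; omega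
      refine ⟨⟨a, h1, h3⟩, funext fun i => ?_⟩
      change a i = x i
      rw [h2 i (Finset.mem_Icc.1 i.2).1, dif_pos i.2]
  let E := LinearEquiv.ofBijective res hres
  let t := Module.finBasis ℂ (U ⊓ suppGE M : Submodule ℂ SatoSpace)
  let ψ : A₀ →ₗ[TimeSeries]
      (Fin (Module.finrank ℂ (U ⊓ suppGE M : Submodule ℂ SatoSpace)) → TimeSeries) :=
    { toFun := fun a j => pairing a.1 (t j)
      map_add' := fun a b => funext fun j => pairing_add_left a.2.1 b.2.1 _
      map_smul' := fun f a => funext fun j => pairing_mul_left a.2.1 f _ }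
  have hψ : ¬ Function.Injective ψ := by
    intro hinj
    have h1 := card_le_of_injective TimeSeries (ψ ∘ₗ E.symm.toLinearMap)
      (hinj.comp E.symm.injective)
    rw [Fintype.card_coe, Int.card_Icc, Fintype.card_fin] at h1
    omega
  rw [injective_iff_map_eq_zero] at hψ
  push Not at hψ
  obtain ⟨a, ha, ha0⟩ := hψ
  refine ⟨a.1, fun h => ha0 (Subtype.ext h), a.2.1, fun u hu => ?_⟩
  refine le_pairingKer hr hrU a.2.1 a.2.2 ?_ hu
  intro w hw
  have h1 := t.sum_repr ⟨w, hw⟩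
  have h2 : w = ∑ j, t.repr ⟨w, hw⟩ j • (t j : SatoSpace) := by
    have := congrArg (Submodule.subtype _) h1
    rw [map_sum] at this
    exact this.symm
  rw [h2]
  exact Submodule.sum_mem _ fun j _ => Submodule.smul_mem _ _ (congrFun ha j)

end Annihilator

/-! ### The wave operator of a point of the Sato Grassmann manifold -/

/-- The symbols over the field of fractions annihilating `U`. -/
def annihilator (U : Submodule ℂ SatoSpace) : Submodule TimeField (ℤ → TimeField) where
  carrier := {A | ∀ u ∈ U, (A, 0) ∈ PairRel u}
  zero_mem' := fun u _ => (PairRel u).zero_mem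
  add_mem' := fun {A B} hA hB u hu => by
    have := (PairRel u).add_mem (hA u hu) (hB u hu)
    rwa [Prod.mk_add_mk, add_zero] at this
  smul_mem' := fun c A hA u hu => by
    have := (PairRel u).smul_mem c (hA u hu)
    rwa [Prod.smul_mk, smul_zero] at this

/-- A vector annihilated by `A` is annihilated by the left module generated by `A`. -/
theorem pairRel_of_mem_dSpan {u : SatoSpace} {A B : ℤ → TimeField} (hA : (A, 0) ∈ PairRel u)
    (hB : B ∈ dSpan (dt 1) A) : (B, 0) ∈ PairRel u := by
  obtain ⟨m, g, rfl⟩ := mem_gSpan_iff.1 hB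
  have := sum_mem_pairRel hA m g
  simpa only [MicroDiffOp.iterate_dt_zero, smul_zero, Finset.sum_const_zero] using this

section

variable {U : Submodule ℂ SatoSpace} {A B : ℤ → TimeField} {n : ℤ}

/-- The annihilator is stable under all flows: differentiate the relation `⟨A, u⟩ = 0`. -/
theorem covD_mem_annihilator (hA : A ∈ annihilator U) (k : ℕ+) :
    covD (dt k) (k : ℕ) A ∈ annihilator U := fun u hu => by
  have := pairRel_covD (hA u hu) k
  rwa [dt_zero] at this

theorem iterate_covD_mem_annihilator (hA : A ∈ annihilator U) (i : ℕ) :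
    (covD (dt 1) 1)^[i] A ∈ annihilator U := by
  induction i with
  | zero => exact hA
  | succ i ih =>
    rw [Function.iterate_succ_apply']
    exact covD_mem_annihilator ih 1

theorem exists_denominator (hA : A ∈ annihilator U) :
    ∃ (τ : TimeSeries) (a : ℤ → TimeSeries) (N : ℤ), τ ≠ 0 ∧ OrdLE N a ∧
      ∀ i, algebraMap TimeSeries TimeField (a i) = algebraMap TimeSeries TimeField τ * A i := by
  obtain ⟨τ, a, N, h1, h2, h3, -⟩ := mem_pairRel.1 (hA 0 U.zero_mem)
  exact ⟨τ, a, N, h1, h2, h3⟩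

theorem ordLE_iff_of_denominator {τ : TimeSeries} {a : ℤ → TimeSeries} (hτ : τ ≠ 0)
    (h : ∀ i, algebraMap TimeSeries TimeField (a i) = algebraMap TimeSeries TimeField τ * A i)
    {N : ℤ} : OrdLE N a ↔ OrdLE N A := by
  refine forall₂_congr fun i _ => ?_
  rw [← algebraMap_injective.eq_iff, h, map_zero,
    mul_eq_zero_iff_left (algebraMap_ne_zero hτ)]

/-- The orders of the annihilating symbols over the field of fractions are bounded below. -/
theorem exists_annihilator_bound (h : U ∈ SatoGrassmannian n) :
    ∃ M : ℤ, ∀ A ∈ annihilator U, OrdLE (M - 1) A → A = 0 := by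
  obtain ⟨M, hM⟩ := exists_order_bound h
  refine ⟨M, fun A hA hord => ?_⟩
  obtain ⟨τ, a, N, hτ, ha, h1⟩ := exists_denominator hA
  have h2 := hM a ((ordLE_iff_of_denominator hτ h1).2 hord) fun u hu => by
    have := pairRel_unique (hA u hu) ha h1
    rw [mul_zero] at this
    exact algebraMap_injective (this.trans (map_zero _).symm)
  funext i
  have h3 := h1 i
  rw [h2, Pi.zero_apply, map_zero, eq_comm] at h3
  exact (mul_eq_zero.1 h3).resolve_left (algebraMap_ne_zero hτ)

theorem exists_mem_annihilator (h : U ∈ SatoGrassmannian n) :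
    ∃ A ∈ annihilator U, A ≠ 0 ∧ OrdLE n A := by
  obtain ⟨a, ha0, ha, h1⟩ := exists_annihilator h
  refine ⟨fun i => algebraMap TimeSeries TimeField (a i), fun u hu => mem_pairRel.2
    ⟨1, a, n, one_ne_zero, ha, fun i => by rw [map_one, one_mul],
      by rw [h1 u hu, map_zero, mul_zero]⟩,
    fun h0 => ha0 (funext fun i => algebraMap_injective ?_), fun i hi => by
      simp only [ha i hi, map_zero]⟩
  rw [Pi.zero_apply, map_zero]
  exact congrFun h0 i

/-- An annihilating operator of minimal order generates all annihilating operators. -/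
theorem exists_minimal_waveOperator (h : U ∈ SatoGrassmannian n) :
    ∃ m ≤ n, ∃ W : MicroDiffOp, W.IsWaveOperator ∧ W.IsMeromorphic ∧
      shiftSym m W.coeff ∈ annihilator U ∧ (∀ B ∈ annihilator U, OrdLE (m - 1) B → B = 0) ∧
      annihilator U ≤ dSpan (dt 1) (shiftSym m W.coeff) := by
  obtain ⟨M, hM⟩ := exists_annihilator_bound h
  obtain ⟨m, ⟨A, hA, hA0, hAm⟩, hmin⟩ := Int.exists_least_of_bdd
    (P := fun m => ∃ A ∈ annihilator U, A ≠ 0 ∧ OrdLE m A)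
    ⟨M, by
      rintro m ⟨A, hA, hA0, hAm⟩
      by_contra hlt
      exact hA0 (hM A hA (hAm.mono (by omega)))⟩
    ⟨n, exists_mem_annihilator h⟩
  have hmin' : ∀ B ∈ annihilator U, OrdLE (m - 1) B → B = 0 := by
    intro B hB hord
    by_contra hB0
    have := hmin _ ⟨B, hB, hB0, hord⟩
    omega
  have hlc : A m ≠ 0 := fun h0 => hA0 <| hmin' A hA fun i hi => by
    rcases eq_or_lt_of_le (show m ≤ i by omega) with rfl | h1
    · exact h0
    · exact hAm i h1
  set W : MicroDiffOp := ⟨fun i => (A m)⁻¹ * A (i + m), 0, fun i hi => by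
    rw [hAm (i + m) (by omega), mul_zero]⟩ with hW
  have hWA : shiftSym m W.coeff = (A m)⁻¹ • A := by
    funext i
    simp only [shiftSym, hW, sub_add_cancel, Pi.smul_apply, smul_eq_mul]
  have hWann : shiftSym m W.coeff ∈ annihilator U := by
    rw [hWA]
    exact Submodule.smul_mem _ _ hA
  have hwave : W.IsWaveOperator :=
    ⟨by simp only [hW, zero_add, inv_mul_cancel₀ hlc], fun i hi => by
      simp only [hW, hAm _ (show m < i + m by omega), mul_zero]⟩
  refine ⟨m, hmin _ (exists_mem_annihilator h), W, hwave, ?_, hWann, hmin', fun B hB => ?_⟩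
  · obtain ⟨τ, a, N, hτ, -, h1⟩ := exists_denominator hWann
    refine ⟨τ, fun j => a (m - j), hτ, fun j => ?_⟩
    rw [h1, shiftSym]
    congr 2
    ring
  · obtain ⟨k, hk⟩ : ∃ k : ℕ, OrdLE (m - 1 + k) B := by
      obtain ⟨τ, a, N, hτ, ha, h1⟩ := exists_denominator hB
      exact ⟨(N - m + 1).toNat, ((ordLE_iff_of_denominator hτ h1).1 ha).mono (by omega)⟩
    induction k generalizing B with
    | zero =>
      rw [hmin' B hB (by simpa using hk)]
      exact Submodule.zero_mem _
    | succ k ih =>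
      set T := (covD (dt 1) 1)^[k] (shiftSym m W.coeff) with hT
      have hT' : T = shiftSym m ((covD (dt 1) 1)^[k] W.coeff) := iterate_covD_shiftSym _ _ _ _ _
      have htop := coeff_iterate_covD hwave.1 hwave.2 k
      have h1 := ih (B - B (m + k) • T) (Submodule.sub_mem _ hB
        (Submodule.smul_mem _ _ (iterate_covD_mem_annihilator hWann k))) fun i hi => by
          rw [Pi.sub_apply, Pi.smul_apply, smul_eq_mul, hT', shiftSym]
          rcases eq_or_lt_of_le (show m + k ≤ i by omega) with rfl | h2
          · rw [add_sub_cancel_left, htop.2, mul_one, sub_self]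
          · rw [htop.1 _ (by omega), hk i (by push_cast; omega), mul_zero, sub_self]
      have h2 := Submodule.add_mem _ h1 (Submodule.smul_mem _ (B (m + k)) (iterate_mem_gSpan k))
      rwa [sub_add_cancel] at h2

/-- A point of charge `n` of the Sato Grassmann manifold is the subspace attached to a solution,
whose wave operator generates the annihilator. -/
theorem exists_waveOperator (h : U ∈ SatoGrassmannian n) :
    ∃ W : MicroDiffOp, W.IsWaveOperator ∧ W.IsMeromorphic ∧
      (∀ k : ℕ+, covD (dt k) (k : ℕ) W.coeff ∈ dSpan (dt 1) W.coeff) ∧ subspaceOf n W = U ∧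
      (∀ B ∈ annihilator U, OrdLE (n - 1) B → B = 0) ∧
      annihilator U ≤ dSpan (dt 1) (shiftSym n W.coeff) := by
  obtain ⟨m, hmn, W, hW, hm, hann, hmin, hspan⟩ := exists_minimal_waveOperator h
  have hflat : ∀ k : ℕ+, covD (dt k) (k : ℕ) W.coeff ∈ dSpan (dt 1) W.coeff := by
    intro k
    have h1 := shiftSym_mem_dSpan (-m) (hspan (covD_mem_annihilator hann k))
    rwa [covD_shiftSym, shiftSym_shiftSym, shiftSym_shiftSym, neg_add_cancel, shiftSym_zero,
      shiftSym_zero] at h1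
  have hle : U ≤ subspaceOf m W := fun u hu =>
    (mem_subspaceOf_iff_pairRel hW.2 hm m).2 (hann u hu)
  have hS := subspaceOf_mem_satoGrassmannian hW hm hflat m
  obtain rfl : m = n := le_antisymm hmn (charge_le hle h hS)
  exact ⟨W, hW, hm, hflat, (eq_of_le_of_charge hle h hS).symm, hmin, hspan⟩

theorem shiftSym_mem_annihilator {W : MicroDiffOp} (hW : W.IsWaveOperator) (hm : W.IsMeromorphic)
    (hU : U ≤ subspaceOf n W) : shiftSym n W.coeff ∈ annihilator U := fun _ hu =>
  (mem_subspaceOf_iff_pairRel hW.2 hm n).1 (hU hu)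

/-- The difference of two wave operators with the same subspace gives an annihilating symbol of
order less than `n`, which vanishes. -/
theorem waveOperator_unique (h : U ∈ SatoGrassmannian n) {W W' : MicroDiffOp}
    (hW : W.IsWaveOperator) (hm : W.IsMeromorphic) (hU : subspaceOf n W = U)
    (hW' : W'.IsWaveOperator) (hm' : W'.IsMeromorphic) (hU' : subspaceOf n W' = U) : W = W' := by
  obtain ⟨-, -, -, -, -, hmin, -⟩ := exists_waveOperator h
  have h1 := hmin _ (Submodule.sub_mem _ (shiftSym_mem_annihilator hW hm hU.ge)
    (shiftSym_mem_annihilator hW' hm' hU'.ge)) fun i hi => by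
      rw [Pi.sub_apply, shiftSym, shiftSym]
      rcases eq_or_lt_of_le (show n ≤ i by omega) with rfl | h2
      · rw [sub_self, hW.1, hW'.1, sub_self]
      · rw [hW.2 _ (by omega), hW'.2 _ (by omega), sub_self]
  ext i
  have h2 := congrFun h1 (i + n)
  rw [Pi.sub_apply, shiftSym, shiftSym, add_sub_cancel_right] at h2
  exact sub_eq_zero.1 h2

end

/-! ### The correspondence -/

section

variable {S : Set ℤ} {n : S → ℤ}

theorem MicroDiffOp.inverse_unique {W V V' : MicroDiffOp} (h : V * W = 1) (h' : W * V' = 1) :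
    V = V' := by
  rw [← mul_one' V, ← h', ← MicroDiffOp.mul_assoc, h, one_mul']

/-- The left module generated by a solution is stable under all flows. -/
theorem flat_of_mem_solutions {W : S → MicroDiffOp} (hW : W ∈ Solutions n) (s : S) (k : ℕ+) :
    covD (dt k) (k : ℕ) (W s).coeff ∈ dSpan (dt 1) (W s).coeff := by
  obtain ⟨h1, V, h2, h3, -⟩ := hW
  obtain ⟨V', hV', h4, h5⟩ := (h1 s).1.exists_inverse
  have hV : V s = V' := MicroDiffOp.inverse_unique (h2 s).2 h4
  exact (MicroDiffOp.sato_iff (h1 s).1 (h2 s).1 (h2 s).2 (hV ▸ hV') k).1 (h3 s k)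

theorem flagOf_mem_flag {W : S → MicroDiffOp} (hW : W ∈ Solutions n) : flagOf n W ∈ Flag n := by
  refine ⟨fun s => subspaceOf_mem_satoGrassmannian (hW.1 s).1 (hW.1 s).2
    (flat_of_mem_solutions hW s) (n s), fun s s' hs u hu => ?_⟩
  obtain ⟨h1, V, h2, -, h3⟩ := hW
  have h4 := shiftSym_mem_dSpan (n s) ((MicroDiffOp.negPart_eq_zero_iff (h2 s).1 (h2 s).2 _).1
    (h3 s s' hs))
  change shiftSym (n s) (shiftSym (n s' - n s) (W s').coeff) ∈ _ at h4
  rw [shiftSym_shiftSym, add_sub_cancel] at h4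
  exact (mem_subspaceOf_iff_pairRel (h1 s').1.2 (h1 s').2 (n s')).2 (pairRel_of_mem_dSpan
    ((mem_subspaceOf_iff_pairRel (h1 s).1.2 (h1 s).2 (n s)).1 hu) h4)

theorem injOn_flagOf : Set.InjOn (flagOf n) (Solutions n) := by
  intro W hW W' hW' h
  funext s
  exact waveOperator_unique ((flagOf_mem_flag hW).1 s) (hW.1 s).1 (hW.1 s).2 rfl (hW'.1 s).1
    (hW'.1 s).2 (congrFun h s).symm

theorem surjOn_flagOf : Set.SurjOn (flagOf n) (Solutions n) (Flag n) := by
  intro U hU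
  choose W h1 h2 h3 h4 h5 h6 using fun s => exists_waveOperator (hU.1 s)
  choose V hV hWV hVW using fun s => (h1 s).exists_inverse
  refine ⟨W, ⟨fun s => ⟨h1 s, h2 s⟩, V, fun s => ⟨hWV s, hVW s⟩, fun s k =>
    (MicroDiffOp.sato_iff (h1 s) (hWV s) (hVW s) (hV s) k).2 (h3 s k), fun s s' hs => ?_⟩,
    funext h4⟩
  rw [MicroDiffOp.negPart_eq_zero_iff (hWV s) (hVW s)]
  have h7 : shiftSym (n s') (W s').coeff ∈ annihilator (U s) :=
    shiftSym_mem_annihilator (h1 s') (h2 s') ((hU.2 s s' hs).trans (h4 s').ge)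
  have h8 := shiftSym_mem_dSpan (-n s) (h6 s h7)
  rwa [shiftSym_shiftSym, shiftSym_shiftSym, neg_add_cancel, shiftSym_zero, neg_add_eq_sub] at h8

end

end

end MKP

theorem mainTheorem1 (S : Set ℤ) (hS : S.Nonempty) (hS' : S.OrdConnected)
    (n : S → ℤ) (hn : StrictMono n) :
    Set.BijOn (MKP.flagOf n) (MKP.Solutions n) (MKP.Flag n) := by
  exact ⟨fun _ hW => MKP.flagOf_mem_flag hW, MKP.injOn_flagOf, MKP.surjOn_flagOf⟩
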